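/- Let $m\in\mathbb{N}$ and $\mathbb{Z}^+=\{0,1,2,\dots\}$. Let $f:\mathbb{R}^m\to\mathbb{R}^m$ and $\Sigma:\mathbb{R}^m\to\mathbb{R}^{m\times m}$ be $C^2$, with $\Sigma$ bounded and $\Sigma(x)$ invertible for every $x$, and let $\Delta_{\max}>0$ and $\tau>0$. Suppose that there are $\alpha,\beta>0$ with $\tau<2\beta$ and $\langle f(x),x\rangle\le\alpha-\beta|x|^2$ for all $x\in\mathbb{R}^m$. Put $$\mathcal{G}(x,l)=\min\{k\in\mathbb{Z}^+:\ |f(x+2^{-k}\Delta_{\max}f(x))-f(x)|\le\tau\ \text{and}\ k\ge l-1\},$$ $$k^\star(x)=\min\{k\in\mathbb{Z}^+:\ |f(x+2^{-j}\Delta_{\max}f(x))-f(x)|\le\tau\ \text{for all integers } j\ge k\},$$ and suppose that $k^\star(\bar y)=\mathcal{G}(\bar y,1)$ for at least one $\bar y\in\mathbb{R}^m$. Let $\eta_1,\eta_2,\dots$ be i.i.d. $\mathcal{N}(0,I)$ in $\mathbb{R}^m$. From given $x_0\in\mathbb{R}^m$ and $k_{-1}\in\mathbb{Z}^+$ define,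 for $n\ge0$, $$k_n=\mathcal{G}(x_n,k_{n-1}),\quad \Delta_n=2^{-k_n}\Delta_{\max},\quad x_{n+1}=x_n+\Delta_nf(x_n)+\sqrt{\Delta_n}\,\Sigma(x_n)\eta_{n+1},$$ $$t_0=0,\quad t_{n+1}=t_n+\Delta_n.$$ For $\delta>0$ let $N_0=0$, $N_j=\inf\{n\ge0:\ t_n\ge\delta+t_{N_{j-1}}\}$ for $j\ge1$, and $(y_j,l_j)=(x_{N_j+1},k_{N_j})$ for $j\ge0$. Assume that $\delta>5\Delta_{\max}$. Then, for every $(x_0,k_{-1})$, all the $N_j$ are almost surely finite and $\{(y_j,l_j)\}_{j\ge0}$ is a time-homogeneous Markov chain on $\mathbb{R}^m\times\mathbb{Z}^+$, with a transition kernel $P$ that does not depend on $(x_0,k_{-1})$; here $P((y,l),\cdot)$ is the law of $(y_1,l_1)$ given $(y_0,l_0)=(x_1,k_0)=(y,l)$. This chain has a unique invariant probability measure $\pi$. Furthermore, if $h:\mathbb{R}^m\times\mathbb{Z}^+\to\mathbb{R}$ is measurable and $|h(y,l)|\le1+|y|^2$ for all $(y,l)$, then $h$ is $\pi$-integrable and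 there exist $\lambda\in(0,1)$ and $\kappa\in(0,\infty)$ such that, for all $(y,l)\in\mathbb{R}^m\times\mathbb{Z}^+$ and all $n\ge0$, $$|\mathbb{E}^{y,l}h(y_n,l_n)-\pi(h)|\le\kappa\lambda^n[1+|y|^2],$$ where the expectation is finite. This holds both when $\mathbb{E}^{y,l}$ denotes the expectation for the sampled chain started at $(y_0,l_0)=(y,l)$, that is $\mathbb{E}^{y,l}h(y_n,l_n)=(P^nh)(y,l)$, and when it denotes the expectation for the scheme started at $x_0=y$, $k_{-1}=l$. -/

import Mathlib

open MeasureTheory ProbabilityTheory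

noncomputable section

namespace AdaptiveEM

/-- `ℝ^m` with the Euclidean norm. -/
abbrev Vec (m : ℕ) : Type := EuclideanSpace ℝ (Fin m)

/-- The state space `ℝ^m × ℤ⁺`, where `ℤ⁺ = {0, 1, 2, …}`. -/
abbrev State (m : ℕ) : Type := Vec m × ℕ

/-- The data of the adaptive scheme: drift `f`, diffusion matrix `g` (as a linear map at each
point), tolerance `τ`, maximal step `Δmax`, and spacing `δ` of the sampling times. -/
structure Scheme (m : ℕ) where
  f : Vec m → Vec m
  g : Vec m → (Vec m →L[ℝ] Vec m)
  τ : ℝ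
  Δmax : ℝ
  δ : ℝ

namespace Scheme

variable {m : ℕ} (S : Scheme m)

/-- The step size `2^{-k} Δmax` attached to the level `k`. -/
def stepSize (k : ℕ) : ℝ := (2 : ℝ)⁻¹ ^ k * S.Δmax

/-- The deterministic Euler step `H(x, t) = x + t f(x)`. -/
def euler (x : Vec m) (t : ℝ) : Vec m := x + t • S.f x

/-- The error control `|f(H(x, 2^{-k} Δmax)) - f(x)| ≤ τ`. -/
def Accept (x : Vec m) (k : ℕ) : Prop :=
  ‖S.f (S.euler x (S.stepSize k)) - S.f x‖ ≤ S.τ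

/-- `G(x, l) = min {k : the error control holds at level k, and k ≥ l - 1}`. -/
def level (x : Vec m) (l : ℕ) : ℕ := sInf {k : ℕ | S.Accept x k ∧ l ≤ k + 1}

/-- `k⋆(x) = min {k : the error control holds at every level ≥ k}`. -/
def kStar (x : Vec m) : ℕ := sInf {k : ℕ | ∀ j : ℕ, k ≤ j → S.Accept x j}

/-- One step `(x_n, k_{n-1}) ↦ (x_{n+1}, k_n)`, driven by the noise value `e = η_{n+1}`. -/
def step (z : State m) (e : Vec m) : State m :=
  (S.euler z.1 (S.stepSize (S.level z.1 z.2))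
      + √(S.stepSize (S.level z.1 z.2)) • S.g z.1 e,
    S.level z.1 z.2)

/-- The chain started at `z = (x_0, k_{-1})`: `S.chain z η n = (x_n, k_{n-1})`.
The sequence `η` is indexed from `0`, so that its entry `n` is the noise of the step from
`x_n` to `x_{n+1}`. -/
def chain (z : State m) (η : ℕ → Vec m) : ℕ → State m
  | 0 => z
  | n + 1 => S.step (chain z η n) (η n)

/-- The times `t_0 = 0`, `t_{n+1} = t_n + Δ_n`, where `Δ_n = 2^{-k_n} Δmax`
and `k_n` is the second component of `S.chain z η (n + 1)`. -/
def time (z : State m) (η : ℕ → Vec m) : ℕ → ℝ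
  | 0 => 0
  | n + 1 => time z η n + S.stepSize (S.chain z η (n + 1)).2

/-- The random indices `N_0 = 0`, `N_{j+1} = inf {n : t_n ≥ δ + t_{N_j}}`. -/
def sampleIdx (z : State m) (η : ℕ → Vec m) : ℕ → ℕ
  | 0 => 0
  | j + 1 => sInf {n : ℕ | S.δ + S.time z η (sampleIdx z η j) ≤ S.time z η n}

/-- The sampled chain `(y_j, l_j) = (x_{N_j + 1}, k_{N_j})`, for `(x_0, k_{-1}) = z`. -/
def sampled (z : State m) (j : ℕ) (η : ℕ → Vec m) : State m :=
  S.chain z η (S.sampleIdx z η j + 1)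

/-- The law of the i.i.d. `N(0, I)` noise sequence. -/
def noise (m : ℕ) : Measure (ℕ → Vec m) :=
  Measure.infinitePi (fun _ : ℕ => stdGaussian (Vec m))

/-- The number of full steps made after the state `(x_{N+1}, k_N) = w` until the next sampling
time, where `N` is a sampling time. The step of size `2^{-k_N} Δmax` from `t_N` to `t_{N+1}` has
already been made in this state, and it counts towards the spacing `δ`. -/
def wait (w : State m) (η : ℕ → Vec m) : ℕ :=
  sInf {n : ℕ | S.δ ≤ S.stepSize w.2 + S.time w η n}

/-- The transition probabilities `P(w, ·) = ℙ((y_1, l_1) ∈ · | (y_0, l_0) = w)` of the sampled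
chain. -/
def transition (w : State m) : Measure (State m) :=
  (noise m).map (fun η => S.chain w η (S.wait w η + 1))

/-- The sigma-algebra generated by `(y_0, l_0), …, (y_j, l_j)`. -/
abbrev past (z : State m) (j : ℕ) : MeasurableSpace (ℕ → Vec m) :=
  ⨆ i : Fin (j + 1), MeasurableSpace.comap (S.sampled z i) inferInstance

/-- The assumptions on the scheme: `f` and `g` are `C²`, `f` is dissipative with constants
`α, β`, `g` is bounded and pointwise invertible, `0 < τ < 2β`, `Δmax > 0`, and `k⋆(y) = G(y, 1)`
for some `y`. -/
structure Admissible : Prop where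
  contDiff_f : ContDiff ℝ 2 S.f
  contDiff_g : ContDiff ℝ 2 S.g
  dissipative : ∃ α β : ℝ, 0 < α ∧ 0 < β ∧ S.τ < 2 * β ∧
    ∀ x : Vec m, inner ℝ (S.f x) x ≤ α - β * ‖x‖ ^ 2
  bounded_g : ∃ c : ℝ, ∀ x : Vec m, ‖S.g x‖ ≤ c
  invertible_g : ∀ x : Vec m, (S.g x).IsInvertible
  tol_pos : 0 < S.τ
  stepMax_pos : 0 < S.Δmax
  exists_kStar : ∃ y : Vec m, S.kStar y = S.level y 1

end Scheme

end AdaptiveEM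

end

/-! The sampled chain satisfies the hypotheses of Harris' theorem (`harris`) with V(y, l) = |y|²: V
contracts in mean up to a constant, and from each set {V ≤ R} all transition laws dominate one
nonzero measure. Since V ignores the level, this measure has to serve infinitely many levels at
once.

Drift (`exists_drift`). Put y = x + h f(x) for an accepted step. Acceptance says that f(x) is within
τ of f(y), so dissipativity can be used at the endpoint y, as for the implicit Euler scheme. Since τ
< 2β this gives (1 + 2γh)|y|² ≤ |x|² + ah with γ > 0 and no restriction on h. The weight 1 + 2γs,
with s the elapsed time, then yields a supermartingale; over one sampling period the weight grows
from at most 1 + 2γΔmax to 1 + 2γδ, which is the contraction.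

Minorization (`exists_minorization`). By dissipativity f points inwards on a large sphere, so it
vanishes somewhere by a no-retraction argument (`exists_eq_zero_of_inner_neg`), and near a zero
every level is accepted (`exists_ball_accept`). From a bounded set and a very fine level, the level
drops by one at every step. The step sizes form a geometric series, so with probability at least 1/2
the position stays bounded until a fixed level K is reached. One Gaussian step then enters the ball
around the zero, where the level descends to 0 and the chain is held until δ has elapsed. The final
step dominates a multiple of Lebesgue measure on that ball, at level 0.

The step sizes could a priori be summable, so finiteness of the sampling times needs proof
(`ae_nonempty_hitSet`): the minorization gives a positive chance of reaching δ from any bounded set,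
and the supermartingale prevents the mass that has not reached δ from escaping to infinity. The
Markov property (`lintegral_sampled_succ`) comes from splitting according to the value of N_j and
replacing the later noise by an independent copy. -/

/-! ### No retraction onto the sphere, and zeros of inward-pointing fields -/

section Brouwer

open Metric Polynomial

variable {E : Type*} [NormedAddCommGroup E] [InnerProductSpace ℝ E] [FiniteDimensional ℝ E]

/-- The bounded degree lets values at small `t` determine the value at `t = 1`. -/
lemma exists_polynomial_det_one_add_smul (A : E →L[ℝ] E) :
    ∃ p : ℝ[X], p.degree < (Module.finrank ℝ E + 1 : ℕ) ∧
      ∀ t : ℝ, p.eval t = (ContinuousLinearMap.id ℝ E + t • A).det := by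
  classical
  let b := Module.finBasis ℝ E
  let M := LinearMap.toMatrix b b (A : E →ₗ[ℝ] E)
  refine ⟨Matrix.det ((X : ℝ[X]) • M.map C + (1 : Matrix _ _ ℝ).map C), ?_, fun t => ?_⟩
  · have h := natDegree_det_X_add_C_le M 1
    rw [Fintype.card_fin] at h
    exact lt_of_le_of_lt degree_le_natDegree (by exact_mod_cast Nat.lt_succ_of_le h)
  · rw [ContinuousLinearMap.det, ← LinearMap.det_toMatrix b]
    rw [← coe_evalRingHom, RingHom.map_det]
    congr 1
    ext i j
    simp [M, LinearMap.toMatrix_apply, Matrix.one_apply, Finsupp.single_apply, eq_comm, add_comm]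
    ring_nf
    split_ifs <;> simp [add_comm]

/-- Lagrange interpolation at nodes in `[0, ε]`, evaluated at 1. The weights do not depend on `p`,
so the identity can be integrated over a family of polynomials without touching their coefficients.
-/
lemma exists_lagrange_weights (n : ℕ) (ε : ℝ) (hε : 0 < ε) :
    ∃ (t w : Fin (n + 1) → ℝ), (∀ i, 0 ≤ t i ∧ t i ≤ ε) ∧ ∑ i, w i = 1 ∧
      ∀ p : ℝ[X], p.degree < (n + 1 : ℕ) → p.eval 1 = ∑ i, w i * p.eval (t i) := by
  classical
  let t : Fin (n + 1) → ℝ := fun i => ε * ((i : ℕ) / (n + 1 : ℝ))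
  have hinj : Set.InjOn t (Finset.univ : Finset (Fin (n + 1))) := by
    intro i _ j _ h
    have hn : (n + 1 : ℝ) ≠ 0 := by positivity
    have : ((i : ℕ) : ℝ) = (j : ℕ) := by
      have := mul_left_cancel₀ hε.ne' h
      field_simp at this
      exact this
    exact Fin.ext (by exact_mod_cast this)
  refine ⟨t, fun i => (Lagrange.basis Finset.univ t i).eval 1, fun i => ⟨by positivity, ?_⟩,
    ?_, fun p hp => ?_⟩
  · have : ((i : ℕ) : ℝ) / (n + 1 : ℝ) ≤ 1 := by
      rw [div_le_one (by positivity)]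
      exact_mod_cast i.2.le
    exact mul_le_of_le_one_right hε.le this
  · rw [← eval_finsetSum, Lagrange.sum_basis hinj Finset.univ_nonempty, eval_one]
  · have := Lagrange.eq_interpolate (s := Finset.univ) (v := t) hinj (f := p) (by simpa using hp)
    conv_lhs => rw [this]
    simp [Lagrange.interpolate_apply, eval_finsetSum, mul_comm]

lemma det_eq_zero_of_forall_inner_eq_zero {A : E →L[ℝ] E} {v : E} (hv : v ≠ 0)
    (h : ∀ x, inner ℝ (A x) v = 0) : A.det = 0 := by
  by_contra hA
  have hu : IsUnit (A : E →ₗ[ℝ] E) :=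
    (LinearMap.isUnit_iff_isUnit_det _).2 (isUnit_iff_ne_zero.2 hA)
  obtain ⟨x, hx⟩ := ((Module.End.isUnit_iff _).1 hu).2 v
  have := h x
  rw [show A x = v from hx] at this
  exact hv (inner_self_eq_zero.1 this)

/-- For `s ≤ t` the map `id + s • A` is injective because `s * ‖A‖ < 1`; hence the determinant
cannot change sign on the way from its value 1 at `s = 0`. -/
lemma det_id_add_smul_pos {A : E →L[ℝ] E} {L t : ℝ} (hA : ‖A‖ ≤ L) (ht : 0 ≤ t)
    (htL : t * L < 1) : 0 < (ContinuousLinearMap.id ℝ E + t • A).det := by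
  have hne : ∀ s ∈ Set.Icc 0 t, (ContinuousLinearMap.id ℝ E + s • A).det ≠ 0 := by
    intro s hs h0
    obtain ⟨v, hv, hv0⟩ := (Submodule.ne_bot_iff _).1 (LinearMap.bot_lt_ker_of_det_eq_zero h0).ne'
    have hv' : v + s • A v = 0 := by simpa using hv
    have h1 : ‖v‖ ≤ s * (L * ‖v‖) := by
      calc ‖v‖ = s * ‖A v‖ := by
            have := congrArg norm (eq_neg_of_add_eq_zero_left hv')
            rwa [norm_neg, norm_smul, Real.norm_of_nonneg hs.1] at this
        _ ≤ s * (L * ‖v‖) := mul_le_mul_of_nonneg_left (A.le_of_opNorm_le hA v) hs.1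
    have h2 : 0 < ‖v‖ := norm_pos_iff.2 hv0
    have h3 : 0 ≤ L := (norm_nonneg A).trans hA
    have h4 : s * L ≤ t * L := mul_le_mul_of_nonneg_right hs.2 h3
    nlinarith
  have hc : Continuous fun s : ℝ => (ContinuousLinearMap.id ℝ E + s • A).det :=
    ContinuousLinearMap.continuous_det.comp (by fun_prop)
  by_contra! hle
  obtain ⟨s, hs, hs0⟩ := intermediate_value_Icc' ht hc.continuousOn
    (show (0 : ℝ) ∈ Set.Icc _ _ from ⟨hle, by simp [ContinuousLinearMap.det]⟩)
  exact hne s hs hs0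

section

variable {r : E → E} {ρ : ℝ}

/-- Connectedness of the ball. The image lies in the ball by convexity and is open by the inverse
function theorem. It is relatively closed, since the image of the closed ball is compact and
boundary points are fixed. -/
lemma image_ball_perturbation (hρ : 0 < ρ) (hr : ∀ x ∈ closedBall (0 : E) ρ, ContDiffAt ℝ 1 r x)
    (hnorm : ∀ x ∈ closedBall (0 : E) ρ, ‖r x‖ = ρ) (hid : ∀ x ∈ sphere (0 : E) ρ, r x = x)
    {t : ℝ} (ht : 0 ≤ t) (ht1 : t < 1)
    (hdet : ∀ x ∈ closedBall (0 : E) ρ,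
      (ContinuousLinearMap.id ℝ E + t • (fderiv ℝ r x - ContinuousLinearMap.id ℝ E)).det ≠ 0) :
    (fun x => x + t • (r x - x)) '' ball 0 ρ = ball 0 ρ := by
  set φ : E → E := fun x => x + t • (r x - x) with hφ
  have hstrict : ∀ x ∈ closedBall (0 : E) ρ, HasStrictFDerivAt φ
      (ContinuousLinearMap.id ℝ E + t • (fderiv ℝ r x - ContinuousLinearMap.id ℝ E)) x := by
    intro x hx
    have h1 : HasStrictFDerivAt r (fderiv ℝ r x) x := (hr x hx).hasStrictFDerivAt one_ne_zero
    exact (hasStrictFDerivAt_id x).add ((h1.sub (hasStrictFDerivAt_id x)).const_smul t)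
  have hcont : ContinuousOn φ (closedBall 0 ρ) := fun x hx =>
    (hstrict x hx).continuousAt.continuousWithinAt
  have hsub : φ '' ball 0 ρ ⊆ ball 0 ρ := by
    rintro _ ⟨x, hx, rfl⟩
    have hx' : ‖x‖ < ρ := by simpa using hx
    have h1 : φ x = (1 - t) • x + t • r x := by simp only [hφ]; module
    rw [mem_ball_zero_iff, h1]
    refine (norm_add_le _ _).trans_lt ?_
    rw [norm_smul, norm_smul, hnorm x (ball_subset_closedBall hx), Real.norm_of_nonneg ht,
      Real.norm_of_nonneg (sub_nonneg.2 ht1.le)]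
    nlinarith
  refine hsub.antisymm ?_
  refine (convex_ball (0 : E) ρ).isPreconnected.subset_of_closure_inter_subset ?_ ?_ ?_
  · rw [isOpen_iff_mem_nhds]
    rintro _ ⟨x, hx, rfl⟩
    have hx' := ball_subset_closedBall hx
    have hsurj : (ContinuousLinearMap.id ℝ E
        + t • (fderiv ℝ r x - ContinuousLinearMap.id ℝ E)).range = ⊤ := by
      refine LinearMap.range_eq_top.2 ?_
      exact ((Module.End.isUnit_iff _).1 ((LinearMap.isUnit_iff_isUnit_det _).2
        (isUnit_iff_ne_zero.2 (hdet x hx')))).2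
    rw [← (hstrict x hx').map_nhds_eq_of_surj hsurj]
    exact Filter.image_mem_map (isOpen_ball.mem_nhds hx)
  · exact ⟨φ 0, hsub ⟨0, mem_ball_self hρ, rfl⟩, 0, mem_ball_self hρ, rfl⟩
  · rintro y ⟨hy, hyb⟩
    have hcl : closure (φ '' ball 0 ρ) ⊆ φ '' closedBall 0 ρ :=
      closure_minimal (Set.image_mono ball_subset_closedBall)
        ((isCompact_closedBall _ _).image_of_continuousOn hcont).isClosed
    obtain ⟨x, hx, rfl⟩ := hcl hy
    rcases (mem_closedBall_zero_iff.1 hx).lt_or_eq with h | h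
    · exact ⟨x, mem_ball_zero_iff.2 h, rfl⟩
    · exfalso
      have h2 : φ x = x := by simp [hφ, hid x (mem_sphere_zero_iff_norm.2 h)]
      rw [h2, mem_ball_zero_iff, h] at hyb
      exact lt_irrefl _ hyb

/-- For small `t` the map `x + t • (r x - x)` is a bijection of the ball with positive Jacobian, so
its Jacobian integrates to the volume of the ball. The Jacobian is polynomial in `t`, so the same
holds at `t = 1`. There the derivative is that of `r`, which is singular because `‖r x‖` is
constant: the integral is 0. -/
theorem not_exists_retraction_sphere (hρ : 0 < ρ)
    (hr : ∀ x ∈ closedBall (0 : E) ρ, ContDiffAt ℝ 1 r x)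
    (hnorm : ∀ x ∈ closedBall (0 : E) ρ, ‖r x‖ = ρ) :
    ¬ ∀ x ∈ sphere (0 : E) ρ, r x = x := by
  intro hid
  borelize E
  let vol : Measure E := MeasureTheory.Measure.addHaar
  let A : E → E →L[ℝ] E := fun x => fderiv ℝ r x - ContinuousLinearMap.id ℝ E
  have hA : ContinuousOn A (closedBall 0 ρ) := fun x hx =>
    (((hr x hx).fderiv_right (m := 0) (by norm_num)).continuousAt.sub
      continuousAt_const).continuousWithinAt
  obtain ⟨L, hL⟩ := ((isCompact_closedBall (0 : E) ρ).image_of_continuousOn hA.norm).bddAbove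
  have hL' : ∀ x ∈ closedBall (0 : E) ρ, ‖A x‖ ≤ L := fun x hx => hL ⟨x, hx, rfl⟩
  have hL0 : 0 ≤ L := (norm_nonneg _).trans (hL' 0 (mem_closedBall_self hρ.le))
  let ε : ℝ := 1 / (L + 2)
  have hε : 0 < ε := by positivity
  have hε1 : ε < 1 := by rw [div_lt_one (by positivity)]; linarith
  have hεL : ε * L < 1 := by
    rw [one_div_mul_eq_div, div_lt_one (by positivity)]; linarith
  have hint : ∀ t : ℝ, IntegrableOn
      (fun x => (ContinuousLinearMap.id ℝ E + t • A x).det) (ball 0 ρ) vol := by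
    intro t
    have hc : ContinuousOn (fun x => (ContinuousLinearMap.id ℝ E + t • A x).det)
        (closedBall 0 ρ) :=
      ContinuousLinearMap.continuous_det.comp_continuousOn
        (continuousOn_const.add (hA.const_smul t))
    exact (hc.integrableOn_compact (isCompact_closedBall _ _)).mono_set ball_subset_closedBall
  have hsmall : ∀ t, 0 ≤ t → t ≤ ε →
      ∫ x in ball 0 ρ, (ContinuousLinearMap.id ℝ E + t • A x).det ∂vol = vol.real (ball 0 ρ) := by
    intro t ht htε
    have hpos : ∀ x ∈ closedBall (0 : E) ρ,
        0 < (ContinuousLinearMap.id ℝ E + t • A x).det := fun x hx =>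
      det_id_add_smul_pos (hL' x hx) ht ((mul_le_mul_of_nonneg_right htε hL0).trans_lt hεL)
    have himg := image_ball_perturbation hρ hr hnorm hid ht (htε.trans_lt hε1)
      fun x hx => (hpos x hx).ne'
    have hinj : Set.InjOn (fun x => x + t • (r x - x)) (ball 0 ρ) := by
      intro x hx y hy hxy
      have h1 : ‖(r y - y) - (r x - x)‖ ≤ L * ‖y - x‖ := by
        refine (convex_closedBall (0 : E) ρ).norm_image_sub_le_of_norm_hasFDerivWithin_le
          (f := fun x => r x - x) (f' := A) (fun z hz => ?_) hL' (ball_subset_closedBall hx)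
          (ball_subset_closedBall hy)
        exact ((((hr z hz).differentiableAt one_ne_zero).hasFDerivAt).sub
          (hasFDerivAt_id z)).hasFDerivWithinAt
      have h2 : y - x = - (t • ((r y - y) - (r x - x))) := by
        simp only at hxy
        rw [eq_neg_iff_add_eq_zero]
        have : y - x + t • (r y - y - (r x - x)) = (y + t • (r y - y)) - (x + t • (r x - x)) := by
          module
        rw [this, hxy, sub_self]
      have h3 : ‖y - x‖ ≤ ε * L * ‖y - x‖ := by
        conv_lhs => rw [h2, norm_neg, norm_smul, Real.norm_of_nonneg ht]
        calc t * ‖r y - y - (r x - x)‖ ≤ ε * (L * ‖y - x‖) := by gcongr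
          _ = _ := by ring
      have h4 : ‖y - x‖ = 0 := by
        by_contra hne
        have : 0 < ‖y - x‖ := lt_of_le_of_ne (norm_nonneg _) (Ne.symm hne)
        nlinarith
      exact (sub_eq_zero.1 (norm_eq_zero.1 h4)).symm
    have hder : ∀ x ∈ ball (0 : E) ρ, HasFDerivWithinAt (fun x => x + t • (r x - x))
        (ContinuousLinearMap.id ℝ E + t • A x) (ball 0 ρ) x := by
      intro x hx
      have h1 := ((hr x (ball_subset_closedBall hx)).differentiableAt one_ne_zero).hasFDerivAt
      exact ((hasFDerivAt_id x).add ((h1.sub (hasFDerivAt_id x)).const_smul t)).hasFDerivWithinAt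
    have hcv := lintegral_abs_det_fderiv_eq_addHaar_image vol measurableSet_ball hder hinj
    rw [himg] at hcv
    rw [integral_eq_lintegral_of_nonneg_ae, Measure.real, ← hcv]
    · congr 1
      refine setLIntegral_congr_fun measurableSet_ball fun x hx => ?_
      rw [abs_of_pos (hpos x (ball_subset_closedBall hx))]
    · filter_upwards [self_mem_ae_restrict measurableSet_ball] with x hx
      exact (hpos x (ball_subset_closedBall hx)).le
    · exact (hint t).aestronglyMeasurable
  obtain ⟨t, w, ht, hw, hp⟩ := exists_lagrange_weights (Module.finrank ℝ E) ε hε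
  have hkey : ∫ x in ball 0 ρ, (ContinuousLinearMap.id ℝ E + (1 : ℝ) • A x).det ∂vol
      = vol.real (ball 0 ρ) := by
    have : ∀ x, (ContinuousLinearMap.id ℝ E + (1 : ℝ) • A x).det
        = ∑ i, w i * (ContinuousLinearMap.id ℝ E + t i • A x).det := by
      intro x
      obtain ⟨p, hpd, hpe⟩ := exists_polynomial_det_one_add_smul (A x)
      simp only [← hpe]
      exact hp p hpd
    simp only [this]
    rw [integral_finsetSum _ fun i _ => (hint (t i)).const_mul (w i)]
    simp only [integral_const_mul]
    rw [Finset.sum_congr rfl fun i _ => by rw [hsmall (t i) (ht i).1 (ht i).2], ← Finset.sum_mul,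
      hw, one_mul]
  have hzero : ∫ x in ball 0 ρ, (ContinuousLinearMap.id ℝ E + (1 : ℝ) • A x).det ∂vol = 0 := by
    rw [setIntegral_congr_fun (g := fun _ => (0 : ℝ)) measurableSet_ball, integral_zero]
    intro x hx
    have hx' := ball_subset_closedBall hx
    have h1 : ContinuousLinearMap.id ℝ E + (1 : ℝ) • A x = fderiv ℝ r x := by simp [A]
    change (ContinuousLinearMap.id ℝ E + (1 : ℝ) • A x).det = 0
    rw [h1]
    have hrx : r x ≠ 0 := by
      rw [← norm_pos_iff, hnorm x hx']; exact hρ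
    refine det_eq_zero_of_forall_inner_eq_zero hrx fun v => ?_
    have hd := ((hr x hx').differentiableAt one_ne_zero).hasFDerivAt
    have h2 := hd.norm_sq
    have h3 : HasFDerivAt (fun x => ‖r x‖ ^ 2) (0 : E →L[ℝ] ℝ) x := by
      refine (hasFDerivAt_const (ρ ^ 2) x).congr_of_eventuallyEq ?_
      filter_upwards [isOpen_ball.mem_nhds hx] with z hz
      rw [hnorm z (ball_subset_closedBall hz)]
    have h4 := congrArg (fun T : E →L[ℝ] ℝ => T v) (h2.unique h3)
    simp at h4
    rw [real_inner_comm]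
    exact h4
  have hpos : 0 < vol.real (ball 0 ρ) :=
    ENNReal.toReal_pos (measure_ball_pos _ _ hρ).ne' measure_ball_lt_top.ne
  linarith [hkey.symm.trans hzero]

end

/-- A `C¹` vector field that points inwards on a sphere vanishes somewhere in the ball. -/
theorem exists_eq_zero_of_inner_neg {f : E → E} (hf : ContDiff ℝ 1 f) {ρ : ℝ} (hρ : 0 < ρ)
    (hin : ∀ x ∈ sphere (0 : E) ρ, inner ℝ (f x) x < 0) : ∃ x, f x = 0 := by
  by_contra! hne
  -- The retraction follows the ray from `x` in the direction `u x` opposite to `f x` up to the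
  -- sphere: `s x` is the larger root of `‖x + s • u x‖ = ρ`, and `q x > 0` makes it smooth. On the
  -- sphere `u` points outwards, so the larger root is 0.
  let u : E → E := fun x => -(‖f x‖⁻¹ • f x)
  let q : E → ℝ := fun x => ρ ^ 2 - ‖x‖ ^ 2 + inner ℝ x (u x) ^ 2
  let s : E → ℝ := fun x => -inner ℝ x (u x) + √(q x)
  have hu1 : ∀ x, ‖u x‖ = 1 := by
    intro x
    simp [u, norm_smul, hne x]
  have hus : ∀ x ∈ sphere (0 : E) ρ, 0 < inner ℝ x (u x) := by
    intro x hx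
    have h1 := hin x hx
    have h2 : inner ℝ x (u x) = ‖f x‖⁻¹ * (- inner ℝ (f x) x) := by
      simp [u, inner_neg_right, inner_smul_right, real_inner_comm]
    rw [h2]
    have := norm_pos_iff.2 (hne x)
    exact mul_pos (inv_pos.2 this) (by linarith)
  have hq : ∀ x ∈ closedBall (0 : E) ρ, 0 < q x := by
    intro x hx
    rcases (mem_closedBall_zero_iff.1 hx).lt_or_eq with h | h
    · have : ‖x‖ ^ 2 < ρ ^ 2 := by gcongr
      simp only [q]; nlinarith [sq_nonneg (inner ℝ x (u x))]
    · have := hus x (mem_sphere_zero_iff_norm.2 h)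
      simp only [q, h]; nlinarith
  have hcu : ContDiff ℝ 1 u := ((hf.norm ℝ hne).inv (fun x => norm_ne_zero_iff.2 (hne x))).smul hf
    |>.neg
  have hci : ContDiff ℝ 1 fun x => inner ℝ x (u x) := contDiff_id.inner ℝ hcu
  have hcq : ContDiff ℝ 1 q := (contDiff_const.sub (contDiff_norm_sq ℝ)).add (hci.pow 2)
  refine not_exists_retraction_sphere (r := fun x => x + s x • u x) hρ (fun x hx => ?_)
    (fun x hx => ?_) (fun x hx => ?_)
  · exact contDiffAt_id.add (((hci.neg).contDiffAt.add
      (hcq.contDiffAt.sqrt (hq x hx).ne')).smul hcu.contDiffAt)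
  · have h1 : ‖x + s x • u x‖ ^ 2 = ρ ^ 2 := by
      rw [norm_add_sq_real, inner_smul_right, norm_smul, hu1, mul_one, Real.norm_eq_abs, sq_abs]
      have := Real.sq_sqrt (hq x hx).le
      have h2 : s x + inner ℝ x (u x) = √(q x) := by simp [s]
      have h3 : (s x + inner ℝ x (u x)) ^ 2 = q x := by rw [h2, this]
      simp only [q] at h3
      nlinarith
    exact (sq_eq_sq₀ (norm_nonneg _) hρ.le).1 h1
  · have h1 : q x = inner ℝ x (u x) ^ 2 := by
      simp [q, mem_sphere_zero_iff_norm.1 hx]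
    have h2 : s x = 0 := by
      simp only [s, h1, Real.sqrt_sq (hus x hx).le]; ring
    simp [h2]

end Brouwer

/-! ### Gaussian lower bounds and second moments -/

noncomputable section

section Gaussian

open scoped ENNReal
open Metric

lemma MeasureTheory.Measure.pi_mono_of_le {ι : Type*} [Fintype ι] {α : ι → Type*}
    [∀ i, MeasurableSpace (α i)] {μ ν : ∀ i, Measure (α i)} (h : ∀ i, μ i ≤ ν i) :
    Measure.pi μ ≤ Measure.pi ν := by
  refine Measure.le_iff.2 fun s hs => ?_
  rw [Measure.pi, Measure.pi, toMeasure_apply _ _ hs, toMeasure_apply _ _ hs]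
  refine (OuterMeasure.le_pi.2 fun t ht => ?_) s
  refine (OuterMeasure.pi_pi_le _ _).trans ?_
  exact Finset.prod_le_prod' fun i _ => h i _

lemma exists_smul_volume_restrict_le_gaussianReal (ρ : ℝ) :
    ∃ c : ℝ≥0∞, c ≠ 0 ∧ c ≠ ⊤ ∧
      c • (volume : Measure ℝ).restrict (Set.Icc (-ρ) ρ) ≤ gaussianReal 0 1 := by
  have hc : ContinuousOn (gaussianPDFReal 0 1) (Set.Icc (-ρ) ρ) := by
    unfold gaussianPDFReal
    fun_prop
  rcases (Set.Icc (-ρ) ρ).eq_empty_or_nonempty with he | hne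
  · exact ⟨1, one_ne_zero, ENNReal.one_ne_top, by simpa [he] using Measure.zero_le _⟩
  obtain ⟨x₀, -, hx₀⟩ := isCompact_Icc.exists_isMinOn hne hc
  refine ⟨gaussianPDF 0 1 x₀, (gaussianPDF_pos 0 one_ne_zero x₀).ne', gaussianPDF_ne_top, ?_⟩
  refine Measure.le_iff.2 fun s hs => ?_
  rw [gaussianReal_apply _ one_ne_zero, Measure.smul_apply, Measure.restrict_apply hs, smul_eq_mul,
    ← setLIntegral_const]
  refine (setLIntegral_mono (measurable_gaussianPDF _ _) fun x hx => ?_).trans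
    (lintegral_mono_set Set.inter_subset_left)
  exact ENNReal.ofReal_le_ofReal (hx₀ hx.2)

variable {m : ℕ}

/-- The ball lies in a cube, on which each one-dimensional Gaussian density is bounded below. -/
lemma exists_mul_volume_le_stdGaussian (ρ : ℝ) :
    ∃ c : ℝ≥0∞, c ≠ 0 ∧ c ≠ ⊤ ∧ ∀ A : Set (EuclideanSpace ℝ (Fin m)), MeasurableSet A →
      A ⊆ closedBall 0 ρ → c * volume A ≤ stdGaussian (EuclideanSpace ℝ (Fin m)) A := by
  obtain ⟨c, hc0, hct, hle⟩ := exists_smul_volume_restrict_le_gaussianReal ρ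
  refine ⟨c ^ m, pow_ne_zero _ hc0, ENNReal.pow_ne_top hct, fun A hA hsub => ?_⟩
  have hmeas : Measurable (WithLp.toLp 2 : (Fin m → ℝ) → EuclideanSpace ℝ (Fin m)) := by fun_prop
  rw [← map_pi_eq_stdGaussian, Measure.map_apply hmeas hA,
    ← (PiLp.volume_preserving_toLp (Fin m)).measure_preimage hA.nullMeasurableSet]
  have hpi : Measure.pi (fun _ : Fin m => c • (volume : Measure ℝ).restrict (Set.Icc (-ρ) ρ))
      = c ^ m • (volume : Measure (Fin m → ℝ)).restrict
          (Set.univ.pi fun _ => Set.Icc (-ρ) ρ) := by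
    have : SigmaFinite (c • (volume : Measure ℝ).restrict (Set.Icc (-ρ) ρ)) :=
      have := Measure.smul_finite ((volume : Measure ℝ).restrict (Set.Icc (-ρ) ρ)) hct
      inferInstance
    refine Measure.pi_eq fun s _ => ?_
    rw [volume_pi, Measure.restrict_pi_pi, Measure.smul_apply, Measure.pi_pi]
    simp [Finset.prod_mul_distrib]
  have h2 := (Measure.pi_mono_of_le fun _ : Fin m => hle) (WithLp.toLp 2 ⁻¹' A)
  rw [hpi, Measure.smul_apply, smul_eq_mul, Measure.restrict_apply (hmeas hA)] at h2
  refine le_trans (le_of_eq ?_) h2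
  congr 2
  rw [Set.inter_eq_left.2]
  intro x hx i _
  have h3 : ‖x i‖ ≤ ρ := by
    have := hsub hx
    rw [mem_closedBall_zero_iff] at this
    exact (PiLp.norm_apply_le (WithLp.toLp 2 x) i).trans this
  exact abs_le.1 h3

/-- The bound on the inverse keeps the preimage of `A` in a fixed ball, and the determinant controls
its volume. The constant depends on `R`, `B`, `d` only, hence is uniform over a compact set of
starting points. -/
lemma exists_mul_volume_le_stdGaussian_affine (R B d : ℝ) :
    ∃ c : ℝ≥0∞, c ≠ 0 ∧ c ≠ ⊤ ∧ ∀ (a : EuclideanSpace ℝ (Fin m))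
      (L : EuclideanSpace ℝ (Fin m) →L[ℝ] EuclideanSpace ℝ (Fin m)),
      ‖a‖ ≤ R → L.IsInvertible → ‖L.inverse‖ ≤ B → |L.det| ≤ d →
      ∀ A : Set (EuclideanSpace ℝ (Fin m)), MeasurableSet A → A ⊆ closedBall 0 R →
        c * volume A ≤ stdGaussian (EuclideanSpace ℝ (Fin m)) {e | a + L e ∈ A} := by
  obtain ⟨c, hc0, hct, hc⟩ := exists_mul_volume_le_stdGaussian (m := m) (B * (R + R))
  -- `max d 1` keeps the factor positive whatever the sign of `d`.
  refine ⟨c * ENNReal.ofReal (max d 1)⁻¹, mul_ne_zero hc0 (by simp), 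
    ENNReal.mul_ne_top hct ENNReal.ofReal_ne_top, fun a L ha hL hB hd A hA hsub => ?_⟩
  obtain ⟨e, rfl⟩ := hL
  rw [ContinuousLinearMap.inverse_equiv] at hB
  have hdet : LinearMap.det ((e : EuclideanSpace ℝ (Fin m) →L[ℝ] EuclideanSpace ℝ (Fin m)) :
      EuclideanSpace ℝ (Fin m) →ₗ[ℝ] EuclideanSpace ℝ (Fin m)) ≠ 0 :=
    (LinearEquiv.isUnit_det' e.toLinearEquiv).ne_zero
  have hmeasA : MeasurableSet {x : EuclideanSpace ℝ (Fin m) | a + x ∈ A} :=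
    (measurable_const_add a) hA
  have hvol : ENNReal.ofReal (max d 1)⁻¹ * volume A
      ≤ volume {x : EuclideanSpace ℝ (Fin m) | a + e x ∈ A} := by
    have h1 := Measure.addHaar_preimage_continuousLinearMap volume hdet
      {x : EuclideanSpace ℝ (Fin m) | a + x ∈ A}
    have h2 : volume {x : EuclideanSpace ℝ (Fin m) | a + x ∈ A} = volume A :=
      measure_preimage_add volume a A
    rw [h2] at h1
    refine le_trans ?_ h1.ge
    gcongr
    rw [abs_inv]
    exact inv_anti₀ (abs_pos.2 hdet) (hd.trans (le_max_left _ _))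
  rw [mul_assoc]
  refine (mul_le_mul_right hvol c).trans ?_
  refine hc _ (e.continuous.measurable hmeasA) fun x hx => ?_
  rw [mem_closedBall_zero_iff]
  have h3 : x = e.symm ((a + e x) - a) := by simp
  have h4 : ‖a + e x‖ ≤ R := mem_closedBall_zero_iff.1 (hsub hx)
  rw [h3]
  calc ‖e.symm ((a + e x) - a)‖ ≤ B * ‖(a + e x) - a‖ :=
        (e.symm : EuclideanSpace ℝ (Fin m) →L[ℝ] EuclideanSpace ℝ (Fin m)).le_of_opNorm_le hB _
    _ ≤ B * (R + R) := by
        have : 0 ≤ B := (norm_nonneg _).trans hB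
        gcongr
        exact (norm_sub_le _ _).trans (add_le_add h4 ha)

lemma integrable_norm_sq_stdGaussian :
    Integrable (fun e => ‖e‖ ^ 2) (stdGaussian (EuclideanSpace ℝ (Fin m))) :=
  (IsGaussian.memLp_two_id (μ := stdGaussian (EuclideanSpace ℝ (Fin m)))).integrable_norm_pow
    two_ne_zero

lemma integrable_norm_add_apply_sq_stdGaussian (a : EuclideanSpace ℝ (Fin m))
    (L : EuclideanSpace ℝ (Fin m) →L[ℝ] EuclideanSpace ℝ (Fin m)) :
    Integrable (fun e => ‖a + L e‖ ^ 2) (stdGaussian (EuclideanSpace ℝ (Fin m))) := by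
  have h : MemLp (fun e => a + L e) 2 (stdGaussian (EuclideanSpace ℝ (Fin m))) :=
    (memLp_const a).add (L.comp_memLp' IsGaussian.memLp_two_id)
  exact h.integrable_norm_pow two_ne_zero

/-- The cross term integrates to zero because the Gaussian is centred. -/
lemma lintegral_norm_add_apply_sq_stdGaussian_le (a : EuclideanSpace ℝ (Fin m))
    (L : EuclideanSpace ℝ (Fin m) →L[ℝ] EuclideanSpace ℝ (Fin m)) :
    ∫⁻ e, ENNReal.ofReal (‖a + L e‖ ^ 2) ∂(stdGaussian (EuclideanSpace ℝ (Fin m))) ≤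
      ENNReal.ofReal (‖a‖ ^ 2
        + ‖L‖ ^ 2 * ∫ e, ‖e‖ ^ 2 ∂(stdGaussian (EuclideanSpace ℝ (Fin m)))) := by
  rw [← ofReal_integral_eq_lintegral_ofReal (integrable_norm_add_apply_sq_stdGaussian a L)
    (Filter.Eventually.of_forall fun e => by positivity)]
  refine ENNReal.ofReal_le_ofReal ?_
  have hint : Integrable (fun e : EuclideanSpace ℝ (Fin m) => 2 * inner ℝ a (L e))
      (stdGaussian (EuclideanSpace ℝ (Fin m))) := by
    refine Integrable.const_mul ?_ _
    exact ((innerSL ℝ a).comp L).integrable_comp IsGaussian.integrable_id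
  have hzero : ∫ e, 2 * inner ℝ a (L e) ∂(stdGaussian (EuclideanSpace ℝ (Fin m))) = 0 := by
    rw [integral_const_mul, show (fun e => inner ℝ a (L e)) = ((innerSL ℝ a).comp L) from rfl,
      integral_strongDual_stdGaussian, mul_zero]
  have hle : ∀ e : EuclideanSpace ℝ (Fin m),
      ‖a + L e‖ ^ 2 ≤ ‖a‖ ^ 2 + 2 * inner ℝ a (L e) + ‖L‖ ^ 2 * ‖e‖ ^ 2 := by
    intro e
    rw [norm_add_sq_real, ← mul_pow]
    gcongr
    exact L.le_opNorm e
  calc ∫ e, ‖a + L e‖ ^ 2 ∂(stdGaussian (EuclideanSpace ℝ (Fin m)))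
      ≤ ∫ e, (‖a‖ ^ 2 + 2 * inner ℝ a (L e) + ‖L‖ ^ 2 * ‖e‖ ^ 2)
          ∂(stdGaussian (EuclideanSpace ℝ (Fin m))) :=
        integral_mono (integrable_norm_add_apply_sq_stdGaussian a L)
          (((integrable_const _).add hint).add (integrable_norm_sq_stdGaussian.const_mul _)) hle
    _ = _ := by
        have h1 := integral_add ((integrable_const (‖a‖ ^ 2)).add hint)
          ((integrable_norm_sq_stdGaussian (m := m)).const_mul (‖L‖ ^ 2))
        have h2 := integral_add (integrable_const (‖a‖ ^ 2)) hint
        simp only [Pi.add_apply] at h1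
        rw [h1, h2, hzero, integral_const_mul]
        simp

lemma stdGaussian_norm_gt_le {c : ℝ} (hc : 0 < c) :
    stdGaussian (EuclideanSpace ℝ (Fin m)) {e | c < ‖e‖} ≤
      ENNReal.ofReal ((∫ e, ‖e‖ ^ 2 ∂(stdGaussian (EuclideanSpace ℝ (Fin m)))) / c ^ 2) := by
  have h1 := mul_meas_ge_le_lintegral₀ (μ := stdGaussian (EuclideanSpace ℝ (Fin m)))
    (f := fun e => ENNReal.ofReal (‖e‖ ^ 2)) (by fun_prop) (ENNReal.ofReal (c ^ 2))
  rw [← ofReal_integral_eq_lintegral_ofReal integrable_norm_sq_stdGaussian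
    (Filter.Eventually.of_forall fun e => by positivity)] at h1
  rw [ENNReal.ofReal_div_of_pos (by positivity), ENNReal.le_div_iff_mul_le (Or.inl (by simp [hc.ne']))
    (by simp), mul_comm]
  refine le_trans ?_ h1
  refine mul_le_mul_right (measure_mono fun e (he : c < ‖e‖) => ?_) _
  exact ENNReal.ofReal_le_ofReal (by gcongr)

end Gaussian

end

/-! ### Harris' theorem by contraction of a weighted oscillation -/

noncomputable section

section Harris

open scoped ENNReal
open Filter Topology

variable {X : Type*} [MeasurableSpace X]

/-- The bound is integrated against the product of the two measures, one variable at a time;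
equality of the masses turns the difference of integrals into a double integral of `φ u - φ v`. -/
lemma abs_integral_sub_integral_le {μ₁ μ₂ : Measure X} [IsFiniteMeasure μ₁] [IsFiniteMeasure μ₂]
    {r : ℝ} (hr : 0 < r) (h₁ : μ₁.real Set.univ = r) (h₂ : μ₂.real Set.univ = r)
    {φ W : X → ℝ} (hφ₁ : Integrable φ μ₁) (hφ₂ : Integrable φ μ₂) (hW₁ : Integrable W μ₁)
    (hW₂ : Integrable W μ₂) (h : ∀ u v, |φ u - φ v| ≤ W u + W v) :
    |∫ u, φ u ∂μ₁ - ∫ v, φ v ∂μ₂| ≤ ∫ u, W u ∂μ₁ + ∫ v, W v ∂μ₂ := by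
  have hv : ∀ v, |∫ u, φ u ∂μ₁ - r * φ v| ≤ ∫ u, W u ∂μ₁ + r * W v := by
    intro v
    have e1 : ∫ u, φ u ∂μ₁ - r * φ v = ∫ u, (φ u - φ v) ∂μ₁ := by
      rw [integral_sub hφ₁ (integrable_const _), integral_const, h₁, smul_eq_mul]
    have e2 : ∫ u, W u ∂μ₁ + r * W v = ∫ u, (W u + W v) ∂μ₁ := by
      rw [integral_add hW₁ (integrable_const _), integral_const, h₁, smul_eq_mul]
    rw [e1, e2]
    refine (abs_integral_le_integral_abs).trans (integral_mono ?_ ?_ fun u => h u v)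
    · exact (hφ₁.sub (integrable_const _)).abs
    · exact hW₁.add (integrable_const _)
  have e3 : r * (∫ u, φ u ∂μ₁ - ∫ v, φ v ∂μ₂) = ∫ v, (∫ u, φ u ∂μ₁ - r * φ v) ∂μ₂ := by
    rw [integral_sub (integrable_const _) (hφ₂.const_mul r), integral_const, h₂, smul_eq_mul,
      integral_const_mul]
    ring
  have e4 : r * (∫ u, W u ∂μ₁ + ∫ v, W v ∂μ₂) = ∫ v, (∫ u, W u ∂μ₁ + r * W v) ∂μ₂ := by
    rw [integral_add (integrable_const _) (hW₂.const_mul r), integral_const, h₂, smul_eq_mul,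
      integral_const_mul]
    ring
  have e5 : |r * (∫ u, φ u ∂μ₁ - ∫ v, φ v ∂μ₂)| ≤ r * (∫ u, W u ∂μ₁ + ∫ v, W v ∂μ₂) := by
    rw [e3, e4]
    refine (abs_integral_le_integral_abs).trans (integral_mono ?_ ?_ hv)
    · exact ((integrable_const _).sub (hφ₂.const_mul r)).abs
    · exact (integrable_const _).add (hW₂.const_mul r)
  rw [abs_mul, abs_of_pos hr] at e5
  exact le_of_mul_le_mul_left e5 hr

/-- A common part `ν` of two probability measures improves the trivial bound on the difference
of two integrals. -/
lemma abs_integral_sub_integral_le_of_common {μ₁ μ₂ ν : Measure X} [IsProbabilityMeasure μ₁]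
    [IsProbabilityMeasure μ₂] (hν₁ : ν ≤ μ₁) (hν₂ : ν ≤ μ₂) (hν : ν.real Set.univ < 1)
    {φ W : X → ℝ} (hφ₁ : Integrable φ μ₁) (hφ₂ : Integrable φ μ₂) (hW₁ : Integrable W μ₁)
    (hW₂ : Integrable W μ₂) {w : ℝ} (hW : ∀ u, w ≤ W u) (h : ∀ u v, |φ u - φ v| ≤ W u + W v) :
    |∫ u, φ u ∂μ₁ - ∫ v, φ v ∂μ₂| ≤
      ∫ u, W u ∂μ₁ + ∫ v, W v ∂μ₂ - 2 * (w * ν.real Set.univ) := by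
  have : IsFiniteMeasure ν := isFiniteMeasure_of_le _ hν₁
  -- After removal of `ν` the remainders have equal mass. The contribution of `ν` to the integrals
  -- of `φ` cancels, while each integral of `W` drops by at least `w` times the mass of `ν`.
  have key : ∀ μ : Measure X, IsProbabilityMeasure μ → ν ≤ μ → Integrable φ μ → Integrable W μ →
      IsFiniteMeasure (μ - ν) ∧ (μ - ν).real Set.univ = 1 - ν.real Set.univ ∧
      Integrable φ (μ - ν) ∧ Integrable W (μ - ν) ∧
      ∫ u, φ u ∂μ = ∫ u, φ u ∂(μ - ν) + ∫ u, φ u ∂ν ∧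
      ∫ u, W u ∂(μ - ν) ≤ ∫ u, W u ∂μ - w * ν.real Set.univ := by
    intro μ hμ hle hφ hWi
    have hs : μ - ν + ν = μ := Measure.sub_add_cancel_of_le hle
    have hle' : μ - ν ≤ μ := Measure.sub_le
    have hfin : IsFiniteMeasure (μ - ν) := isFiniteMeasure_of_le _ hle'
    have hφ' := hφ.mono_measure hle'
    have hW' := hWi.mono_measure hle'
    have hφν := hφ.mono_measure hle
    have hWν := hWi.mono_measure hle
    refine ⟨hfin, ?_, hφ', hW', ?_, ?_⟩
    · have h1 : (μ - ν + ν).real Set.univ = 1 := by rw [hs, probReal_univ]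
      rw [Measure.real, Measure.add_apply,
        ENNReal.toReal_add (measure_ne_top _ _) (measure_ne_top _ _)] at h1
      simp only [Measure.real]
      linarith
    · conv_lhs => rw [← hs]
      exact integral_add_measure hφ' hφν
    · have h1 : ∫ u, W u ∂μ = ∫ u, W u ∂(μ - ν) + ∫ u, W u ∂ν := by
        conv_lhs => rw [← hs]
        exact integral_add_measure hW' hWν
      have h2 : ∫ _, w ∂ν ≤ ∫ u, W u ∂ν := integral_mono (integrable_const _) hWν hW
      rw [integral_const, smul_eq_mul, mul_comm] at h2
      linarith
  obtain ⟨f1, m1, a1, b1, c1, d1⟩ := key μ₁ inferInstance hν₁ hφ₁ hW₁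
  obtain ⟨f2, m2, a2, b2, c2, d2⟩ := key μ₂ inferInstance hν₂ hφ₂ hW₂
  have := abs_integral_sub_integral_le (sub_pos.2 hν) m1 m2 a1 a2 b1 b2 h
  rw [c1, c2, add_sub_add_right_eq_sub]
  linarith

/-- A sequence of probability measures that is uniformly Cauchy on measurable sets converges
setwise. -/
lemma exists_probabilityMeasure_tendsto {μ : ℕ → Measure X} [∀ n, IsProbabilityMeasure (μ n)]
    {c : ℕ → ℝ} (hc : Tendsto c atTop (𝓝 0))
    (h : ∀ A, MeasurableSet A → ∀ n k, n ≤ k → |(μ k).real A - (μ n).real A| ≤ c n) :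
    ∃ π : Measure X, IsProbabilityMeasure π ∧
      ∀ A, MeasurableSet A → Tendsto (fun n => μ n A) atTop (𝓝 (π A)) := by
  have hlim : ∀ A : Set X, ∃ L : ℝ, MeasurableSet A →
      Tendsto (fun n => (μ n).real A) atTop (𝓝 L) := by
    intro A
    by_cases hA : MeasurableSet A
    · have hcau : CauchySeq fun n => (μ n).real A := by
        refine cauchySeq_of_le_tendsto_0' c (fun n k hnk => ?_) hc
        rw [dist_comm, Real.dist_eq]
        exact h A hA n k hnk
      obtain ⟨L, hL⟩ := cauchySeq_tendsto_of_complete hcau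
      exact ⟨L, fun _ => hL⟩
    · exact ⟨0, fun h => absurd h hA⟩
  choose L hL using hlim
  have hL0 : ∀ A, MeasurableSet A → 0 ≤ L A := fun A hA =>
    ge_of_tendsto' (hL A hA) fun n => measureReal_nonneg
  have hLc : ∀ A, MeasurableSet A → ∀ n, |L A - (μ n).real A| ≤ c n := fun A hA n =>
    le_of_tendsto ((hL A hA).sub_const _).abs
      (eventually_atTop.2 ⟨n, fun k hk => h A hA n k hk⟩)
  -- Countable additivity of the limit: `c n` bounds the distance to `μ n` uniformly over all sets,
  -- so the tail of a union is controlled by that of a single `μ n`.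
  have hsum : ∀ f : ℕ → Set X, (∀ i, MeasurableSet (f i)) → Pairwise (Function.onFun Disjoint f) →
      HasSum (fun i => L (f i)) (L (⋃ i, f i)) := by
    intro f hf hd
    rw [hasSum_iff_tendsto_nat_of_nonneg fun i => hL0 _ (hf i)]
    have hU : MeasurableSet (⋃ i, f i) := MeasurableSet.iUnion hf
    have hUn : ∀ N : ℕ, MeasurableSet (⋃ i ∈ Finset.range N, f i) := fun N =>
      Finset.measurableSet_biUnion _ fun i _ => hf i
    have hfin : ∀ (n N : ℕ), (μ n).real (⋃ i ∈ Finset.range N, f i)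
        = ∑ i ∈ Finset.range N, (μ n).real (f i) := fun n N =>
      measureReal_biUnion_finset (fun i _ j _ hij => hd hij) fun i _ => hf i
    have hLN : ∀ N : ℕ, ∑ i ∈ Finset.range N, L (f i) = L (⋃ i ∈ Finset.range N, f i) := by
      intro N
      refine tendsto_nhds_unique ?_ (hL _ (hUn N))
      simp only [hfin]
      exact tendsto_finsetSum _ fun i _ => hL _ (hf i)
    simp only [hLN]
    rw [Metric.tendsto_atTop]
    intro ε hε
    obtain ⟨n, hn⟩ := (hc.eventually (gt_mem_nhds (show (0 : ℝ) < ε / 4 by positivity))).exists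
    have hμn : Tendsto (fun N : ℕ => (μ n).real (⋃ i ∈ Finset.range N, f i)) atTop
        (𝓝 ((μ n).real (⋃ i, f i))) := by
      simp only [hfin]
      have h1 : HasSum (fun i => (μ n).real (f i)) ((μ n).real (⋃ i, f i)) := by
        have h2 := measure_iUnion (μ := μ n) hd hf
        have h3 : ∑' i, (μ n) (f i) ≠ ⊤ := by rw [← h2]; exact measure_ne_top _ _
        rw [Measure.real, h2]
        rw [ENNReal.tsum_toReal_eq fun i => measure_ne_top _ _]
        exact ENNReal.hasSum_toReal h3
      exact h1.tendsto_sum_nat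
    obtain ⟨N₀, hN₀⟩ := Metric.tendsto_atTop.1 hμn (ε / 4) (by positivity)
    refine ⟨N₀, fun N hN => ?_⟩
    have h1 := hN₀ N hN
    have h2 := hLc _ (hUn N) n
    have h3 := hLc _ hU n
    rw [Real.dist_eq] at h1 ⊢
    rw [abs_lt] at h1 ⊢
    rw [abs_le] at h2 h3
    constructor <;> linarith
  have hL_empty : L ∅ = 0 := tendsto_nhds_unique (hL ∅ .empty) (by simp)
  let π : Measure X := Measure.ofMeasurable (fun A _ => ENNReal.ofReal (L A))
    (by simp [hL_empty]) (fun f hf hd => by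
      rw [← (hsum f hf hd).tsum_eq,
        ENNReal.ofReal_tsum_of_nonneg (fun i => hL0 _ (hf i)) (hsum f hf hd).summable])
  have hπ : ∀ A, MeasurableSet A → π A = ENNReal.ofReal (L A) := fun A hA =>
    Measure.ofMeasurable_apply A hA
  have hL_univ : L Set.univ = 1 := tendsto_nhds_unique (hL _ .univ) (by simp)
  refine ⟨π, ⟨by rw [hπ _ .univ, hL_univ, ENNReal.ofReal_one]⟩, fun A hA => ?_⟩
  rw [hπ A hA]
  have := ENNReal.tendsto_ofReal (hL A hA)
  simpa [Measure.real, ENNReal.ofReal_toReal (measure_ne_top _ _)] using this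

/-- Fatou's lemma in the layer-cake variable, where setwise convergence is pointwise convergence of
the integrand. -/
lemma lintegral_le_liminf_of_tendsto {μ : ℕ → Measure X} {π : Measure X}
    (h : ∀ A, MeasurableSet A → Tendsto (fun n => μ n A) atTop (𝓝 (π A)))
    {f : X → ℝ} (hf : Measurable f) (hf0 : ∀ x, 0 ≤ f x) :
    ∫⁻ x, ENNReal.ofReal (f x) ∂π ≤
      liminf (fun n => ∫⁻ x, ENNReal.ofReal (f x) ∂(μ n)) atTop := by
  have e : ∀ ρ : Measure X, ∫⁻ x, ENNReal.ofReal (f x) ∂ρ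
      = ∫⁻ t in Set.Ioi 0, ρ {x : X | t < f x} := fun ρ =>
    lintegral_eq_lintegral_meas_lt ρ (Eventually.of_forall hf0) hf.aemeasurable
  simp only [e]
  refine le_trans (le_of_eq ?_) (lintegral_liminf_le fun n => ?_)
  · refine lintegral_congr fun t => ?_
    exact (h _ (measurableSet_lt measurable_const hf)).liminf_eq.symm
  · exact Antitone.measurable fun s t hst => measure_mono fun x (hx : t < f x) => hst.trans_lt hx

lemma integrable_and_integral_le {ρ : Measure X} {V : X → ℝ} (hV : Measurable V)
    (hV0 : ∀ x, 0 ≤ V x) {M : ℝ} (hM : 0 ≤ M)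
    (h : ∫⁻ x, ENNReal.ofReal (V x) ∂ρ ≤ ENNReal.ofReal M) :
    Integrable V ρ ∧ ∫ x, V x ∂ρ ≤ M := by
  refine ⟨⟨hV.aestronglyMeasurable, ?_⟩, ?_⟩
  · rw [hasFiniteIntegral_iff_ofReal (Eventually.of_forall hV0)]
    exact h.trans_lt ENNReal.ofReal_lt_top
  · rw [integral_eq_lintegral_of_nonneg_ae (Eventually.of_forall hV0) hV.aestronglyMeasurable]
    exact ENNReal.toReal_le_of_le_ofReal hM h

lemma integrable_of_oscillation {ρ : Measure X} [IsFiniteMeasure ρ] {V φ : X → ℝ}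
    (hVi : Integrable V ρ) (hφ : Measurable φ) {C β : ℝ}
    (h : ∀ u v, |φ u - φ v| ≤ C * (2 + β * (V u + V v))) : Integrable φ ρ := by
  rcases isEmpty_or_nonempty X with hX | ⟨⟨x⟩⟩
  · rw [Measure.eq_zero_of_isEmpty ρ]
    exact integrable_zero_measure
  refine Integrable.mono' (g := fun u => |φ x| + C * (2 + β * (V u + V x))) ?_
    hφ.aestronglyMeasurable (Eventually.of_forall fun u => ?_)
  · exact (integrable_const _).add (((integrable_const _).add
      ((hVi.add (integrable_const _)).const_mul β)).const_mul C)
  · have := h u x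
    rw [Real.norm_eq_abs]
    have h2 := abs_sub_abs_le_abs_sub (φ u) (φ x)
    linarith

lemma integral_bind_kernel {Y : Type*} [MeasurableSpace Y] {ρ : Measure X} {κ : Kernel X Y}
    {φ : Y → ℝ} (h : Integrable φ (ρ.bind κ)) :
    ∫ z, φ z ∂(ρ.bind κ) = ∫ x, ∫ z, φ z ∂(κ x) ∂ρ := by
  rw [Measure.comp_eq_comp_const_apply] at h ⊢
  rw [Kernel.integral_comp h, Kernel.const_apply]

variable {P : Kernel X X}

lemma pow_succ_comp_apply (n : ℕ) (x : X) : (P ^ (n + 1)) x = (P x).bind (P ^ n) := by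
  rw [pow_succ]; rfl

lemma pow_add_comp_apply (n k : ℕ) (x : X) : (P ^ (n + k)) x = ((P ^ k) x).bind (P ^ n) := by
  rw [pow_add]; rfl

variable [IsMarkovKernel P] {V : X → ℝ} {a b : ℝ}

instance isMarkovKernel_pow (n : ℕ) : IsMarkovKernel (P ^ n) := by
  induction n with
  | zero => rw [pow_zero]; exact inferInstanceAs (IsMarkovKernel (Kernel.id : Kernel X X))
  | succ n ih => rw [pow_succ]; exact inferInstanceAs (IsMarkovKernel ((P ^ n) ∘ₖ P))

lemma lintegral_pow_le_of_drift (hV : Measurable V) (hV0 : ∀ x, 0 ≤ V x) (ha : 0 ≤ a) (ha1 : a < 1)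
    (hb : 0 ≤ b)
    (hdrift : ∀ x, ∫⁻ y, ENNReal.ofReal (V y) ∂(P x) ≤ ENNReal.ofReal (a * V x + b))
    (n : ℕ) (x : X) :
    ∫⁻ y, ENNReal.ofReal (V y) ∂((P ^ n) x) ≤ ENNReal.ofReal (a ^ n * V x + b / (1 - a)) := by
  have hs : 0 < 1 - a := by linarith
  induction n with
  | zero =>
    rw [pow_zero]
    change ∫⁻ y, ENNReal.ofReal (V y) ∂(Kernel.id x) ≤ _
    rw [Kernel.id_apply, lintegral_dirac' _ hV.ennreal_ofReal]
    refine ENNReal.ofReal_le_ofReal ?_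
    have : 0 ≤ b / (1 - a) := by positivity
    simpa using this
  | succ n ih =>
    rw [pow_succ']
    change ∫⁻ y, ENNReal.ofReal (V y) ∂((P ∘ₖ (P ^ n)) x) ≤ _
    rw [Kernel.lintegral_comp _ _ _ hV.ennreal_ofReal]
    have hM : 0 ≤ a ^ n * V x + b / (1 - a) := by
      have := hV0 x
      positivity
    obtain ⟨hi, hle⟩ := integrable_and_integral_le hV hV0 hM ih
    refine (lintegral_mono fun y => hdrift y).trans ?_
    rw [← ofReal_integral_eq_lintegral_ofReal
      (show Integrable (fun y => a * V y + b) _ from (hi.const_mul a).add (integrable_const b))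
      (Eventually.of_forall fun y => add_nonneg (mul_nonneg ha (hV0 y)) hb)]
    refine ENNReal.ofReal_le_ofReal ?_
    have e1 : ∫ y, (a * V y + b) ∂((P ^ n) x) = a * ∫ y, V y ∂((P ^ n) x) + b := by
      rw [integral_add (hi.const_mul a) (integrable_const b), integral_const_mul]
      simp
    rw [e1]
    calc a * ∫ y, V y ∂((P ^ n) x) + b ≤ a * (a ^ n * V x + b / (1 - a)) + b := by gcongr
      _ = a ^ (n + 1) * V x + b / (1 - a) := by field_simp; ring

/-- For `V x + V y` large the drift alone contracts. For `V x + V y` small the common part `ν` gains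
a fixed amount, and a small weight `β` keeps the additive constant of the drift below this gain. -/
lemma exists_oscillation_contraction (hV : Measurable V) (hV0 : ∀ x, 0 ≤ V x) (ha : 0 ≤ a)
    (ha1 : a < 1) (hb : 0 ≤ b)
    (hdrift : ∀ x, ∫⁻ y, ENNReal.ofReal (V y) ∂(P x) ≤ ENNReal.ofReal (a * V x + b))
    (hminor : ∀ R : ℝ, ∃ ν : Measure X, ν Set.univ ≠ 0 ∧ ∀ x, V x ≤ R → ν ≤ P x) :
    ∃ β θ : ℝ, 0 < β ∧ 0 < θ ∧ θ < 1 ∧ ∀ (φ : X → ℝ) (C : ℝ), Measurable φ → 0 ≤ C →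
      (∀ u v, |φ u - φ v| ≤ C * (2 + β * (V u + V v))) →
      ∀ x y, |∫ u, φ u ∂(P x) - ∫ v, φ v ∂(P y)| ≤ θ * C * (2 + β * (V x + V y)) := by
  -- Beyond this level half of the gap `1 - a` is worth `2 * (b + 1)`, more than the constants `2 *
  -- b` of the two drifts.
  set R : ℝ := 4 * (b + 1) / (1 - a) with hR
  have hs : 0 < 1 - a := by linarith
  -- Halving `ν` leaves a remainder of positive mass under every `P x`. If the sublevel set is
  -- empty, any nonzero measure of mass at most 1/2 will do.
  obtain ⟨ν, hν0, hν⟩ : ∃ ν : Measure X, ν Set.univ ≠ 0 ∧ ν Set.univ ≤ ENNReal.ofReal (1 / 2) ∧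
      ∀ x, V x ≤ R → ν ≤ P x := by
    obtain ⟨ν, hν0, hν⟩ := hminor R
    by_cases hex : ∃ x, V x ≤ R
    · obtain ⟨x, hx⟩ := hex
      refine ⟨ENNReal.ofReal (1 / 2) • ν, ?_, ?_, fun y hy => ?_⟩
      · simpa using hν0
      · calc ENNReal.ofReal (1 / 2) * ν Set.univ ≤ ENNReal.ofReal (1 / 2) * P x Set.univ := by
              gcongr; exact hν x hx
          _ = _ := by simp
      · refine le_trans ?_ (hν y hy)
        refine Measure.le_iff.2 fun s _ => ?_
        rw [Measure.smul_apply, smul_eq_mul]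
        refine mul_le_of_le_one_left zero_le ?_
        rw [ENNReal.ofReal_le_one]; norm_num
    · push Not at hex
      rcases isEmpty_or_nonempty X with hX | ⟨⟨x⟩⟩
      · exact absurd (by rw [Measure.eq_zero_of_isEmpty ν]; rfl) hν0
      · exact ⟨ENNReal.ofReal (1 / 2) • Measure.dirac x, by simp, by simp,
          fun y hy => absurd hy (not_le.2 (hex y))⟩
  obtain ⟨hνle, hν⟩ := hν
  have hνfin : ν Set.univ ≠ ⊤ := (hνle.trans_lt ENNReal.ofReal_lt_top).ne
  set e : ℝ := ν.real Set.univ with he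
  have he0 : 0 < e := ENNReal.toReal_pos hν0 hνfin
  have he1 : e ≤ 1 / 2 := ENNReal.toReal_le_of_le_ofReal (by norm_num) hνle
  -- Then `2 * β * b ≤ e`, half of the gain `2 * e` from the common part.
  set β : ℝ := e / (2 * (b + 1)) with hβ
  have hβ0 : 0 < β := by positivity
  have hβb : β * (b + 1) = e / 2 := by rw [hβ]; field_simp
  set q : ℝ := min (e / 2) (min ((1 - a) / 2) β) with hq
  have hq0 : 0 < q := by simp only [hq, lt_min_iff]; exact ⟨by positivity, by positivity, hβ0⟩
  have hq1 : q ≤ e / 2 := min_le_left _ _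
  have hq2 : q ≤ (1 - a) / 2 := (min_le_right _ _).trans (min_le_left _ _)
  have hq3 : q ≤ β := (min_le_right _ _).trans (min_le_right _ _)
  refine ⟨β, 1 - q, hβ0, by linarith, by linarith, fun φ C hφ hC h x y => ?_⟩
  have hPV : ∀ x, Integrable V (P x) ∧ ∫ y, V y ∂(P x) ≤ a * V x + b := fun x =>
    integrable_and_integral_le hV hV0 (add_nonneg (mul_nonneg ha (hV0 x)) hb) (hdrift x)
  have hφi : ∀ x, Integrable φ (P x) := fun x => integrable_of_oscillation (hPV x).1 hφ h
  have hWi : ∀ x, Integrable (fun u => C * (1 + β * V u)) (P x) := fun x =>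
    ((integrable_const _).add ((hPV x).1.const_mul β)).const_mul C
  have hWint : ∀ x, ∫ u, C * (1 + β * V u) ∂(P x) ≤ C * (1 + β * (a * V x + b)) := by
    intro x
    rw [integral_const_mul, integral_add (integrable_const _) ((hPV x).1.const_mul β),
      integral_const_mul]
    simp only [integral_const, probReal_univ, smul_eq_mul, one_mul]
    have := (hPV x).2
    gcongr
  have hosc : ∀ u v, |φ u - φ v| ≤ C * (1 + β * V u) + C * (1 + β * V v) := fun u v =>
    (h u v).trans (le_of_eq (by ring))
  have hWC : ∀ u, C ≤ C * (1 + β * V u) := fun u =>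
    le_mul_of_one_le_right hC (by have := mul_nonneg hβ0.le (hV0 u); linarith)
  have hsum0 : 0 ≤ V x + V y := add_nonneg (hV0 x) (hV0 y)
  have hx := hWint x
  have hy := hWint y
  rcases le_total R (V x + V y) with hRle | hRle
  · have h1 := abs_integral_sub_integral_le_of_common (μ₁ := P x) (μ₂ := P y) (ν := 0)
      (Measure.zero_le _) (Measure.zero_le _) (by simp) (hφi x) (hφi y) (hWi x) (hWi y) hWC hosc
    simp only [measureReal_zero_apply, mul_zero, sub_zero] at h1
    have h2 : 2 * q + 2 * β * b ≤ β * (1 - q - a) * (V x + V y) := by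
      have h3 : 2 * (b + 1) ≤ (1 - q - a) * (V x + V y) := by
        calc 2 * (b + 1) = (1 - a) / 2 * R := by rw [hR]; field_simp; ring
          _ ≤ (1 - q - a) * (V x + V y) :=
            mul_le_mul (by linarith) hRle (by positivity) (by linarith)
      nlinarith
    have h4 : 2 + β * (a * V x + b) + β * (a * V y + b) ≤ (1 - q) * (2 + β * (V x + V y)) := by
      nlinarith
    calc _ ≤ C * (2 + β * (a * V x + b) + β * (a * V y + b)) := by linarith
      _ ≤ C * ((1 - q) * (2 + β * (V x + V y))) := by gcongr
      _ = _ := by ring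
  · have h1 := abs_integral_sub_integral_le_of_common (μ₁ := P x) (μ₂ := P y) (ν := ν)
      (hν x (by linarith [hV0 y])) (hν y (by linarith [hV0 x])) (by linarith) (hφi x) (hφi y)
      (hWi x) (hWi y) hWC hosc
    have h4 : 2 + β * (a * V x + b) + β * (a * V y + b) - 2 * e
        ≤ (1 - q) * (2 + β * (V x + V y)) := by
      have h5 : 0 ≤ (1 - q - a) * (β * (V x + V y)) :=
        mul_nonneg (by linarith) (mul_nonneg hβ0.le hsum0)
      nlinarith
    calc _ ≤ C * (2 + β * (a * V x + b) + β * (a * V y + b) - 2 * e) := by linarith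
      _ ≤ C * ((1 - q) * (2 + β * (V x + V y))) := by gcongr
      _ = _ := by ring

/-- **Harris' theorem**: a Markov kernel with a Lyapunov function whose sublevel sets are small
has a unique invariant probability measure and is geometrically ergodic. -/
theorem harris [Nonempty X] (hV : Measurable V) (hV0 : ∀ x, 0 ≤ V x) (ha : 0 ≤ a)
    (ha1 : a < 1) (hb : 0 ≤ b)
    (hdrift : ∀ x, ∫⁻ y, ENNReal.ofReal (V y) ∂(P x) ≤ ENNReal.ofReal (a * V x + b))
    (hminor : ∀ R : ℝ, ∃ ν : Measure X, ν Set.univ ≠ 0 ∧ ∀ x, V x ≤ R → ν ≤ P x) :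
    ∃ π : Measure X, (IsProbabilityMeasure π ∧ Kernel.Invariant P π) ∧
      (∀ π' : Measure X, IsProbabilityMeasure π' → Kernel.Invariant P π' → π' = π) ∧
      Integrable V π ∧
      ∃ lam κ : ℝ, 0 < lam ∧ lam < 1 ∧ 0 < κ ∧
        ∀ φ : X → ℝ, Measurable φ → (∀ x, |φ x| ≤ 1 + V x) → ∀ (x : X) (n : ℕ),
          Integrable φ ((P ^ n) x) ∧
          |∫ u, φ u ∂((P ^ n) x) - ∫ u, φ u ∂π| ≤ κ * lam ^ n * (1 + V x) := by
  obtain ⟨β, θ, hβ, hθ0, hθ1, hcon⟩ :=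
    exists_oscillation_contraction hV hV0 ha ha1 hb hdrift hminor
  have hs : 0 < 1 - a := by linarith
  have hPV : ∀ (n : ℕ) x, Integrable V ((P ^ n) x) ∧
      ∫ y, V y ∂((P ^ n) x) ≤ a ^ n * V x + b / (1 - a) := fun n x =>
    integrable_and_integral_le hV hV0 (by have := hV0 x; positivity)
      (lintegral_pow_le_of_drift hV hV0 ha ha1 hb hdrift n x)
  have hmeasP : ∀ (φ : X → ℝ) (n : ℕ), Measurable φ →
      Measurable fun x => ∫ u, φ u ∂((P ^ n) x) := fun φ n hφ =>
    (StronglyMeasurable.integral_kernel hφ.stronglyMeasurable).measurable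
  have hosc : ∀ (φ : X → ℝ) (C : ℝ), Measurable φ → 0 ≤ C →
      (∀ u v, |φ u - φ v| ≤ C * (2 + β * (V u + V v))) → ∀ (n : ℕ) x y,
      |∫ u, φ u ∂((P ^ n) x) - ∫ v, φ v ∂((P ^ n) y)| ≤ θ ^ n * C * (2 + β * (V x + V y)) := by
    intro φ C hφ hC h n
    induction n with
    | zero =>
      intro x y
      rw [pow_zero]
      change |∫ u, φ u ∂(Kernel.id x) - ∫ v, φ v ∂(Kernel.id y)| ≤ _
      rw [Kernel.id_apply, Kernel.id_apply, integral_dirac' _ _ hφ.stronglyMeasurable,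
        integral_dirac' _ _ hφ.stronglyMeasurable]
      simpa using h x y
    | succ n ih =>
      intro x y
      have e : ∀ x, ∫ u, φ u ∂((P ^ (n + 1)) x) = ∫ z, ∫ u, φ u ∂((P ^ n) z) ∂(P x) := by
        intro x
        have hi := integrable_of_oscillation (hPV (n + 1) x).1 hφ h
        rw [pow_succ_comp_apply] at hi ⊢
        exact integral_bind_kernel hi
      rw [e, e]
      refine (hcon _ _ (hmeasP φ n hφ) (by positivity) ih x y).trans (le_of_eq ?_)
      ring
  -- The contraction averaged over the second starting point. Taking `ρ` to be a later iterate gives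
  -- the Cauchy property; taking `ρ = π` gives convergence.
  have hav : ∀ (φ : X → ℝ) (C : ℝ), Measurable φ → 0 ≤ C →
      (∀ u v, |φ u - φ v| ≤ C * (2 + β * (V u + V v))) → ∀ (n : ℕ) (x : X) (ρ : Measure X),
      IsProbabilityMeasure ρ → Integrable V ρ → Integrable φ (ρ.bind ⇑(P ^ n)) →
      |∫ u, φ u ∂((P ^ n) x) - ∫ u, φ u ∂(ρ.bind ⇑(P ^ n))|
        ≤ θ ^ n * C * (2 + β * (V x + ∫ y, V y ∂ρ)) := by
    intro φ C hφ hC h n x ρ hρ hVρ hφρ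
    have hi : Integrable (fun y => ∫ u, φ u ∂((P ^ n) y)) ρ :=
      integrable_of_oscillation hVρ (hmeasP φ n hφ) (hosc φ C hφ hC h n)
    rw [integral_bind_kernel hφρ]
    have e1 : ∫ u, φ u ∂((P ^ n) x) - ∫ y, ∫ u, φ u ∂((P ^ n) y) ∂ρ
        = ∫ y, (∫ u, φ u ∂((P ^ n) x) - ∫ u, φ u ∂((P ^ n) y)) ∂ρ := by
      rw [integral_sub (integrable_const _) hi]; simp
    have hi2 : Integrable (fun y => 2 + β * (V x + V y)) ρ :=
      (integrable_const _).add (((integrable_const _).add hVρ).const_mul β)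
    have e2 : ∫ y, θ ^ n * C * (2 + β * (V x + V y)) ∂ρ
        = θ ^ n * C * (2 + β * (V x + ∫ y, V y ∂ρ)) := by
      have hi3 : Integrable (fun y => V x + V y) ρ := (integrable_const _).add hVρ
      rw [integral_const_mul, integral_add (integrable_const _) (hi3.const_mul β),
        integral_const_mul, integral_add (integrable_const _) hVρ]
      simp
    rw [e1, ← e2]
    exact abs_integral_le_integral_abs.trans (integral_mono
      ((integrable_const _).sub hi).abs (hi2.const_mul _) fun y => hosc φ C hφ hC h n x y)
  have hind : ∀ A : Set X, MeasurableSet A → ∀ u v,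
      |A.indicator (fun _ => (1 : ℝ)) u - A.indicator (fun _ => (1 : ℝ)) v|
        ≤ 1 * (2 + β * (V u + V v)) := by
    intro A hA u v
    have h1 := mul_nonneg hβ.le (add_nonneg (hV0 u) (hV0 v))
    by_cases hu : u ∈ A <;> by_cases hv : v ∈ A <;> simp [hu, hv] <;> linarith
  have hindm : ∀ A : Set X, MeasurableSet A → Measurable (A.indicator fun _ => (1 : ℝ)) :=
    fun A hA => measurable_const.indicator hA
  have hindi : ∀ (A : Set X), MeasurableSet A → ∀ (ρ : Measure X), IsProbabilityMeasure ρ →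
      Integrable (A.indicator fun _ => (1 : ℝ)) ρ := fun A hA ρ _ =>
    (integrable_const _).indicator hA
  have hindint : ∀ (A : Set X), MeasurableSet A → ∀ ρ : Measure X,
      ∫ u, A.indicator (fun _ => (1 : ℝ)) u ∂ρ = ρ.real A := fun A hA ρ => by
    rw [integral_indicator hA]; simp
  obtain ⟨x₀⟩ := ‹Nonempty X›
  let D : ℝ := 2 + β * (V x₀ + (V x₀ + b / (1 - a)))
  have hθn : Tendsto (fun n : ℕ => θ ^ n) atTop (𝓝 0) :=
    tendsto_pow_atTop_nhds_zero_of_lt_one hθ0.le hθ1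
  obtain ⟨π, hπ, hπlim⟩ := exists_probabilityMeasure_tendsto (μ := fun n => (P ^ n) x₀)
    (c := fun n => θ ^ n * D) (by simpa using hθn.mul_const D) (fun A hA n k hnk => by
      obtain ⟨j, rfl⟩ := Nat.exists_eq_add_of_le hnk
      have h1 := hav _ 1 (hindm A hA) zero_le_one (hind A hA) n x₀ ((P ^ j) x₀) inferInstance
        (hPV j x₀).1 (by
          rw [← pow_add_comp_apply]; exact hindi A hA _ inferInstance)
      rw [← pow_add_comp_apply, hindint A hA, hindint A hA, abs_sub_comm, mul_one] at h1
      refine h1.trans ?_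
      have h2 : ∫ y, V y ∂((P ^ j) x₀) ≤ V x₀ + b / (1 - a) := by
        refine (hPV j x₀).2.trans ?_
        gcongr
        exact mul_le_of_le_one_left (hV0 _) (pow_le_one₀ ha ha1.le)
      simp only [D]
      gcongr)
  -- Fatou gives that `π` pushed through `P` is at most `π` on every set, and of two probability
  -- measures so ordered both are equal. No continuity of `P` enters.
  have hπinv : Kernel.Invariant P π := by
    have : IsProbabilityMeasure (π.bind P) := inferInstanceAs (IsProbabilityMeasure (P ∘ₘ π))
    refine Measure.eq_of_le_of_isProbabilityMeasure (Measure.le_iff.2 fun A hA => ?_)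
    rw [Measure.bind_apply hA (Kernel.aemeasurable _)]
    have h1 := lintegral_le_liminf_of_tendsto hπlim (f := fun y => (P y).real A)
      (Kernel.measurable_coe P hA).ennreal_toReal (fun y => measureReal_nonneg)
    simp only [Measure.real, ENNReal.ofReal_toReal (measure_ne_top _ _)] at h1
    refine h1.trans (le_of_eq ?_)
    have h2 : (fun n : ℕ => ∫⁻ y, P y A ∂((P ^ n) x₀)) = fun n => (P ^ (n + 1)) x₀ A :=
      funext fun n => (Kernel.pow_succ_apply_eq_lintegral P n x₀ hA).symm
    rw [h2]
    exact ((hπlim A hA).comp (tendsto_add_atTop_nat 1)).liminf_eq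
  have hpow : ∀ (π' : Measure X), Kernel.Invariant P π' → ∀ n : ℕ, π'.bind (P ^ n) = π' := by
    intro π' h n
    induction n with
    | zero => rw [pow_zero]; exact Measure.bind_dirac
    | succ n ih =>
      have : Kernel.Invariant (P ^ n) π' := ih
      rw [pow_succ]
      exact this.comp h
  have hVπ : Integrable V π := by
    refine (integrable_and_integral_le hV hV0 (M := V x₀ + b / (1 - a))
      (by have := hV0 x₀; positivity) ?_).1
    refine (lintegral_le_liminf_of_tendsto hπlim hV hV0).trans ?_
    refine liminf_le_of_le (by isBoundedDefault) fun c hc => ?_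
    obtain ⟨n, hn⟩ := hc.exists
    refine hn.trans ((lintegral_pow_le_of_drift hV hV0 ha ha1 hb hdrift n x₀).trans ?_)
    refine ENNReal.ofReal_le_ofReal ?_
    gcongr
    exact mul_le_of_le_one_left (hV0 _) (pow_le_one₀ ha ha1.le)
  have herg : ∀ (φ : X → ℝ) (C : ℝ), Measurable φ → 0 ≤ C →
      (∀ u v, |φ u - φ v| ≤ C * (2 + β * (V u + V v))) → ∀ (n : ℕ) (x : X),
      |∫ u, φ u ∂((P ^ n) x) - ∫ u, φ u ∂π| ≤ θ ^ n * C * (2 + β * (V x + ∫ y, V y ∂π)) := by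
    intro φ C hφ hC h n x
    have h1 := hav φ C hφ hC h n x π hπ hVπ (by
      rw [hpow π hπinv]; exact integrable_of_oscillation hVπ hφ h)
    rwa [hpow π hπinv] at h1
  refine ⟨π, ⟨hπ, hπinv⟩, fun π' hπ' hinv' => ?_, hVπ, θ,
    max 1 (1 / β) * (2 + β * (1 + ∫ y, V y ∂π)), hθ0, hθ1, ?_, fun φ hφ hφV x n => ?_⟩
  -- Uniqueness: `(P ^ n) x A` tends to `π A` for every `x`; integration against `π'` preserves the
  -- limit by dominated convergence.
  · refine Measure.ext fun A hA => ?_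
    have h1 : ∀ x, Tendsto (fun n : ℕ => (P ^ n) x A) atTop (𝓝 (π A)) := by
      intro x
      have h2 : Tendsto (fun n : ℕ => ((P ^ n) x).real A) atTop (𝓝 (π.real A)) := by
        rw [tendsto_iff_dist_tendsto_zero]
        refine squeeze_zero (g := fun n : ℕ => θ ^ n * (1 * (2 + β * (V x + ∫ y, V y ∂π))))
          (fun n => dist_nonneg) (fun n => ?_) (by simpa using hθn.mul_const _)
        rw [Real.dist_eq]
        have := herg _ 1 (hindm A hA) zero_le_one (hind A hA) n x
        rw [hindint A hA, hindint A hA] at this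
        linarith
      have := ENNReal.tendsto_ofReal h2
      simpa [Measure.real, ENNReal.ofReal_toReal (measure_ne_top _ _)] using this
    have h3 : ∀ n : ℕ, ∫⁻ x, (P ^ n) x A ∂π' = π' A := by
      intro n
      conv_rhs => rw [← hpow π' hinv' n]
      rw [Measure.bind_apply hA (Kernel.aemeasurable _)]
    have h4 := tendsto_lintegral_of_dominated_convergence (μ := π') (F := fun n x => (P ^ n) x A)
      (f := fun _ => π A) (fun _ => 1) (fun n => Kernel.measurable_coe _ hA)
      (fun n => Eventually.of_forall fun x => prob_le_one) (by simp)
      (Eventually.of_forall h1)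
    simp only [h3, lintegral_const, measure_univ, mul_one] at h4
    exact tendsto_nhds_unique tendsto_const_nhds h4
  · have : 0 ≤ ∫ y, V y ∂π := integral_nonneg hV0
    positivity
  -- `C ≥ 1` and `C * β ≥ 1` turn `|φ| ≤ 1 + V` into the weighted oscillation bound.
  · set C := max 1 (1 / β) with hC
    have hC1 : 1 ≤ C := le_max_left _ _
    have hCβ : 1 ≤ C * β := by
      calc 1 = 1 / β * β := by field_simp
        _ ≤ C * β := by gcongr; exact le_max_right _ _
    have h : ∀ u v, |φ u - φ v| ≤ C * (2 + β * (V u + V v)) := by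
      intro u v
      have h1 := abs_sub (φ u) (φ v)
      have h2 := hφV u
      have h3 := hφV v
      have h4 : V u + V v ≤ C * β * (V u + V v) :=
        le_mul_of_one_le_left (add_nonneg (hV0 u) (hV0 v)) hCβ
      linarith
    refine ⟨integrable_of_oscillation (hPV n x).1 hφ h, (herg φ C hφ (by positivity) h n x).trans ?_⟩
    have hI : 0 ≤ ∫ y, V y ∂π := integral_nonneg hV0
    have h5 : 2 + β * (V x + ∫ y, V y ∂π) ≤ (2 + β * (1 + ∫ y, V y ∂π)) * (1 + V x) := by
      have := hV0 x
      nlinarith [mul_nonneg hI this, mul_nonneg hβ.le (mul_nonneg hI this), mul_nonneg hβ.le this]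
    calc _ ≤ θ ^ n * C * ((2 + β * (1 + ∫ y, V y ∂π)) * (1 + V x)) := by gcongr
      _ = _ := by ring

end Harris

end

/-! ### Splicing of noise, shifts of the scheme, measurability -/

noncomputable section

lemma measurable_nat_sInf {α : Type*} [MeasurableSpace α] {s : α → Set ℕ}
    (hs : ∀ k, MeasurableSet {a | k ∈ s a}) : Measurable fun a => sInf (s a) := by
  refine measurable_to_countable' fun n => ?_
  -- The second set accounts for `sInf ∅ = 0`.
  have h : (fun a => sInf (s a)) ⁻¹' {n} =
      ({a | n ∈ s a} ∩ ⋂ k : ℕ, ⋂ _ : k < n, {a | k ∈ s a}ᶜ) ∪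
        {a | n = 0 ∧ ∀ k, k ∉ s a} := by
    ext a
    simp only [Set.mem_preimage, Set.mem_singleton_iff, Set.mem_union, Set.mem_inter_iff,
      Set.mem_ofPred_eq, Set.mem_iInter, Set.mem_compl_iff]
    constructor
    · rintro rfl
      rcases (s a).eq_empty_or_nonempty with he | hne
      · right; simp [he]
      · exact Or.inl ⟨Nat.sInf_mem hne, fun k hk => Nat.notMem_of_lt_sInf hk⟩
    · rintro (⟨h1, h2⟩ | ⟨rfl, h⟩)
      · refine le_antisymm (Nat.sInf_le h1) ?_
        by_contra! hlt
        exact h2 _ hlt (Nat.sInf_mem ⟨n, h1⟩)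
      · rw [Set.eq_empty_of_forall_notMem h, Nat.sInf_empty]
  rw [h]
  refine ((hs n).inter (MeasurableSet.iInter fun k => MeasurableSet.iInter fun _ =>
    (hs k).compl)).union ?_
  by_cases hn : n = 0
  · simp only [hn, true_and]
    have : {a | ∀ k, k ∉ s a} = ⋂ k : ℕ, {a | k ∈ s a}ᶜ := by ext; simp
    rw [this]
    exact MeasurableSet.iInter fun k => (hs k).compl
  · simp [hn]

namespace AdaptiveEM

namespace Scheme

variable {m : ℕ}

instance : IsProbabilityMeasure (noise m) := by unfold noise; infer_instance

/-- The sequence that agrees with `ζ` before `n` and continues with `ξ` from `n` on. -/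
def concat (n : ℕ) (ζ ξ : ℕ → Vec m) : ℕ → Vec m := fun i => if i < n then ζ i else ξ (i - n)

lemma concat_of_lt {n i : ℕ} (h : i < n) (ζ ξ : ℕ → Vec m) : concat n ζ ξ i = ζ i := if_pos h

lemma concat_add (n i : ℕ) (ζ ξ : ℕ → Vec m) : concat n ζ ξ (i + n) = ξ i := by
  simp [concat]

lemma measurable_concat (n : ℕ) :
    Measurable fun p : (ℕ → Vec m) × (ℕ → Vec m) => concat n p.1 p.2 := by
  refine measurable_pi_lambda _ fun i => ?_
  unfold concat
  split_ifs <;> fun_prop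

/-- Independence of past and future in the form used throughout: replacing the noise from index `n`
on by an independent copy does not change the law. Agreement on finite cylinders suffices. -/
lemma map_concat_noise (n : ℕ) :
    ((noise m).prod (noise m)).map (fun p => concat n p.1 p.2) = noise m := by
  classical
  refine Measure.eq_infinitePi _ fun s t ht => ?_
  rw [Measure.map_apply (measurable_concat n)
    (MeasurableSet.pi s.countable_toSet fun i _ => ht i)]
  have hpre : (fun p : (ℕ → Vec m) × (ℕ → Vec m) => concat n p.1 p.2) ⁻¹' (Set.pi s t) =
      Set.pi (s.filter (· < n)) t ×ˢ
        Set.pi ((s.filter (n ≤ ·)).image (· - n)) (fun i => t (i + n)) := by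
    ext ⟨ζ, ξ⟩
    simp only [Set.mem_preimage, Set.mem_pi, Set.mem_prod, Finset.coe_filter, Set.mem_ofPred_eq,
      Finset.mem_coe, Finset.coe_image, Set.mem_image]
    constructor
    · intro h
      refine ⟨fun i hi => ?_, ?_⟩
      · simpa [concat, hi.2] using h i hi.1
      · rintro _ ⟨i, hi, rfl⟩
        have h1 := h i hi.1
        rw [Nat.sub_add_cancel hi.2]
        simpa [concat, not_lt.2 hi.2] using h1
    · rintro ⟨h1, h2⟩ i hi
      by_cases hin : i < n
      · simpa [concat, hin] using h1 i ⟨hi, hin⟩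
      · have h3 := h2 (i - n) ⟨i, ⟨hi, not_lt.1 hin⟩, rfl⟩
        rw [Nat.sub_add_cancel (not_lt.1 hin)] at h3
        simpa [concat, hin] using h3
  rw [hpre, Measure.prod_prod, noise, Measure.infinitePi_pi _ fun i _ => ht i,
    Measure.infinitePi_pi _ fun i _ => ht (i + n), Finset.prod_image,
    ← Finset.prod_filter_mul_prod_filter_not s (· < n)]
  · congr 1
    simp only [not_lt]
    refine Finset.prod_congr rfl fun i hi => ?_
    rw [Nat.sub_add_cancel (Finset.mem_filter.1 hi).2]
  · intro i hi j hj hij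
    have h1 := (Finset.mem_filter.1 hi).2
    have h2 := (Finset.mem_filter.1 hj).2
    simp only at hij
    omega

lemma lintegral_noise_concat (n : ℕ) {F : (ℕ → Vec m) → ENNReal} (hF : Measurable F) :
    ∫⁻ η, F η ∂(noise m) = ∫⁻ ζ, ∫⁻ ξ, F (concat n ζ ξ) ∂(noise m) ∂(noise m) := by
  conv_lhs => rw [← map_concat_noise n]
  rw [lintegral_map hF (measurable_concat n),
    lintegral_prod (fun p : (ℕ → Vec m) × (ℕ → Vec m) => F (concat n p.1 p.2))
      (hF.comp (measurable_concat n)).aemeasurable]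

/-- Conditioning on the first noise value, the basis of every one-step recursion for the scheme. -/
lemma lintegral_noise_cons {F : Vec m → (ℕ → Vec m) → ENNReal}
    (hF : Measurable (Function.uncurry F)) :
    ∫⁻ η, F (η 0) (fun i => η (i + 1)) ∂(noise m)
      = ∫⁻ e, ∫⁻ ξ, F e ξ ∂(noise m) ∂(stdGaussian (Vec m)) := by
  have h1 : Measurable fun η : ℕ → Vec m => F (η 0) fun i => η (i + 1) := by
    have : Measurable fun η : ℕ → Vec m => (η 0, fun i => η (i + 1)) := by fun_prop
    exact hF.comp this
  rw [lintegral_noise_concat 1 h1]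
  have h2 : ∀ ζ ξ : ℕ → Vec m, F (concat 1 ζ ξ 0) (fun i => concat 1 ζ ξ (i + 1)) = F (ζ 0) ξ :=
    fun ζ ξ => by simp only [concat_add]; rw [concat_of_lt one_pos]
  simp only [h2]
  have h3 : (noise m).map (fun ζ => ζ 0) = stdGaussian (Vec m) := Measure.infinitePi_map_eval _ 0
  have h4 : Measurable fun e => ∫⁻ ξ, F e ξ ∂(noise m) := hF.lintegral_prod_right'
  rw [← h3, lintegral_map h4 (measurable_pi_apply 0)]

variable (S : Scheme m)

lemma chain_succ' (w : State m) (η : ℕ → Vec m) (n : ℕ) :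
    S.chain w η (n + 1) = S.chain (S.step w (η 0)) (fun i => η (i + 1)) n := by
  induction n with
  | zero => rfl
  | succ n ih => rw [chain, ih]; rfl

lemma chain_add (w : State m) (η : ℕ → Vec m) (n k : ℕ) :
    S.chain w η (n + k) = S.chain (S.chain w η n) (fun i => η (i + n)) k := by
  induction k with
  | zero => rfl
  | succ k ih => rw [← add_assoc, chain, ih, chain, add_comm k n]

lemma time_add (w : State m) (η : ℕ → Vec m) (n k : ℕ) :
    S.time w η (n + k) = S.time w η n + S.time (S.chain w η n) (fun i => η (i + n)) k := by
  induction k with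
  | zero => simp [time]
  | succ k ih => rw [← add_assoc, time, ih, time, add_assoc n k 1, chain_add, add_assoc]

lemma time_succ' (w : State m) (η : ℕ → Vec m) (n : ℕ) :
    S.time w η (n + 1) = S.stepSize (S.step w (η 0)).2
      + S.time (S.step w (η 0)) (fun i => η (i + 1)) n := by
  rw [add_comm n 1, time_add]
  simp [time, chain]

lemma chain_congr (w : State m) {η η' : ℕ → Vec m} {n : ℕ} (h : ∀ i < n, η i = η' i) :
    S.chain w η n = S.chain w η' n := by
  induction n with
  | zero => rfl
  | succ n ih => rw [chain, chain, ih fun i hi => h i (by omega), h n (by omega)]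

lemma time_congr (w : State m) {η η' : ℕ → Vec m} {n : ℕ} (h : ∀ i < n, η i = η' i) :
    S.time w η n = S.time w η' n := by
  induction n with
  | zero => rfl
  | succ n ih => rw [time, time, ih fun i hi => h i (by omega), S.chain_congr w h]

/-- The indices at which the time elapsed exceeds `δ`, if the time `s` has elapsed initially. -/
def hitSet (w : State m) (s : ℝ) (η : ℕ → Vec m) : Set ℕ := {n | S.δ ≤ s + S.time w η n}

lemma zero_mem_hitSet {w : State m} {s : ℝ} {η : ℕ → Vec m} :
    0 ∈ S.hitSet w s η ↔ S.δ ≤ s := by simp [hitSet, time]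

lemma succ_mem_hitSet {w : State m} {s : ℝ} {η : ℕ → Vec m} {n : ℕ} :
    n + 1 ∈ S.hitSet w s η ↔ n ∈ S.hitSet (S.step w (η 0)) (s + S.stepSize (S.step w (η 0)).2)
      (fun i => η (i + 1)) := by
  simp only [hitSet, Set.mem_ofPred_eq, time_succ', add_assoc]

lemma stepSize_succ (k : ℕ) : 2 * S.stepSize (k + 1) = S.stepSize k := by
  unfold stepSize; rw [pow_succ]; ring

lemma tendsto_stepSize : Filter.Tendsto S.stepSize Filter.atTop (nhds 0) := by
  have := (tendsto_pow_atTop_nhds_zero_of_lt_one (r := (2 : ℝ)⁻¹) (by norm_num)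
    (by norm_num)).mul_const S.Δmax
  rwa [zero_mul] at this

variable {S}

namespace Admissible

variable (hS : S.Admissible)
include hS

lemma continuous_f : Continuous S.f := hS.contDiff_f.continuous

lemma continuous_g : Continuous S.g := hS.contDiff_g.continuous

lemma stepSize_pos (k : ℕ) : 0 < S.stepSize k := by
  have := hS.stepMax_pos
  unfold stepSize; positivity

lemma stepSize_le (k : ℕ) : S.stepSize k ≤ S.Δmax := by
  unfold stepSize
  exact mul_le_of_le_one_left hS.stepMax_pos.le (pow_le_one₀ (by norm_num) (by norm_num))

lemma continuous_euler (t : ℝ) : Continuous fun x => S.euler x t :=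
  continuous_id.add (hS.continuous_f.const_smul t)

lemma isClosed_accept (k : ℕ) : IsClosed {x | S.Accept x k} := by
  have := hS.continuous_f
  have := hS.continuous_euler (S.stepSize k)
  exact isClosed_le (by fun_prop) continuous_const

/-- All sufficiently fine levels are accepted, uniformly on bounded sets. -/
lemma exists_accept_of_norm_le (R : ℝ) : ∃ K, ∀ x : Vec m, ‖x‖ ≤ R → ∀ k, K ≤ k → S.Accept x k := by
  obtain ⟨F, hF⟩ := ((isCompact_closedBall (0 : Vec m) R).image
    hS.continuous_f.norm).bddAbove
  have hF' : ∀ x : Vec m, ‖x‖ ≤ R → ‖S.f x‖ ≤ F := fun x hx =>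
    hF ⟨x, by simpa using hx, rfl⟩
  -- The enlarged ball contains all Euler points started in the ball of radius `R`.
  have huc := (isCompact_closedBall (0 : Vec m) (R + S.Δmax * F)).uniformContinuousOn_of_continuous
    hS.continuous_f.continuousOn
  obtain ⟨d, hd, hd'⟩ := Metric.uniformContinuousOn_iff.1 huc S.τ hS.tol_pos
  have ht : Filter.Tendsto (fun k => S.stepSize k * F) Filter.atTop (nhds 0) := by
    simpa using S.tendsto_stepSize.mul_const F
  obtain ⟨K, hK⟩ := Filter.eventually_atTop.1 (ht.eventually (gt_mem_nhds hd))
  refine ⟨K, fun x hx k hk => ?_⟩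
  have h1 : ‖S.stepSize k • S.f x‖ ≤ S.stepSize k * F := by
    rw [norm_smul, Real.norm_of_nonneg (hS.stepSize_pos k).le]
    exact mul_le_mul_of_nonneg_left (hF' x hx) (hS.stepSize_pos k).le
  have hF0 : 0 ≤ F := (norm_nonneg _).trans (hF' x hx)
  have h2 : S.stepSize k * F ≤ S.Δmax * F := mul_le_mul_of_nonneg_right (hS.stepSize_le k) hF0
  have h3 := hd' (S.euler x (S.stepSize k)) (by
      rw [mem_closedBall_zero_iff]
      exact (norm_add_le _ _).trans (by linarith)) x (by
      rw [mem_closedBall_zero_iff]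
      linarith [mul_nonneg hS.stepMax_pos.le hF0]) (by
      rw [dist_eq_norm, euler, add_sub_cancel_left]
      exact h1.trans_lt (hK k hk))
  rw [dist_eq_norm] at h3
  exact h3.le

/-- Fine levels are accepted, so the minimum is over a nonempty set and the default value of `sInf`
never occurs. -/
lemma level_mem (x : Vec m) (l : ℕ) : S.Accept x (S.level x l) ∧ l ≤ S.level x l + 1 := by
  obtain ⟨K, hK⟩ := hS.exists_accept_of_norm_le ‖x‖
  exact Nat.sInf_mem (s := {k : ℕ | S.Accept x k ∧ l ≤ k + 1})
    ⟨max K l, hK x le_rfl _ (le_max_left _ _), (le_max_right K l).trans (Nat.le_succ _)⟩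

lemma measurable_level : Measurable fun z : State m => S.level z.1 z.2 := by
  refine measurable_nat_sInf fun k => ?_
  have h1 : MeasurableSet {z : State m | S.Accept z.1 k} :=
    measurable_fst (hS.isClosed_accept k).measurableSet
  have h2 : MeasurableSet {z : State m | z.2 ≤ k + 1} :=
    measurable_snd (MeasurableSet.of_discrete (s := {l : ℕ | l ≤ k + 1}))
  exact h1.inter h2

lemma measurable_step : Measurable fun p : State m × Vec m => S.step p.1 p.2 := by
  have hl : Measurable fun p : State m × Vec m => S.level p.1.1 p.1.2 :=
    hS.measurable_level.comp measurable_fst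
  have hh : Measurable fun p : State m × Vec m => S.stepSize (S.level p.1.1 p.1.2) :=
    (Measurable.of_discrete (f := S.stepSize)).comp hl
  have hf : Measurable fun p : State m × Vec m => S.f p.1.1 :=
    hS.continuous_f.measurable.comp (by fun_prop)
  have hg : Measurable fun p : State m × Vec m => S.g p.1.1 p.2 := by
    have : Continuous fun p : Vec m × Vec m => S.g p.1 p.2 := by
      have := hS.continuous_g
      fun_prop
    exact this.measurable.comp (by fun_prop : Measurable fun p : State m × Vec m => (p.1.1, p.2))
  refine Measurable.prodMk ?_ hl
  exact ((measurable_fst.comp measurable_fst).add (hh.smul hf)).add (hh.sqrt.smul hg)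

lemma measurable_chain (n : ℕ) :
    Measurable fun p : State m × (ℕ → Vec m) => S.chain p.1 p.2 n := by
  induction n with
  | zero => exact measurable_fst
  | succ n ih =>
    have : Measurable fun p : State m × (ℕ → Vec m) => (S.chain p.1 p.2 n, p.2 n) :=
      ih.prodMk (by fun_prop)
    exact hS.measurable_step.comp this

lemma measurable_time (n : ℕ) :
    Measurable fun p : State m × (ℕ → Vec m) => S.time p.1 p.2 n := by
  induction n with
  | zero => exact measurable_const
  | succ n ih =>
    exact ih.add ((Measurable.of_discrete (f := S.stepSize)).comp
      (measurable_snd.comp (hS.measurable_chain (n + 1))))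

lemma measurable_hitSet (n : ℕ) :
    MeasurableSet {p : State m × ℝ × (ℕ → Vec m) | n ∈ S.hitSet p.1 p.2.1 p.2.2} := by
  have h : Measurable fun p : State m × ℝ × (ℕ → Vec m) => S.time p.1 p.2.2 n :=
    (hS.measurable_time n).comp (by fun_prop : Measurable
      fun p : State m × ℝ × (ℕ → Vec m) => (p.1, p.2.2))
  exact measurableSet_le measurable_const ((by fun_prop : Measurable
      fun p : State m × ℝ × (ℕ → Vec m) => p.2.1).add h)

lemma measurable_chain_index {α : Type*} [MeasurableSpace α] {w : α → State m} {η : α → ℕ → Vec m}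
    {N : α → ℕ} (hw : Measurable w) (hη : Measurable η) (hN : Measurable N) :
    Measurable fun a => S.chain (w a) (η a) (N a) := by
  have h : Measurable fun p : (State m × (ℕ → Vec m)) × ℕ => S.chain p.1.1 p.1.2 p.2 :=
    measurable_from_prod_countable_left fun n => hS.measurable_chain n
  exact h.comp ((hw.prodMk hη).prodMk hN)

lemma measurable_time_index {α : Type*} [MeasurableSpace α] {w : α → State m} {η : α → ℕ → Vec m}
    {N : α → ℕ} (hw : Measurable w) (hη : Measurable η) (hN : Measurable N) :
    Measurable fun a => S.time (w a) (η a) (N a) := by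
  have h : Measurable fun p : (State m × (ℕ → Vec m)) × ℕ => S.time p.1.1 p.1.2 p.2 :=
    measurable_from_prod_countable_left fun n => hS.measurable_time n
  exact h.comp ((hw.prodMk hη).prodMk hN)

lemma measurable_hitIdx :
    Measurable fun p : State m × ℝ × (ℕ → Vec m) => sInf (S.hitSet p.1 p.2.1 p.2.2) :=
  measurable_nat_sInf hS.measurable_hitSet

lemma measurable_sampleIdx (z : State m) (j : ℕ) : Measurable fun η => S.sampleIdx z η j := by
  induction j with
  | zero => exact measurable_const
  | succ j ih =>
    refine measurable_nat_sInf fun k => ?_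
    exact measurableSet_le (measurable_const.add
      (hS.measurable_time_index measurable_const measurable_id ih))
      (hS.measurable_time_index measurable_const measurable_id measurable_const)

lemma measurable_sampled (z : State m) (j : ℕ) : Measurable (S.sampled z j) :=
  hS.measurable_chain_index measurable_const measurable_id
    ((hS.measurable_sampleIdx z j).add measurable_const)

end Admissible

end Scheme

end AdaptiveEM

end

/-! ### One-step analysis until time δ, and the Lyapunov drift -/

noncomputable section

namespace AdaptiveEM

namespace Scheme

open scoped ENNReal
open Filter Topology

variable {m : ℕ} (S : Scheme m)

open Classical in
/-- `φ` at the state one step after the first index in `hitSet`, restricted to the event that this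
index is at most `n`. -/
def stopBy (φ : State m → ℝ≥0∞) (n : ℕ) (w : State m) (s : ℝ) (η : ℕ → Vec m) : ℝ≥0∞ :=
  if ∃ k ≤ n, k ∈ S.hitSet w s η then φ (S.chain w η (sInf (S.hitSet w s η) + 1)) else 0

open Classical in
/-- `φ` at the state one step after the first index in `hitSet`, restricted to the event that
there is such an index. -/
def stopVal (φ : State m → ℝ≥0∞) (w : State m) (s : ℝ) (η : ℕ → Vec m) : ℝ≥0∞ :=
  if (S.hitSet w s η).Nonempty then φ (S.chain w η (sInf (S.hitSet w s η) + 1)) else 0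

/-- The expectation of `stopVal`. -/
def reach (φ : State m → ℝ≥0∞) (w : State m) (s : ℝ) : ℝ≥0∞ :=
  ∫⁻ η, S.stopVal φ w s η ∂(noise m)

/-- The event that the first `n + 1` indices are not in `hitSet`. -/
def alive (n : ℕ) (w : State m) (s : ℝ) : Set (ℕ → Vec m) := {η | ∀ k ≤ n, k ∉ S.hitSet w s η}

variable {S}

lemma sInf_hitSet_of_le {w : State m} {s : ℝ} (hs : S.δ ≤ s) (η : ℕ → Vec m) :
    sInf (S.hitSet w s η) = 0 :=
  Nat.sInf_eq_zero.2 (Or.inl (S.zero_mem_hitSet.2 hs))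

/-- Nonemptiness matters: with `sInf ∅ = 0` on both sides the shift by one would fail. -/
lemma sInf_hitSet_of_lt {w : State m} {s : ℝ} (hs : s < S.δ) {η : ℕ → Vec m}
    (h : (S.hitSet (S.step w (η 0)) (s + S.stepSize (S.step w (η 0)).2)
      fun i => η (i + 1)).Nonempty) :
    sInf (S.hitSet w s η) = sInf (S.hitSet (S.step w (η 0))
      (s + S.stepSize (S.step w (η 0)).2) fun i => η (i + 1)) + 1 := by
  refine le_antisymm (Nat.sInf_le (S.succ_mem_hitSet.2 (Nat.sInf_mem h))) ?_
  have hne : (S.hitSet w s η).Nonempty := ⟨_, S.succ_mem_hitSet.2 (Nat.sInf_mem h)⟩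
  have h1 := Nat.sInf_mem hne
  rcases h2 : sInf (S.hitSet w s η) with _ | k
  · rw [h2, zero_mem_hitSet] at h1
    exact absurd h1 (not_le.2 hs)
  · rw [h2, succ_mem_hitSet] at h1
    exact Nat.succ_le_succ (Nat.sInf_le h1)

lemma exists_mem_hitSet_succ {w : State m} {s : ℝ} (hs : s < S.δ) {η : ℕ → Vec m} {n : ℕ} :
    (∃ k ≤ n + 1, k ∈ S.hitSet w s η) ↔ ∃ k ≤ n, k ∈ S.hitSet (S.step w (η 0))
      (s + S.stepSize (S.step w (η 0)).2) fun i => η (i + 1) := by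
  constructor
  · rintro ⟨k, hk, h⟩
    rcases k with _ | k
    · exact absurd (S.zero_mem_hitSet.1 h) (not_le.2 hs)
    · exact ⟨k, by omega, S.succ_mem_hitSet.1 h⟩
  · rintro ⟨k, hk, h⟩
    exact ⟨k + 1, by omega, S.succ_mem_hitSet.2 h⟩

lemma hitSet_nonempty_succ {w : State m} {s : ℝ} (hs : s < S.δ) {η : ℕ → Vec m} :
    (S.hitSet w s η).Nonempty ↔ (S.hitSet (S.step w (η 0))
      (s + S.stepSize (S.step w (η 0)).2) fun i => η (i + 1)).Nonempty := by
  constructor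
  · rintro ⟨k, h⟩
    rcases k with _ | k
    · exact absurd (S.zero_mem_hitSet.1 h) (not_le.2 hs)
    · exact ⟨k, S.succ_mem_hitSet.1 h⟩
  · rintro ⟨k, h⟩
    exact ⟨k + 1, S.succ_mem_hitSet.2 h⟩

lemma stopBy_of_le {φ : State m → ℝ≥0∞} {n : ℕ} {w : State m} {s : ℝ} (hs : S.δ ≤ s)
    (η : ℕ → Vec m) : S.stopBy φ n w s η = φ (S.step w (η 0)) := by
  rw [stopBy, if_pos ⟨0, n.zero_le, S.zero_mem_hitSet.2 hs⟩,
    sInf_hitSet_of_le hs]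
  rfl

lemma stopVal_of_le {φ : State m → ℝ≥0∞} {w : State m} {s : ℝ} (hs : S.δ ≤ s)
    (η : ℕ → Vec m) : S.stopVal φ w s η = φ (S.step w (η 0)) := by
  rw [stopVal, if_pos ⟨0, S.zero_mem_hitSet.2 hs⟩,
    sInf_hitSet_of_le hs]
  rfl

lemma stopBy_zero_of_lt {φ : State m → ℝ≥0∞} {w : State m} {s : ℝ} (hs : s < S.δ)
    (η : ℕ → Vec m) : S.stopBy φ 0 w s η = 0 := by
  refine if_neg ?_
  rintro ⟨k, hk, h⟩
  obtain rfl : k = 0 := by omega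
  exact not_le.2 hs (S.zero_mem_hitSet.1 h)

lemma stopBy_succ_of_lt {φ : State m → ℝ≥0∞} {n : ℕ} {w : State m} {s : ℝ} (hs : s < S.δ)
    (η : ℕ → Vec m) : S.stopBy φ (n + 1) w s η = S.stopBy φ n (S.step w (η 0))
      (s + S.stepSize (S.step w (η 0)).2) fun i => η (i + 1) := by
  by_cases h : ∃ k ≤ n, k ∈ S.hitSet (S.step w (η 0)) (s + S.stepSize (S.step w (η 0)).2)
      fun i => η (i + 1)
  · obtain ⟨k, -, hk⟩ := id h
    rw [stopBy, if_pos ((exists_mem_hitSet_succ hs).2 h), stopBy,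
      if_pos h, sInf_hitSet_of_lt hs ⟨k, hk⟩, chain_succ']
  · rw [stopBy, if_neg (fun h' => h ((exists_mem_hitSet_succ hs).1 h')), stopBy,
      if_neg h]

lemma stopVal_of_lt {φ : State m → ℝ≥0∞} {w : State m} {s : ℝ} (hs : s < S.δ)
    (η : ℕ → Vec m) : S.stopVal φ w s η = S.stopVal φ (S.step w (η 0))
      (s + S.stepSize (S.step w (η 0)).2) fun i => η (i + 1) := by
  by_cases h : (S.hitSet (S.step w (η 0)) (s + S.stepSize (S.step w (η 0)).2)
      fun i => η (i + 1)).Nonempty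
  · rw [stopVal, if_pos ((hitSet_nonempty_succ hs).2 h), stopVal,
      if_pos h, sInf_hitSet_of_lt hs h, chain_succ']
  · rw [stopVal, if_neg (fun h' => h ((hitSet_nonempty_succ hs).1 h')), stopVal,
      if_neg h]

lemma iSup_stopBy (φ : State m → ℝ≥0∞) (w : State m) (s : ℝ) (η : ℕ → Vec m) :
    ⨆ n, S.stopBy φ n w s η = S.stopVal φ w s η := by
  by_cases h : (S.hitSet w s η).Nonempty
  · rw [stopVal, if_pos h]
    refine le_antisymm (iSup_le fun n => ?_) ?_
    · unfold stopBy
      split_ifs <;> simp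
    · obtain ⟨k, hk⟩ := h
      refine le_trans (le_of_eq ?_) (le_iSup _ k)
      rw [stopBy, if_pos ⟨k, le_rfl, hk⟩]
  · rw [stopVal, if_neg h, ENNReal.iSup_eq_zero]
    exact fun n => if_neg fun ⟨k, _, hk⟩ => h ⟨k, hk⟩

lemma stopBy_mono (φ : State m → ℝ≥0∞) (w : State m) (s : ℝ) :
    Monotone fun n => S.stopBy φ n w s := by
  intro n k hnk η
  by_cases h : ∃ j ≤ n, j ∈ S.hitSet w s η
  · obtain ⟨j, hj, hm⟩ := id h
    simp only [stopBy, if_pos h, if_pos (⟨j, hj.trans hnk, hm⟩ : ∃ j ≤ k, j ∈ S.hitSet w s η)]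
    exact le_rfl
  · simp only [stopBy, if_neg h, zero_le]

lemma alive_of_le {n : ℕ} {w : State m} {s : ℝ} (hs : S.δ ≤ s) : S.alive n w s = ∅ :=
  Set.eq_empty_of_forall_notMem fun _ h => h 0 n.zero_le (S.zero_mem_hitSet.2 hs)

lemma mem_alive_succ_of_lt {n : ℕ} {w : State m} {s : ℝ} (hs : s < S.δ) {η : ℕ → Vec m} :
    η ∈ S.alive (n + 1) w s ↔ (fun i => η (i + 1)) ∈ S.alive n (S.step w (η 0))
      (s + S.stepSize (S.step w (η 0)).2) := by
  have := not_congr (exists_mem_hitSet_succ (w := w) (n := n) (η := η) hs)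
  push Not at this
  exact this

lemma lintegral_noise_zero {F : Vec m → ℝ≥0∞} (hF : Measurable F) :
    ∫⁻ η, F (η 0) ∂(noise m) = ∫⁻ e, F e ∂(stdGaussian (Vec m)) := by
  rw [lintegral_noise_cons (F := fun e _ => F e) (hF.comp measurable_fst)]
  simp

namespace Admissible

variable (hS : S.Admissible)
include hS

lemma measurableSet_nonempty_hitSet :
    MeasurableSet {p : State m × ℝ × (ℕ → Vec m) | (S.hitSet p.1 p.2.1 p.2.2).Nonempty} := by
  have : {p : State m × ℝ × (ℕ → Vec m) | (S.hitSet p.1 p.2.1 p.2.2).Nonempty} =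
      ⋃ n, {p : State m × ℝ × (ℕ → Vec m) | n ∈ S.hitSet p.1 p.2.1 p.2.2} := by
    ext p; simp [Set.Nonempty]
  rw [this]
  exact MeasurableSet.iUnion hS.measurable_hitSet

lemma measurableSet_alive (n : ℕ) :
    MeasurableSet {p : State m × ℝ × (ℕ → Vec m) | p.2.2 ∈ S.alive n p.1 p.2.1} := by
  have : {p : State m × ℝ × (ℕ → Vec m) | p.2.2 ∈ S.alive n p.1 p.2.1} =
      ⋂ k, ⋂ _ : k ≤ n, {p : State m × ℝ × (ℕ → Vec m) | k ∈ S.hitSet p.1 p.2.1 p.2.2}ᶜ := by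
    ext p; simp [alive]
  rw [this]
  exact MeasurableSet.iInter fun k => MeasurableSet.iInter fun _ => (hS.measurable_hitSet k).compl

lemma measurable_chain_hitIdx :
    Measurable fun p : State m × ℝ × (ℕ → Vec m) =>
      S.chain p.1 p.2.2 (sInf (S.hitSet p.1 p.2.1 p.2.2) + 1) :=
  hS.measurable_chain_index measurable_fst (by fun_prop)
    (hS.measurable_hitIdx.add measurable_const)

lemma measurable_stopVal {φ : State m → ℝ≥0∞} (hφ : Measurable φ) :
    Measurable fun p : State m × ℝ × (ℕ → Vec m) => S.stopVal φ p.1 p.2.1 p.2.2 :=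
  Measurable.ite hS.measurableSet_nonempty_hitSet (hφ.comp hS.measurable_chain_hitIdx)
    measurable_const

lemma measurable_stopBy {φ : State m → ℝ≥0∞} (hφ : Measurable φ) (n : ℕ) :
    Measurable fun p : State m × ℝ × (ℕ → Vec m) => S.stopBy φ n p.1 p.2.1 p.2.2 := by
  refine Measurable.ite ?_ (hφ.comp hS.measurable_chain_hitIdx) measurable_const
  have : {p : State m × ℝ × (ℕ → Vec m) | ∃ k ≤ n, k ∈ S.hitSet p.1 p.2.1 p.2.2} =
      {p : State m × ℝ × (ℕ → Vec m) | p.2.2 ∈ S.alive n p.1 p.2.1}ᶜ := by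
    ext p; simp [alive]
  rw [this]
  exact (hS.measurableSet_alive n).compl

lemma measurable_next (w : State m) (s : ℝ) :
    Measurable fun p : Vec m × (ℕ → Vec m) =>
      (S.step w p.1, s + S.stepSize (S.step w p.1).2, p.2) := by
  have h : Measurable fun p : Vec m × (ℕ → Vec m) => S.step w p.1 :=
    hS.measurable_step.comp (measurable_const.prodMk measurable_fst)
  exact h.prodMk ((measurable_const.add
    ((Measurable.of_discrete (f := S.stepSize)).comp h.snd)).prodMk measurable_snd)

lemma measurable_step_right (w : State m) : Measurable (S.step w) :=
  hS.measurable_step.comp (measurable_const.prodMk measurable_id)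

lemma lintegral_stopBy_of_le {φ : State m → ℝ≥0∞} (hφ : Measurable φ) {n : ℕ} {w : State m}
    {s : ℝ} (hs : S.δ ≤ s) : ∫⁻ η, S.stopBy φ n w s η ∂(noise m)
      = ∫⁻ e, φ (S.step w e) ∂(stdGaussian (Vec m)) := by
  simp only [stopBy_of_le hs]
  exact lintegral_noise_zero (hφ.comp (hS.measurable_step_right w))

lemma lintegral_stopBy_succ_of_lt {φ : State m → ℝ≥0∞} (hφ : Measurable φ) {n : ℕ} {w : State m}
    {s : ℝ} (hs : s < S.δ) : ∫⁻ η, S.stopBy φ (n + 1) w s η ∂(noise m)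
      = ∫⁻ e, ∫⁻ ξ, S.stopBy φ n (S.step w e) (s + S.stepSize (S.step w e).2) ξ ∂(noise m)
          ∂(stdGaussian (Vec m)) := by
  simp only [stopBy_succ_of_lt hs]
  exact lintegral_noise_cons
    (F := fun e ξ => S.stopBy φ n (S.step w e) (s + S.stepSize (S.step w e).2) ξ)
    ((hS.measurable_stopBy hφ n).comp (hS.measurable_next w s))

lemma reach_of_le {φ : State m → ℝ≥0∞} (hφ : Measurable φ) {w : State m} {s : ℝ}
    (hs : S.δ ≤ s) : S.reach φ w s = ∫⁻ e, φ (S.step w e) ∂(stdGaussian (Vec m)) := by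
  simp only [reach, stopVal_of_le hs]
  exact lintegral_noise_zero (hφ.comp (hS.measurable_step_right w))

lemma reach_of_lt {φ : State m → ℝ≥0∞} (hφ : Measurable φ) {w : State m} {s : ℝ} (hs : s < S.δ) :
    S.reach φ w s = ∫⁻ e, S.reach φ (S.step w e) (s + S.stepSize (S.step w e).2)
      ∂(stdGaussian (Vec m)) := by
  simp only [reach]
  simp only [stopVal_of_lt hs]
  exact lintegral_noise_cons
    (F := fun e ξ => S.stopVal φ (S.step w e) (s + S.stepSize (S.step w e).2) ξ)
    ((hS.measurable_stopVal hφ).comp (hS.measurable_next w s))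

/-- Bounds on `stopBy` are proved by induction on the horizon `n`; monotone convergence carries them
over to `reach`. -/
lemma reach_eq_iSup {φ : State m → ℝ≥0∞} (hφ : Measurable φ) (w : State m) (s : ℝ) :
    S.reach φ w s = ⨆ n, ∫⁻ η, S.stopBy φ n w s η ∂(noise m) := by
  rw [← lintegral_iSup (f := fun n η => S.stopBy φ n w s η) (fun n => (hS.measurable_stopBy hφ n).comp
    (measurable_const.prodMk (measurable_const.prodMk measurable_id))) (stopBy_mono φ w s)]
  simp only [reach, iSup_stopBy]

/-- A dissipativity estimate for the deterministic part of an accepted step. -/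
lemma exists_norm_euler_sq_le : ∃ γ a : ℝ, 0 < γ ∧ 0 ≤ a ∧ ∀ (x : Vec m) (k : ℕ), S.Accept x k →
    (1 + 2 * γ * S.stepSize k) * ‖S.euler x (S.stepSize k)‖ ^ 2
      ≤ ‖x‖ ^ 2 + a * S.stepSize k := by
  obtain ⟨α, β, hα, hβ, hτβ, hdis⟩ := hS.dissipative
  have hτ := hS.tol_pos
  -- Half of `τ` is lost in `τ‖y‖ ≤ (τ / 2)(1 + ‖y‖²)`; the rest of `β` is positive as `τ < 2β`.
  refine ⟨β - S.τ / 2, 2 * α + S.τ, by linarith, by positivity, fun x k hk => ?_⟩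
  set h := S.stepSize k with hh
  have h0 : 0 < h := hS.stepSize_pos k
  set y := S.euler x h with hy
  -- Expanding `‖x‖²` around the endpoint `y` leaves `h²‖f x‖²` with the favourable sign, so it can
  -- be dropped.
  have hx : x = y - h • S.f x := by simp [hy, euler]
  have h1 : inner ℝ (S.f x) y ≤ α - β * ‖y‖ ^ 2 + S.τ * ‖y‖ := by
    have e : S.f x = S.f y - (S.f y - S.f x) := by abel
    rw [e, inner_sub_left]
    have h2 := abs_le.1 (abs_real_inner_le_norm (S.f y - S.f x) y)
    have h3 : ‖S.f y - S.f x‖ * ‖y‖ ≤ S.τ * ‖y‖ := mul_le_mul_of_nonneg_right hk (norm_nonneg _)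
    linarith [hdis y, h2.1]
  have h4 : ‖x‖ ^ 2 = ‖y‖ ^ 2 - 2 * h * inner ℝ (S.f x) y + h ^ 2 * ‖S.f x‖ ^ 2 := by
    conv_lhs => rw [hx]
    rw [norm_sub_sq_real, inner_smul_right, norm_smul, Real.norm_of_nonneg h0.le,
      real_inner_comm (S.f x) y]
    ring
  have h5 : S.τ * ‖y‖ ≤ S.τ / 2 * (1 + ‖y‖ ^ 2) := by nlinarith [sq_nonneg (‖y‖ - 1)]
  have h6 : 0 ≤ h ^ 2 * ‖S.f x‖ ^ 2 := by positivity
  have h7 : h * inner ℝ (S.f x) y ≤ h * (α - β * ‖y‖ ^ 2 + S.τ / 2 * (1 + ‖y‖ ^ 2)) :=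
    mul_le_mul_of_nonneg_left (by linarith) h0.le
  nlinarith

lemma exists_norm_g_le : ∃ c : ℝ, 0 ≤ c ∧ ∀ x : Vec m, ‖S.g x‖ ≤ c := by
  obtain ⟨c, hc⟩ := hS.bounded_g
  exact ⟨c, (norm_nonneg _).trans (hc 0), hc⟩

/-- The noise has mean zero and variance proportional to the step, so it only enlarges the additive
constant. `A` and `B` leave room for time-dependent weights. -/
lemma exists_lintegral_step_le : ∃ γ c : ℝ, 0 < γ ∧ 0 ≤ c ∧ ∀ (w : State m) (A B : ℝ), 0 ≤ A →
    0 ≤ B → ∫⁻ e, ENNReal.ofReal (A * ‖(S.step w e).1‖ ^ 2 + B) ∂(stdGaussian (Vec m)) ≤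
      ENNReal.ofReal (A * ((‖w.1‖ ^ 2 + c * S.stepSize (S.level w.1 w.2))
        / (1 + 2 * γ * S.stepSize (S.level w.1 w.2))) + B) := by
  obtain ⟨γ, a, hγ, ha, hle⟩ := hS.exists_norm_euler_sq_le
  obtain ⟨σ, hσ, hg⟩ := hS.exists_norm_g_le
  set M : ℝ := ∫ e, ‖e‖ ^ 2 ∂(stdGaussian (Vec m)) with hM
  have hM0 : 0 ≤ M := integral_nonneg fun e => by positivity
  have hD := hS.stepMax_pos
  refine ⟨γ, a + (1 + 2 * γ * S.Δmax) * (σ ^ 2 * M), hγ, by positivity, fun w A B hA hB => ?_⟩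
  set k := S.level w.1 w.2
  set h := S.stepSize k
  have h0 : 0 < h := hS.stepSize_pos k
  have hhD : h ≤ S.Δmax := hS.stepSize_le k
  set y := S.euler w.1 h
  have h1 := lintegral_norm_add_apply_sq_stdGaussian_le y (√h • S.g w.1)
  have hL : ‖√h • S.g w.1‖ ^ 2 ≤ h * σ ^ 2 := by
    rw [norm_smul, mul_pow, Real.norm_of_nonneg (Real.sqrt_nonneg _), Real.sq_sqrt h0.le]
    gcongr
    exact hg _
  have h2 : ∫⁻ e, ENNReal.ofReal (‖(S.step w e).1‖ ^ 2) ∂(stdGaussian (Vec m))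
      ≤ ENNReal.ofReal ((‖w.1‖ ^ 2 + (a + (1 + 2 * γ * S.Δmax) * (σ ^ 2 * M)) * h)
        / (1 + 2 * γ * h)) := by
    refine h1.trans (ENNReal.ofReal_le_ofReal ?_)
    rw [le_div_iff₀ (by positivity)]
    have h3 := hle w.1 k (hS.level_mem w.1 w.2).1
    have h4 : ‖√h • S.g w.1‖ ^ 2 * M ≤ h * σ ^ 2 * M := mul_le_mul_of_nonneg_right hL hM0
    have h5 : (1 + 2 * γ * h) * (‖√h • S.g w.1‖ ^ 2 * M)
        ≤ (1 + 2 * γ * S.Δmax) * (h * σ ^ 2 * M) := by gcongr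
    nlinarith
  have h6 : ∀ e, ENNReal.ofReal (A * ‖(S.step w e).1‖ ^ 2 + B)
      = ENNReal.ofReal A * ENNReal.ofReal (‖(S.step w e).1‖ ^ 2) + ENNReal.ofReal B := by
    intro e
    rw [ENNReal.ofReal_add (by positivity) hB, ENNReal.ofReal_mul hA]
  simp only [h6]
  have hm : Measurable fun e => ENNReal.ofReal (‖(S.step w e).1‖ ^ 2) :=
    ((hS.measurable_step_right w).fst.norm.pow_const 2).ennreal_ofReal
  rw [lintegral_add_right _ measurable_const, lintegral_const_mul _ hm, lintegral_const,
    measure_univ, mul_one, ENNReal.ofReal_add (by positivity) hB, ENNReal.ofReal_mul hA]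
  gcongr

/-- A function of the state and of the elapsed time that decreases in mean until the elapsed time
reaches `δ`. -/
lemma exists_superharmonic : ∃ γ c : ℝ, 0 < γ ∧ 0 ≤ c ∧
    (∀ (w : State m) (s : ℝ), 0 ≤ s → s < S.δ →
      ∫⁻ e, ENNReal.ofReal ((1 + 2 * γ * (s + S.stepSize (S.step w e).2)) * ‖(S.step w e).1‖ ^ 2
        + c * (S.δ + 2 * S.Δmax - (s + S.stepSize (S.step w e).2))) ∂(stdGaussian (Vec m))
      ≤ ENNReal.ofReal ((1 + 2 * γ * s) * ‖w.1‖ ^ 2 + c * (S.δ + 2 * S.Δmax - s))) ∧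
    (∀ (w : State m) (s : ℝ), 0 ≤ S.δ → S.δ ≤ s → s ≤ S.δ + S.Δmax →
      ∫⁻ e, ENNReal.ofReal ((1 + 2 * γ * S.δ) * ‖(S.step w e).1‖ ^ 2) ∂(stdGaussian (Vec m))
      ≤ ENNReal.ofReal ((1 + 2 * γ * s) * ‖w.1‖ ^ 2 + c * (S.δ + 2 * S.Δmax - s))) := by
  obtain ⟨γ, c, hγ, hc, hle⟩ := hS.exists_lintegral_step_le
  have hD := hS.stepMax_pos
  -- The term linear in `s` pays for the additive constant of each step, whose weight before time
  -- `δ` is at most `1 + 2 * γ * δ`. The reserve `2 * Δmax` covers the overshoot of `δ` and the one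
  -- step made after it.
  refine ⟨γ, (1 + 2 * γ * |S.δ|) * c, hγ, by positivity, fun w s hs hsδ => ?_,
    fun w s hδ hsδ hsD => ?_⟩
  · have hδ : 0 < S.δ := hs.trans_lt hsδ
    rw [abs_of_pos hδ]
    set h := S.stepSize (S.level w.1 w.2) with hh
    have h0 : 0 < h := hS.stepSize_pos _
    have hhD : h ≤ S.Δmax := hS.stepSize_le _
    have hB : 0 ≤ (1 + 2 * γ * S.δ) * c * (S.δ + 2 * S.Δmax - (s + h)) :=
      mul_nonneg (by positivity) (by linarith)
    refine (hle w (1 + 2 * γ * (s + h)) _ (by positivity) hB).trans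
      (ENNReal.ofReal_le_ofReal ?_)
    rw [← hh]
    have h1 : (1 + 2 * γ * (s + h)) * ((‖w.1‖ ^ 2 + c * h) / (1 + 2 * γ * h))
        ≤ (1 + 2 * γ * s) * (‖w.1‖ ^ 2 + c * h) := by
      rw [mul_div_assoc', div_le_iff₀ (by positivity)]
      -- The linear weight is submultiplicative, so a step of size `h` contracts at least as much as
      -- the weight grows.
      have h2 : 1 + 2 * γ * (s + h) ≤ (1 + 2 * γ * s) * (1 + 2 * γ * h) := by
        nlinarith [mul_nonneg (mul_nonneg hγ.le hs) (mul_nonneg hγ.le h0.le)]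
      have h3 : 0 ≤ ‖w.1‖ ^ 2 + c * h := by positivity
      nlinarith
    have h4 : (1 + 2 * γ * s) * (c * h) ≤ (1 + 2 * γ * S.δ) * c * h := by
      rw [← mul_assoc]; gcongr
    nlinarith
  · rw [abs_of_nonneg hδ]
    have hs : 0 ≤ s := hδ.trans hsδ
    set h := S.stepSize (S.level w.1 w.2) with hh
    have h0 : 0 < h := hS.stepSize_pos _
    have hhD : h ≤ S.Δmax := hS.stepSize_le _
    have h1 := hle w (1 + 2 * γ * S.δ) 0 (by positivity) le_rfl
    simp only [add_zero] at h1
    refine h1.trans (ENNReal.ofReal_le_ofReal ?_)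
    rw [← hh]
    have h2 : (‖w.1‖ ^ 2 + c * h) / (1 + 2 * γ * h) ≤ ‖w.1‖ ^ 2 + c * S.Δmax := by
      refine (div_le_self (by positivity) ?_).trans (by gcongr)
      have := mul_pos hγ h0
      linarith
    calc (1 + 2 * γ * S.δ) * ((‖w.1‖ ^ 2 + c * h) / (1 + 2 * γ * h))
        ≤ (1 + 2 * γ * S.δ) * (‖w.1‖ ^ 2 + c * S.Δmax) := by gcongr
      _ = (1 + 2 * γ * S.δ) * ‖w.1‖ ^ 2 + (1 + 2 * γ * S.δ) * c * S.Δmax := by ring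
      _ ≤ _ := by
        gcongr
        linarith

/-- The sampled chain contracts `‖y‖ ^ 2` in mean, up to a constant. -/
lemma exists_drift (hδ : S.Δmax < S.δ) : ∃ a b : ℝ, 0 ≤ a ∧ a < 1 ∧ 0 ≤ b ∧ ∀ w : State m,
    S.reach (fun y => ENNReal.ofReal (‖y.1‖ ^ 2)) w (S.stepSize w.2)
      ≤ ENNReal.ofReal (a * ‖w.1‖ ^ 2 + b) := by
  obtain ⟨γ, c, hγ, hc, hstep, hend⟩ := hS.exists_superharmonic
  have hD := hS.stepMax_pos
  have hδ0 : 0 < S.δ := hD.trans hδ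
  have hφ : Measurable fun y : State m => ENNReal.ofReal ((1 + 2 * γ * S.δ) * ‖y.1‖ ^ 2) := by
    fun_prop
  have key : ∀ (n : ℕ) (w : State m) (s : ℝ), 0 ≤ s → s ≤ S.δ + S.Δmax →
      ∫⁻ η, S.stopBy (fun y => ENNReal.ofReal ((1 + 2 * γ * S.δ) * ‖y.1‖ ^ 2)) n w s η ∂(noise m)
        ≤ ENNReal.ofReal ((1 + 2 * γ * s) * ‖w.1‖ ^ 2 + c * (S.δ + 2 * S.Δmax - s)) := by
    intro n
    induction n with
    | zero =>
      intro w s hs hsD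
      rcases le_or_gt S.δ s with h | h
      · rw [hS.lintegral_stopBy_of_le hφ h]
        exact hend w s hδ0.le h hsD
      · simp [stopBy_zero_of_lt h]
    | succ n ih =>
      intro w s hs hsD
      rcases le_or_gt S.δ s with h | h
      · rw [hS.lintegral_stopBy_of_le hφ h]
        exact hend w s hδ0.le h hsD
      · rw [hS.lintegral_stopBy_succ_of_lt hφ h]
        refine (lintegral_mono fun e => ?_).trans (hstep w s hs h)
        refine ih _ _ ?_ ?_
        · have := (hS.stepSize_pos (S.step w e).2).le
          linarith
        · have := hS.stepSize_le (S.step w e).2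
          linarith
  have hω : 0 < 1 + 2 * γ * S.δ := by positivity
  -- Ratio of the largest initial weight to the final one: the first step, already made, has used up
  -- at most `Δmax` of the time.
  refine ⟨(1 + 2 * γ * S.Δmax) / (1 + 2 * γ * S.δ), c * (S.δ + 2 * S.Δmax) / (1 + 2 * γ * S.δ),
    by positivity, ?_, by positivity, fun w => ?_⟩
  · rw [div_lt_one hω]
    have := mul_lt_mul_of_pos_left hδ hγ
    linarith
  · have h1 : S.reach (fun y => ENNReal.ofReal ((1 + 2 * γ * S.δ) * ‖y.1‖ ^ 2)) w
        (S.stepSize w.2) ≤ ENNReal.ofReal ((1 + 2 * γ * S.Δmax) * ‖w.1‖ ^ 2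
          + c * (S.δ + 2 * S.Δmax)) := by
      rw [hS.reach_eq_iSup hφ]
      refine iSup_le fun n => (key n w _ (hS.stepSize_pos _).le ?_).trans ?_
      · linarith [hS.stepSize_le w.2]
      · have := hS.stepSize_le w.2
        have h2 := (hS.stepSize_pos w.2).le
        refine ENNReal.ofReal_le_ofReal ?_
        gcongr
        linarith
    have h2 : S.reach (fun y => ENNReal.ofReal ((1 + 2 * γ * S.δ) * ‖y.1‖ ^ 2)) w
        (S.stepSize w.2) = ENNReal.ofReal (1 + 2 * γ * S.δ)
          * S.reach (fun y => ENNReal.ofReal (‖y.1‖ ^ 2)) w (S.stepSize w.2) := by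
      have hφ' : Measurable fun y : State m => ENNReal.ofReal (‖y.1‖ ^ 2) := by fun_prop
      have hm : Measurable fun η =>
          S.stopVal (fun y => ENNReal.ofReal (‖y.1‖ ^ 2)) w (S.stepSize w.2) η :=
        (hS.measurable_stopVal hφ').comp ((measurable_const (a := w)).prodMk
        ((measurable_const (a := S.stepSize w.2)).prodMk (measurable_id (α := ℕ → Vec m))))
      unfold reach
      rw [← lintegral_const_mul _ hm]
      refine lintegral_congr fun η => ?_
      simp only [stopVal, ENNReal.ofReal_mul hω.le]
      split_ifs <;> simp
    rw [h2] at h1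
    have h3 : ENNReal.ofReal (1 + 2 * γ * S.δ) ≠ 0 := by simpa using hω
    rw [mul_comm, ← ENNReal.le_div_iff_mul_le (Or.inl h3) (Or.inl ENNReal.ofReal_ne_top),
      ← ENNReal.ofReal_div_of_pos hω] at h1
    refine h1.trans (le_of_eq ?_)
    congr 1
    field_simp

/-- The same supermartingale on the event that `δ` has not been reached. Uniformity in `n` is the
point: mass that never reaches `δ` cannot escape to infinity. -/
lemma exists_lintegral_alive_le : ∃ C : State m → ℝ → ℝ,
    ∀ (n : ℕ) (w : State m) (s : ℝ), 0 ≤ s → s ≤ S.δ + S.Δmax →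
      ∫⁻ η, (S.alive n w s).indicator (fun η => ENNReal.ofReal (‖(S.chain w η n).1‖ ^ 2)) η
        ∂(noise m) ≤ ENNReal.ofReal (C w s) := by
  obtain ⟨γ, c, hγ, hc, hstep, -⟩ := hS.exists_superharmonic
  have hD := hS.stepMax_pos
  refine ⟨fun w s => (1 + 2 * γ * s) * ‖w.1‖ ^ 2 + c * (S.δ + 2 * S.Δmax - s), fun n => ?_⟩
  induction n with
  | zero =>
    intro w s hs hsD
    calc _ ≤ ∫⁻ η, ENNReal.ofReal (‖w.1‖ ^ 2) ∂(noise m) :=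
          lintegral_mono fun η => Set.indicator_le_self' (fun _ _ => zero_le) η
      _ ≤ _ := by
        simp only [lintegral_const, measure_univ, mul_one]
        refine ENNReal.ofReal_le_ofReal ?_
        have h1 : 0 ≤ c * (S.δ + 2 * S.Δmax - s) := mul_nonneg hc (by linarith)
        have h2 : 0 ≤ 2 * γ * s * ‖w.1‖ ^ 2 := by positivity
        linarith
  | succ n ih =>
    intro w s hs hsD
    rcases le_or_gt S.δ s with h | h
    · simp [alive_of_le h]
    · have hm : Measurable fun p : State m × ℝ × (ℕ → Vec m) =>
          (S.alive n p.1 p.2.1).indicator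
            (fun η => ENNReal.ofReal (‖(S.chain p.1 η n).1‖ ^ 2)) p.2.2 := by
        have h1 : Measurable fun p : State m × ℝ × (ℕ → Vec m) =>
            ENNReal.ofReal (‖(S.chain p.1 p.2.2 n).1‖ ^ 2) :=
          ((hS.measurable_chain_index measurable_fst (by fun_prop)
            measurable_const).fst.norm.pow_const 2).ennreal_ofReal
        exact h1.indicator (hS.measurableSet_alive n)
      have e : ∀ η : ℕ → Vec m, (S.alive (n + 1) w s).indicator
            (fun η => ENNReal.ofReal (‖(S.chain w η (n + 1)).1‖ ^ 2)) η
          = (S.alive n (S.step w (η 0)) (s + S.stepSize (S.step w (η 0)).2)).indicator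
            (fun ξ => ENNReal.ofReal (‖(S.chain (S.step w (η 0)) ξ n).1‖ ^ 2))
              fun i => η (i + 1) := by
        intro η
        by_cases hη : η ∈ S.alive (n + 1) w s
        · rw [Set.indicator_of_mem hη, Set.indicator_of_mem ((mem_alive_succ_of_lt h).1 hη),
            chain_succ']
        · rw [Set.indicator_of_notMem hη,
            Set.indicator_of_notMem fun h' => hη ((mem_alive_succ_of_lt h).2 h')]
      simp only [e]
      rw [lintegral_noise_cons (F := fun e ξ =>
        (S.alive n (S.step w e) (s + S.stepSize (S.step w e).2)).indicator
          (fun ξ => ENNReal.ofReal (‖(S.chain (S.step w e) ξ n).1‖ ^ 2)) ξ)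
        (hm.comp (hS.measurable_next w s))]
      refine (lintegral_mono fun e => ?_).trans (hstep w s hs h)
      refine ih _ _ ?_ ?_
      · have := (hS.stepSize_pos (S.step w e).2).le
        linarith
      · have := hS.stepSize_le (S.step w e).2
        linarith

end Admissible

end Scheme

end AdaptiveEM

end

/-! ### Minorization, uniformly over all levels -/

noncomputable section

namespace AdaptiveEM

namespace Scheme

open scoped ENNReal
open Filter Topology Metric

variable {m : ℕ} {S : Scheme m}

/-- The level is allowed to drop by one and does so if the coarser step is accepted; truncated
subtraction makes level 0 stay at 0. -/
lemma level_eq_of_accept {x : Vec m} {l : ℕ} (h : S.Accept x (l - 1)) : S.level x l = l - 1 := by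
  refine le_antisymm (Nat.sInf_le ⟨h, by omega⟩) ?_
  refine le_csInf ⟨l - 1, h, by omega⟩ ?_
  rintro k ⟨-, hk⟩
  omega

lemma level_le_of_accept {x : Vec m} {l k : ℕ} (h : S.Accept x k) (hlk : l ≤ k + 1) :
    S.level x l ≤ k := Nat.sInf_le ⟨h, hlk⟩

lemma reach_mono {φ : State m → ℝ≥0∞} (hφ : ∀ z, φ z = 1) {w : State m} {s t : ℝ} (hst : s ≤ t) :
    S.reach φ w s ≤ S.reach φ w t := by
  refine lintegral_mono fun η => ?_
  by_cases h : (S.hitSet w s η).Nonempty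
  · have h' : (S.hitSet w t η).Nonempty := by
      obtain ⟨n, hn⟩ := h
      have hn' : S.δ ≤ s + S.time w η n := hn
      exact ⟨n, show S.δ ≤ t + S.time w η n by linarith⟩
    simp only [stopVal, if_pos h, if_pos h', hφ, le_refl]
  · simp only [stopVal, if_neg h, zero_le]

namespace Admissible

variable (hS : S.Admissible)
include hS

/-- The drift vanishes somewhere, and all levels are accepted near that point. -/
lemma exists_ball_accept : ∃ (x₀ : Vec m) (r : ℝ), 0 < r ∧ ∀ x ∈ ball x₀ r, ∀ k, S.Accept x k := by
  obtain ⟨α, β, hα, hβ, -, hdis⟩ := hS.dissipative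
  have hτ := hS.tol_pos
  have hD := hS.stepMax_pos
  -- With this radius the inner product on the sphere is at most `α - 2α < 0`.
  obtain ⟨x₀, hx₀⟩ := exists_eq_zero_of_inner_neg (hS.contDiff_f.of_le (by norm_num))
    (ρ := √(2 * α / β)) (by positivity) fun x hx => by
      have h1 := hdis x
      rw [mem_sphere_zero_iff_norm.1 hx, Real.sq_sqrt (by positivity)] at h1
      have : β * (2 * α / β) = 2 * α := by field_simp
      linarith
  have hf := hS.continuous_f
  obtain ⟨r₁, hr₁, h₁⟩ := Metric.continuous_iff.1 hf x₀ (S.τ / 2) (by positivity)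
  have hc : Continuous fun x => ‖x - x₀‖ + S.Δmax * ‖S.f x‖ := by fun_prop
  obtain ⟨r₂, hr₂, h₂⟩ := Metric.continuous_iff.1 hc x₀ r₁ hr₁
  refine ⟨x₀, r₂, hr₂, fun x hx k => ?_⟩
  have h3 := h₂ x hx
  simp only [sub_self, norm_zero, hx₀, mul_zero, add_zero, Real.dist_eq, sub_zero] at h3
  have h4 := (abs_lt.1 h3).2
  -- `f` is below `τ / 2` in norm both at `x` and at all its Euler points, so the error control
  -- holds at every level.
  have h5 : ∀ t : ℝ, 0 ≤ t → t ≤ S.Δmax → ‖S.f (S.euler x t)‖ < S.τ / 2 := by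
    intro t ht htD
    have h6 := h₁ (S.euler x t) (by
      rw [dist_eq_norm, euler, add_sub_right_comm]
      refine (norm_add_le _ _).trans_lt (lt_of_le_of_lt ?_ h4)
      rw [norm_smul, Real.norm_of_nonneg ht]
      gcongr)
    rwa [hx₀, dist_zero_right] at h6
  have h7 := h5 _ (hS.stepSize_pos k).le (hS.stepSize_le k)
  have h8 := h5 0 le_rfl hD.le
  simp only [euler, zero_smul, add_zero] at h8
  exact (norm_sub_le _ _).trans (by linarith)

/-- At a fixed level the Euler point, the inverse and the determinant of the noise matrix are
continuous in the position, hence bounded on the ball. -/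
lemma exists_mul_volume_le_step_aux (R : ℝ) (k : ℕ) : ∃ c : ℝ≥0∞, c ≠ 0 ∧ ∀ w : State m,
    ‖w.1‖ ≤ R → S.level w.1 w.2 = k → ∀ A : Set (Vec m), MeasurableSet A → A ⊆ closedBall 0 R →
      c * volume A ≤ stdGaussian (Vec m) {e | (S.step w e).1 ∈ A} := by
  have hcg := hS.continuous_g
  have hh := hS.stepSize_pos k
  let L : Vec m → Vec m →L[ℝ] Vec m := fun x => √(S.stepSize k) • S.g x
  have hL : Continuous L := by fun_prop
  have hLi : ∀ x, (L x).IsInvertible := by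
    intro x
    obtain ⟨e, he⟩ := hS.invertible_g x
    have hne : √(S.stepSize k) ≠ 0 := (Real.sqrt_pos.2 hh).ne'
    refine ⟨(ContinuousLinearEquiv.smulLeft (Units.mk0 _ hne)).trans e, ?_⟩
    ext v
    simp [L, ← he]
  have hK := isCompact_closedBall (0 : Vec m) R
  obtain ⟨E, hE⟩ := (hK.image (hS.continuous_euler (S.stepSize k)).norm).bddAbove
  obtain ⟨B, hB⟩ := (hK.image_of_continuousOn (f := fun x => ‖(L x).inverse‖) (fun x _ =>
    ((((hLi x).contDiffAt_map_inverse (𝕜 := ℝ) (n := 0)).continuousAt.comp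
      hL.continuousAt).norm).continuousWithinAt)).bddAbove
  obtain ⟨d, hd⟩ := (hK.image (f := fun x => |(L x).det|)
    (ContinuousLinearMap.continuous_det.comp hL).abs).bddAbove
  obtain ⟨c, hc0, -, hc⟩ := exists_mul_volume_le_stdGaussian_affine (m := m) (max R E) B d
  refine ⟨c, hc0, fun w hw hk A hA hsub => ?_⟩
  have hmem : w.1 ∈ closedBall (0 : Vec m) R := by simpa using hw
  have h1 := hc (S.euler w.1 (S.stepSize k)) (L w.1)
    ((hE ⟨_, hmem, rfl⟩).trans (le_max_right _ _)) (hLi _) (hB ⟨_, hmem, rfl⟩)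
    (hd ⟨_, hmem, rfl⟩) A hA (hsub.trans (closedBall_subset_closedBall (le_max_left _ _)))
  have h2 : ∀ e, (S.step w e).1 = S.euler w.1 (S.stepSize k) + L w.1 e := by
    intro e; simp [step, hk, L]
  simpa only [h2] using h1

lemma exists_mul_volume_le_step (R : ℝ) (K : ℕ) : ∃ c : ℝ≥0∞, c ≠ 0 ∧ ∀ w : State m,
    ‖w.1‖ ≤ R → S.level w.1 w.2 ≤ K → ∀ A : Set (Vec m), MeasurableSet A → A ⊆ closedBall 0 R →
      c * volume A ≤ stdGaussian (Vec m) {e | (S.step w e).1 ∈ A} := by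
  choose c hc0 hc using hS.exists_mul_volume_le_step_aux R
  have hne : (Finset.range (K + 1)).Nonempty := ⟨0, by simp⟩
  refine ⟨(Finset.range (K + 1)).inf' hne c, ?_, fun w hw hk A hA hsub => ?_⟩
  · rw [← pos_iff_ne_zero, Finset.lt_inf'_iff]
    exact fun k _ => pos_iff_ne_zero.2 (hc0 k)
  · refine le_trans (mul_le_mul_left ?_ _) (hc _ w hw rfl A hA hsub)
    exact Finset.inf'_le _ (by simpa using Nat.lt_succ_of_le hk)

/-- Restricts the next noise value to `B`; repeated use multiplies the probabilities of prescribed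
moves. -/
lemma mul_le_reach {φ : State m → ℝ≥0∞} (hφ : Measurable φ) {w : State m} {s : ℝ} (hs : s < S.δ)
    {B : Set (Vec m)} (hB : MeasurableSet B) {p c : ℝ≥0∞} (hp : p ≤ stdGaussian (Vec m) B)
    (h : ∀ e ∈ B, c ≤ S.reach φ (S.step w e) (s + S.stepSize (S.step w e).2)) :
    p * c ≤ S.reach φ w s := by
  rw [hS.reach_of_lt hφ hs]
  calc p * c ≤ stdGaussian (Vec m) B * c := mul_le_mul_left hp c
    _ = ∫⁻ _ in B, c ∂(stdGaussian (Vec m)) := by rw [setLIntegral_const, mul_comm]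
    _ ≤ ∫⁻ e in B, S.reach φ (S.step w e) (s + S.stepSize (S.step w e).2)
          ∂(stdGaussian (Vec m)) := setLIntegral_mono' hB h
    _ ≤ _ := setLIntegral_le_lintegral _ _

/-- From a bounded set, whatever the level, the chain passes the time `δ` with a law that dominates
a common measure. -/
lemma exists_minorization (hδ : 5 * S.Δmax < S.δ) (R : ℝ) : ∃ ν : Measure (State m),
    ν Set.univ ≠ 0 ∧ ∀ w : State m, ‖w.1‖ ≤ R → ∀ s : ℝ, 0 ≤ s → s ≤ 2 * S.stepSize w.2 →
      ∀ A, MeasurableSet A → ν A ≤ S.reach (A.indicator fun _ => 1) w s := by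
  have hD := hS.stepMax_pos
  obtain ⟨x₀, r, hr, hacc⟩ := hS.exists_ball_accept
  set B₀ : Set (Vec m) := ball x₀ r with hB₀
  have hB₀m : MeasurableSet B₀ := measurableSet_ball
  obtain ⟨F, hF⟩ := ((isCompact_closedBall (0 : Vec m) (R + 1)).image
    hS.continuous_f.norm).bddAbove
  have hF' : ∀ x : Vec m, ‖x‖ ≤ R + 1 → ‖S.f x‖ ≤ max F 0 := fun x hx =>
    (hF ⟨x, by simpa using hx, rfl⟩).trans (le_max_left _ _)
  have hF0 : 0 ≤ max F 0 := le_max_right _ _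
  set F' := max F 0
  obtain ⟨σ, hσ, hg⟩ := hS.exists_norm_g_le
  set M : ℝ := ∫ e, ‖e‖ ^ 2 ∂(stdGaussian (Vec m)) with hM
  have hM0 : 0 ≤ M := integral_nonneg fun e => by positivity
  -- A step at level `l` with noise at most `(7/6)^l` moves the position by at most `D * (7/8)^l`.
  -- These sum to `8 * D * (7/8)^K` over the levels from `K` on, so `K` keeps the chain within `R +
  -- 1` and the total failure probability below 1/2.
  set D : ℝ := S.Δmax * F' + √S.Δmax * σ with hDdef
  have hD0 : 0 ≤ D := by positivity
  obtain ⟨K, hKacc, hKD, hKM⟩ : ∃ K : ℕ, (∀ x : Vec m, ‖x‖ ≤ R + 1 → ∀ k, K ≤ k → S.Accept x k) ∧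
      8 * D * (7 / 8) ^ K ≤ 1 ∧ 4 * M * (3 / 4) ^ K ≤ 1 / 2 := by
    obtain ⟨K₁, hK₁⟩ := hS.exists_accept_of_norm_le (R + 1)
    have t1 : Tendsto (fun K : ℕ => 8 * D * (7 / 8 : ℝ) ^ K) atTop (𝓝 (8 * D * 0)) :=
      (tendsto_pow_atTop_nhds_zero_of_lt_one (by norm_num) (by norm_num)).const_mul _
    have t2 : Tendsto (fun K : ℕ => 4 * M * (3 / 4 : ℝ) ^ K) atTop (𝓝 (4 * M * 0)) :=
      (tendsto_pow_atTop_nhds_zero_of_lt_one (by norm_num) (by norm_num)).const_mul _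
    rw [mul_zero] at t1 t2
    obtain ⟨K, h1, h2, h3⟩ := ((eventually_ge_atTop K₁).and ((t1.eventually
      (ge_mem_nhds one_pos)).and (t2.eventually (ge_mem_nhds (by norm_num : (0 : ℝ) < 1 / 2))))).exists
    exact ⟨K, fun x hx k hk => hK₁ x hx k (h1.trans hk), h2, h3⟩
  set R' : ℝ := max (R + 1) (‖x₀‖ + r) with hR'
  have hB₀sub : B₀ ⊆ closedBall 0 R' := by
    intro x hx
    rw [mem_closedBall_zero_iff]
    have h1 : ‖x - x₀‖ < r := by simpa [hB₀, dist_eq_norm] using hx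
    have h2 : ‖x‖ ≤ ‖x₀‖ + ‖x - x₀‖ := by
      have := norm_add_le x₀ (x - x₀); simpa using this
    exact (by linarith : ‖x‖ ≤ ‖x₀‖ + r).trans (le_max_right _ _)
  have hB₀norm : ∀ x ∈ B₀, ‖x‖ ≤ R' := fun x hx => mem_closedBall_zero_iff.1 (hB₀sub hx)
  obtain ⟨c, hc0, hc⟩ := hS.exists_mul_volume_le_step R' K
  set p : ℝ≥0∞ := c * volume B₀ with hp
  have hp0 : p ≠ 0 := mul_ne_zero hc0 (measure_ball_pos _ _ hr).ne'
  have hlev0 : ∀ x ∈ B₀, ∀ l, S.level x l = l - 1 := fun x hx l =>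
    level_eq_of_accept (hacc x hx _)
  have hp1 : p ≤ 1 := (hc (x₀, 0) (hB₀norm x₀ (mem_ball_self hr)) (by
    rw [hlev0 x₀ (mem_ball_self hr)]; exact Nat.zero_le _) B₀ hB₀m hB₀sub).trans prob_le_one
  set emb : Vec m → State m := fun x => (x, 0) with hemb
  have hembm : Measurable emb := by fun_prop
  set ν₀ : Measure (State m) := c • (volume.restrict B₀).map emb with hν₀
  have hν₀A : ∀ A, MeasurableSet A → ν₀ A = c * volume (emb ⁻¹' A ∩ B₀) := fun A hA => by
    rw [hν₀, Measure.smul_apply, Measure.map_apply hembm hA,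
      Measure.restrict_apply (hembm hA), smul_eq_mul]
  obtain ⟨n₀, hn₀⟩ := exists_nat_ge (S.δ / S.Δmax)
  rw [div_le_iff₀ hD] at hn₀
  have hpm : ∀ w : State m, MeasurableSet {e | (S.step w e).1 ∈ B₀} := fun w =>
    (hS.measurable_step_right w).fst hB₀m
  have hsucc : ∀ k, 2 * S.stepSize (k + 1) = S.stepSize k := S.stepSize_succ
  set ε : ℝ≥0∞ := p * (p ^ K * p ^ n₀) with hε
  have hε0 : ε ≠ 0 := mul_ne_zero hp0 (mul_ne_zero (pow_ne_zero _ hp0) (pow_ne_zero _ hp0))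
  -- Time budget: the fall to level `K` takes the elapsed time to at most `2 * Δmax`, the jump into
  -- the ball adds one step, and the descent inside it ends by `4 * Δmax`. Thus no intermediate move
  -- starts after `δ`, and waiting at level 0 fills the rest. The factor 1/2 is the probability of
  -- the fall.
  refine ⟨(ENNReal.ofReal (1 / 2) * ε) • ν₀, ?_, fun w hw s hs hsw A hA => ?_⟩
  · rw [Measure.smul_apply, hν₀A _ .univ, smul_eq_mul, Set.preimage_univ, Set.univ_inter]
    exact mul_ne_zero (mul_ne_zero (by simp) hε0) hp0
  set φ : State m → ℝ≥0∞ := A.indicator fun _ => 1 with hφdef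
  have hφ : Measurable φ := measurable_const.indicator hA
  -- remaining in the ball at level `0`
  have stay : ∀ (n : ℕ) (w : State m) (s : ℝ), w.1 ∈ B₀ → w.2 = 0 → S.δ ≤ s + n * S.Δmax →
      p ^ n * ν₀ A ≤ S.reach φ w s := by
    have hlast : ∀ (w : State m) (s : ℝ), w.1 ∈ B₀ → w.2 = 0 → S.δ ≤ s →
        ν₀ A ≤ S.reach φ w s := by
      intro w s hw hl hs
      -- Once `δ` is reached one more step is made; it is this step at level 0 that produces `ν₀`.
      have hlev : S.level w.1 w.2 = 0 := by rw [hlev0 _ hw, hl]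
      rw [hS.reach_of_le hφ hs]
      have h1 : (fun e => φ (S.step w e)) = (S.step w ⁻¹' A).indicator 1 := rfl
      rw [h1, lintegral_indicator_one (hS.measurable_step_right w hA), hν₀A A hA]
      refine (hc w (hB₀norm _ hw) (by rw [hlev]; exact Nat.zero_le _) _
        ((hembm hA).inter hB₀m) (Set.inter_subset_right.trans hB₀sub)).trans ?_
      refine measure_mono fun e he => ?_
      have h2 : S.step w e = ((S.step w e).1, 0) := Prod.ext rfl hlev
      change S.step w e ∈ A
      rw [h2]
      exact he.1
    intro n
    induction n with
    | zero =>
      intro w s hw hl hs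
      rw [pow_zero, one_mul]
      exact hlast w s hw hl (by simpa using hs)
    | succ n ih =>
      intro w s hw hl hs
      rcases le_or_gt S.δ s with h | h
      · exact (mul_le_of_le_one_left zero_le (pow_le_one₀ zero_le hp1)).trans (hlast w s hw hl h)
      · have hlev : S.level w.1 w.2 = 0 := by rw [hlev0 _ hw, hl]
        rw [pow_succ', mul_assoc]
        refine hS.mul_le_reach hφ h (hpm w) (hc w (hB₀norm _ hw)
          (by rw [hlev]; exact Nat.zero_le _) B₀ hB₀m hB₀sub) fun e he => ?_
        refine ih _ _ he hlev ?_
        have h3 : S.stepSize (S.step w e).2 = S.Δmax := by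
          rw [show (S.step w e).2 = 0 from hlev, stepSize, pow_zero, one_mul]
        rw [h3]
        push_cast at hs
        linarith
  -- descending to level `0` in the ball
  have descend : ∀ (l : ℕ) (w : State m) (s : ℝ), w.1 ∈ B₀ → w.2 = l → l ≤ K → 0 ≤ s →
      s ≤ 2 * S.Δmax + 2 * S.stepSize l → p ^ l * (p ^ n₀ * ν₀ A) ≤ S.reach φ w s := by
    intro l
    induction l with
    | zero =>
      intro w s hw hl _ hs _
      rw [pow_zero, one_mul]
      exact stay n₀ w s hw hl (by linarith)
    | succ l ih =>
      intro w s hw hl hlK hs hs2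
      -- The bound `2 * Δmax + 2 * stepSize l` reproduces itself, since twice the finer step is the
      -- coarser one.
      rw [hsucc l] at hs2
      have hle := hS.stepSize_le l
      have hpos := hS.stepSize_pos l
      have hlev : S.level w.1 w.2 = l := by rw [hlev0 _ hw, hl]; rfl
      rw [pow_succ', mul_assoc]
      refine hS.mul_le_reach hφ (by linarith) (hpm w) (hc w (hB₀norm _ hw)
          (by rw [hlev]; omega) B₀ hB₀m hB₀sub) fun e he => ?_
      refine ih _ _ he hlev (by omega) ?_ ?_ <;> rw [show (S.step w e).2 = l from hlev] <;> linarith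
  -- jumping into the ball
  have jump : ∀ (w : State m) (s : ℝ), ‖w.1‖ ≤ R + 1 → w.2 ≤ K → 0 ≤ s → s ≤ 2 * S.Δmax →
      ε * ν₀ A ≤ S.reach φ w s := by
    intro w s hw hl hs hs2
    have hlev : S.level w.1 w.2 ≤ K := level_le_of_accept (hKacc _ hw K le_rfl) (by omega)
    have h1 : ε * ν₀ A = p * (p ^ K * (p ^ n₀ * ν₀ A)) := by rw [hε]; ring
    rw [h1]
    refine hS.mul_le_reach hφ (by linarith) (hpm w) (hc w (hw.trans (le_max_left _ _)) hlev
      B₀ hB₀m hB₀sub) fun e he => ?_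
    have hpos := hS.stepSize_pos (S.step w e).2
    refine le_trans ?_ (descend (S.step w e).2 _ _ he rfl hlev (by linarith) (by linarith))
    refine mul_le_mul_left ?_ _
    exact pow_le_pow_of_le_one zero_le hp1 hlev
  -- descending to level `K`
  have fall : ∀ l, K ≤ l → ∀ (w : State m) (s : ℝ), ‖w.1‖ ≤ R + 8 * D * (7 / 8) ^ l → w.2 = l →
      0 ≤ s → s ≤ 2 * S.stepSize l →
      ENNReal.ofReal (1 - 4 * M * ((3 / 4) ^ K - (3 / 4) ^ l)) * (ε * ν₀ A) ≤ S.reach φ w s := by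
    intro l hl
    induction l, hl using Nat.le_induction with
    | base =>
      intro w s hw hl hs hs2
      rw [sub_self, mul_zero, sub_zero, ENNReal.ofReal_one, one_mul]
      have := hS.stepSize_le K
      exact jump w s (by linarith) hl.le hs (by linarith)
    | succ l hl ih =>
      intro w s hw hwl hs hs2
      rw [hsucc l] at hs2
      have hle := hS.stepSize_le l
      have hpos := hS.stepSize_pos l
      have h78 : (7 / 8 : ℝ) ^ l ≤ (7 / 8) ^ K :=
        pow_le_pow_of_le_one (by norm_num) (by norm_num) hl
      have h78' : (7 / 8 : ℝ) ^ (l + 1) ≤ (7 / 8) ^ l :=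
        pow_le_pow_of_le_one (by norm_num) (by norm_num) (by omega)
      have h8D : 8 * D * (7 / 8 : ℝ) ^ (l + 1) ≤ 1 := by
        refine le_trans ?_ hKD
        exact mul_le_mul_of_nonneg_left (h78'.trans h78) (by positivity)
      have hw1 : ‖w.1‖ ≤ R + 1 := by linarith
      have hlev : S.level w.1 w.2 = l := by
        rw [hwl]
        exact level_eq_of_accept (hKacc _ hw1 _ (by simpa using hl))
      set u : ℝ := M * (3 / 4) ^ l with hu
      have hu0 : 0 ≤ u := by positivity
      have h34 : (3 / 4 : ℝ) ^ l ≤ (3 / 4) ^ K :=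
        pow_le_pow_of_le_one (by norm_num) (by norm_num) hl
      set t : ℝ := 4 * M * ((3 / 4) ^ K - (3 / 4) ^ l) with ht
      have ht0 : 0 ≤ t := mul_nonneg (by positivity) (by linarith)
      have ht1 : t ≤ 1 / 2 := by
        have : 0 ≤ 4 * M * (3 / 4 : ℝ) ^ l := by positivity
        rw [ht, mul_sub]; linarith
      -- The radius serves two ends. The noise increment decays, as `√(1/2) ≤ 3/4` and `(3/4)(7/6) =
      -- 7/8`. By Chebyshev the failure probability is at most `M * (3/4)^l`, as `(7/6)² (3/4) ≥ 1`.
      have hB : MeasurableSet {e : Vec m | ‖e‖ ≤ (7 / 6) ^ l} :=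
        measurableSet_le measurable_norm measurable_const
      have hprob : ENNReal.ofReal (1 - u) ≤
          stdGaussian (Vec m) {e : Vec m | ‖e‖ ≤ (7 / 6) ^ l} := by
        have h1 := stdGaussian_norm_gt_le (m := m) (c := (7 / 6) ^ l) (by positivity)
        have h2 : M / ((7 / 6 : ℝ) ^ l) ^ 2 ≤ u := by
          rw [div_le_iff₀ (by positivity), hu, mul_assoc, ← pow_mul, mul_comm l 2, pow_mul,
            ← mul_pow]
          exact le_mul_of_one_le_right hM0 (one_le_pow₀ (by norm_num))
        have h3 : {e : Vec m | ‖e‖ ≤ (7 / 6) ^ l} = {e : Vec m | (7 / 6) ^ l < ‖e‖}ᶜ := by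
          ext e; simp
        rw [h3, prob_compl_eq_one_sub (measurableSet_lt measurable_const measurable_norm),
          ENNReal.ofReal_sub _ hu0, ENNReal.ofReal_one]
        exact tsub_le_tsub_left (h1.trans (ENNReal.ofReal_le_ofReal h2)) _
      have hfin : ENNReal.ofReal (1 - 4 * M * ((3 / 4) ^ K - (3 / 4) ^ (l + 1)))
          ≤ ENNReal.ofReal (1 - u) * ENNReal.ofReal (1 - t) := by
        rw [← ENNReal.ofReal_mul' (by linarith)]
        refine ENNReal.ofReal_le_ofReal ?_
        -- The failure probabilities telescope: `4 * ((3/4)^l - (3/4)^(l+1)) = (3/4)^l`.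
        have : 4 * M * ((3 / 4 : ℝ) ^ K - (3 / 4) ^ (l + 1)) = t + u := by
          rw [ht, hu, pow_succ]; ring
        rw [this]
        nlinarith
      refine (mul_le_mul_left hfin _).trans ?_
      rw [mul_assoc]
      refine hS.mul_le_reach hφ (by linarith) hB hprob fun e he => ?_
      have he' : ‖e‖ ≤ (7 / 6 : ℝ) ^ l := he
      have hst : (S.step w e).2 = l := hlev
      refine ih _ _ ?_ hst ?_ ?_
      · have h1 : (S.step w e).1 = w.1 + S.stepSize l • S.f w.1
            + √(S.stepSize l) • S.g w.1 e := by
          simp [step, hlev, euler]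
        have h2 : S.stepSize l ≤ (7 / 8) ^ l * S.Δmax := by
          unfold stepSize
          gcongr
          norm_num
        have h3 : √(S.stepSize l) ≤ (3 / 4) ^ l * √S.Δmax := by
          refine Real.sqrt_le_iff.2 ⟨by positivity, ?_⟩
          rw [mul_pow, Real.sq_sqrt hD.le, stepSize, ← pow_mul, mul_comm l 2, pow_mul]
          gcongr
          norm_num
        have h4 : ‖S.stepSize l • S.f w.1‖ ≤ (7 / 8) ^ l * S.Δmax * F' := by
          rw [norm_smul, Real.norm_of_nonneg hpos.le]
          exact mul_le_mul h2 (hF' _ hw1) (norm_nonneg _) (by positivity)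
        have h5 : ‖√(S.stepSize l) • S.g w.1 e‖ ≤ (7 / 8) ^ l * (√S.Δmax * σ) := by
          rw [norm_smul, Real.norm_of_nonneg (Real.sqrt_nonneg _)]
          calc √(S.stepSize l) * ‖S.g w.1 e‖
              ≤ ((3 / 4) ^ l * √S.Δmax) * (σ * (7 / 6) ^ l) := by
                gcongr
                exact ((S.g w.1).le_of_opNorm_le (hg _) e).trans (by gcongr)
            _ = ((3 / 4) * (7 / 6)) ^ l * (√S.Δmax * σ) := by rw [mul_pow]; ring
            _ = _ := by norm_num
        rw [h1]
        calc ‖w.1 + S.stepSize l • S.f w.1 + √(S.stepSize l) • S.g w.1 e‖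
            ≤ ‖w.1‖ + ‖S.stepSize l • S.f w.1‖ + ‖√(S.stepSize l) • S.g w.1 e‖ := norm_add₃_le
          _ ≤ (R + 8 * D * (7 / 8) ^ (l + 1)) + (7 / 8) ^ l * S.Δmax * F'
              + (7 / 8) ^ l * (√S.Δmax * σ) := by gcongr
          _ = R + 8 * D * (7 / 8) ^ l := by rw [hDdef, pow_succ]; ring
      · rw [hst]; linarith
      · rw [hst]; linarith
  have hconc : ENNReal.ofReal (1 / 2) * ε * ν₀ A ≤ S.reach φ w s := by
    rcases le_or_gt K w.2 with h | h
    · refine le_trans ?_ (fall w.2 h w s ?_ rfl hs hsw)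
      · rw [mul_assoc]
        refine mul_le_mul_left (ENNReal.ofReal_le_ofReal ?_) _
        have : 0 ≤ 4 * M * (3 / 4 : ℝ) ^ w.2 := by positivity
        rw [mul_sub]; linarith
      · have : 0 ≤ 8 * D * (7 / 8 : ℝ) ^ w.2 := by positivity
        linarith
    · have := hS.stepSize_le w.2
      refine le_trans ?_ (jump w s (by linarith) h.le hs (by linarith))
      refine mul_le_mul_left (mul_le_of_le_one_left zero_le ?_) _
      rw [ENNReal.ofReal_le_one]; norm_num
  rwa [Measure.smul_apply, smul_eq_mul]

end Admissible

end Scheme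

end AdaptiveEM

end

/-! ### Almost sure passage of time δ, and the transition kernel -/

noncomputable section

namespace AdaptiveEM

namespace Scheme

open scoped ENNReal
open Filter Topology

variable {m : ℕ} {S : Scheme m}

lemma mem_hitSet_concat {n k : ℕ} (hk : k ≤ n) {w : State m} {s : ℝ} {ζ ξ : ℕ → Vec m} :
    k ∈ S.hitSet w s (concat n ζ ξ) ↔ k ∈ S.hitSet w s ζ := by
  have h := S.time_congr w (η := concat n ζ ξ) (η' := ζ) (n := k)
    fun i hi => concat_of_lt (hi.trans_le hk) ζ ξ
  change S.δ ≤ s + S.time w (concat n ζ ξ) k ↔ S.δ ≤ s + S.time w ζ k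
  rw [h]

lemma chain_concat (n : ℕ) (w : State m) (ζ ξ : ℕ → Vec m) :
    S.chain w (concat n ζ ξ) n = S.chain w ζ n :=
  S.chain_congr w fun _ hi => concat_of_lt hi ζ ξ

lemma add_mem_hitSet {n k : ℕ} {w : State m} {s : ℝ} {η : ℕ → Vec m} :
    n + k ∈ S.hitSet w s η ↔
      k ∈ S.hitSet (S.chain w η n) (s + S.time w η n) fun i => η (i + n) := by
  change S.δ ≤ _ ↔ S.δ ≤ _
  rw [time_add, add_assoc]

lemma nonempty_hitSet_concat {n : ℕ} {w : State m} {s : ℝ} {ζ ξ : ℕ → Vec m} :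
    ¬ (S.hitSet w s (concat n ζ ξ)).Nonempty ↔ ζ ∈ S.alive n w s ∧
      ¬ (S.hitSet (S.chain w ζ n) (s + S.time w ζ n) ξ).Nonempty := by
  have hshift : (fun i => concat n ζ ξ (i + n)) = ξ := funext fun i => concat_add n i ζ ξ
  have htime : S.time w (concat n ζ ξ) n = S.time w ζ n :=
    S.time_congr w fun _ hi => concat_of_lt hi ζ ξ
  have hadd : ∀ k, n + k ∈ S.hitSet w s (concat n ζ ξ) ↔
      k ∈ S.hitSet (S.chain w ζ n) (s + S.time w ζ n) ξ := by
    intro k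
    rw [add_mem_hitSet, chain_concat, hshift, htime]
  constructor
  · intro h
    refine ⟨fun k hk hm => h ⟨k, (mem_hitSet_concat hk).2 hm⟩, ?_⟩
    rintro ⟨k, hk⟩
    exact h ⟨_, (hadd k).2 hk⟩
  · rintro ⟨h1, h2⟩ ⟨k, hk⟩
    rcases le_total k n with hkn | hkn
    · exact h1 k hkn ((mem_hitSet_concat hkn).1 hk)
    · obtain ⟨j, rfl⟩ := Nat.exists_eq_add_of_le hkn
      exact h2 ⟨j, (hadd j).1 hk⟩

lemma alive_antitone (w : State m) (s : ℝ) : Antitone fun n => S.alive n w s :=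
  fun _ _ hnk _ h i hi => h i (le_trans hi hnk)

lemma iInter_alive (w : State m) (s : ℝ) :
    ⋂ n, S.alive n w s = {η | ¬ (S.hitSet w s η).Nonempty} := by
  ext η
  simp only [Set.mem_iInter]
  constructor
  · rintro h ⟨k, hk⟩
    exact h k k le_rfl hk
  · exact fun h _ k _ hk => h ⟨k, hk⟩

/-- Before index `n` the noise is `ζ`, after that it is independent of `ζ`. -/
lemma lintegral_mul_chain_shift {n : ℕ} {A : (ℕ → Vec m) → ℝ≥0∞}
    {B : State m → (ℕ → Vec m) → ℝ≥0∞} (hS : S.Admissible) (hA : Measurable A)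
    (hB : Measurable (Function.uncurry B)) (hAc : ∀ ζ ξ, A (concat n ζ ξ) = A ζ) (z : State m) :
    ∫⁻ η, A η * B (S.chain z η n) (fun i => η (i + n)) ∂(noise m)
      = ∫⁻ ζ, A ζ * ∫⁻ ξ, B (S.chain z ζ n) ξ ∂(noise m) ∂(noise m) := by
  have h1 : Measurable fun η : ℕ → Vec m => (S.chain z η n, fun i => η (i + n)) :=
    (hS.measurable_chain_index measurable_const measurable_id measurable_const).prodMk
      (by fun_prop)
  have hm : Measurable fun η => A η * B (S.chain z η n) (fun i => η (i + n)) :=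
    hA.mul (hB.comp h1)
  rw [lintegral_noise_concat n hm]
  refine lintegral_congr fun ζ => ?_
  have hshift : ∀ ξ : ℕ → Vec m, (fun i => concat n ζ ξ (i + n)) = ξ := fun ξ =>
    funext fun i => concat_add n i ζ ξ
  simp only [hAc, chain_concat, hshift]
  exact lintegral_const_mul _ (hB.comp measurable_prodMk_left)

namespace Admissible

variable (hS : S.Admissible)
include hS

lemma time_strictMono (w : State m) (η : ℕ → Vec m) : StrictMono (S.time w η) :=
  strictMono_nat_of_lt_succ fun _ => lt_add_of_pos_right _ (hS.stepSize_pos _)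

lemma time_nonneg (w : State m) (η : ℕ → Vec m) (n : ℕ) : 0 ≤ S.time w η n :=
  (hS.time_strictMono w η).monotone n.zero_le

lemma measurableSet_hitSet_nonempty (w : State m) (s : ℝ) :
    MeasurableSet {η | (S.hitSet w s η).Nonempty} :=
  (measurable_const.prodMk (measurable_const.prodMk measurable_id) :
    Measurable fun η : ℕ → Vec m => (w, s, η)) hS.measurableSet_nonempty_hitSet

lemma measurableSet_alive_right (n : ℕ) (w : State m) (s : ℝ) :
    MeasurableSet (S.alive n w s) :=
  (measurable_const.prodMk (measurable_const.prodMk measurable_id) :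
    Measurable fun η : ℕ → Vec m => (w, s, η)) (hS.measurableSet_alive n)

/-- The total mass of the minorizing measure at `s = 0`; a larger elapsed time only makes `δ` easier
to reach. -/
lemma exists_hit_ge (hδ : 5 * S.Δmax < S.δ) (R : ℝ) : ∃ p : ℝ≥0∞, p ≠ 0 ∧ p ≤ 1 ∧
    ∀ (w : State m) (s : ℝ), ‖w.1‖ ≤ R → 0 ≤ s →
      noise m {η | ¬ (S.hitSet w s η).Nonempty} + p ≤ 1 := by
  obtain ⟨ν, hν0, hν⟩ := hS.exists_minorization hδ R
  refine ⟨min (ν Set.univ) 1, ?_, min_le_right _ _, fun w s hw hs => ?_⟩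
  · rw [← pos_iff_ne_zero, lt_min_iff]
    exact ⟨pos_iff_ne_zero.2 hν0, one_pos⟩
  · have h1 := hν w hw 0 le_rfl (by have := hS.stepSize_pos w.2; positivity) _ .univ
    have h2 := h1.trans (reach_mono (S := S) (by simp) hs)
    have h3 : S.reach (Set.univ.indicator fun _ => 1) w s
        = noise m {η | (S.hitSet w s η).Nonempty} := by
      rw [← lintegral_indicator_one (hS.measurableSet_hitSet_nonempty w s)]
      refine lintegral_congr fun η => ?_
      rw [Set.indicator_univ]
      by_cases h : (S.hitSet w s η).Nonempty
      · rw [stopVal, if_pos h, Set.indicator_of_mem (by exact h)]; rfl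
      · rw [stopVal, if_neg h, Set.indicator_of_notMem (by exact h)]
    rw [h3] at h2
    have h4 := measure_add_measure_compl (μ := noise m) (hS.measurableSet_hitSet_nonempty w s)
    rw [measure_univ] at h4
    calc _ ≤ noise m {η | ¬ (S.hitSet w s η).Nonempty}
          + noise m {η | (S.hitSet w s η).Nonempty} := by
            gcongr
            exact (min_le_left _ _).trans h2
      _ = 1 := by rw [add_comm]; exact h4

/-- The time `δ` is almost surely reached. -/
theorem ae_nonempty_hitSet (hδ : 5 * S.Δmax < S.δ) (w : State m) {s : ℝ} (hs : 0 ≤ s)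
    (hsD : s ≤ S.δ + S.Δmax) : ∀ᵐ η ∂(noise m), (S.hitSet w s η).Nonempty := by
  -- `a` is the probability of never reaching `δ`. Conditioning at index `n`, it is at most `1 - p`
  -- where the position is within `R`, and the rest has mass at most `C / R²`. This gives `a + p *
  -- P(alive n) ≤ P(alive n) + p * C / R²`. As `n → ∞`, `P(alive n)` tends to `a`, so `p` cancels
  -- and `a ≤ C / R²` for every `R`.
  set a : State m → ℝ → ℝ≥0∞ := fun w s => noise m {η | ¬ (S.hitSet w s η).Nonempty} with ha
  obtain ⟨C, hC⟩ := hS.exists_lintegral_alive_le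
  have hsplit : ∀ n, a w s = ∫⁻ ζ, (S.alive n w s).indicator
      (fun ζ => a (S.chain w ζ n) (s + S.time w ζ n)) ζ ∂(noise m) := by
    intro n
    have hm : MeasurableSet {η | ¬ (S.hitSet w s η).Nonempty} :=
      (hS.measurableSet_hitSet_nonempty w s).compl
    simp only [ha]
    rw [← lintegral_indicator_one hm, lintegral_noise_concat n (measurable_one.indicator hm)]
    refine lintegral_congr fun ζ => ?_
    by_cases hζ : ζ ∈ S.alive n w s
    · have hm' : MeasurableSet
          {η | ¬ (S.hitSet (S.chain w ζ n) (s + S.time w ζ n) η).Nonempty} :=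
        (hS.measurableSet_hitSet_nonempty _ _).compl
      rw [Set.indicator_of_mem hζ, ← lintegral_indicator_one hm']
      refine lintegral_congr fun ξ => ?_
      by_cases h : (S.hitSet (S.chain w ζ n) (s + S.time w ζ n) ξ).Nonempty
      · rw [Set.indicator_of_notMem (by exact fun h' => (nonempty_hitSet_concat.1 h').2 h),
          Set.indicator_of_notMem (by exact fun h' => h' h)]
      · rw [Set.indicator_of_mem (by exact nonempty_hitSet_concat.2 ⟨hζ, h⟩),
          Set.indicator_of_mem (by exact h)]
        rfl
    · rw [Set.indicator_of_notMem hζ, lintegral_eq_zero_of_ae_eq_zero]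
      refine Eventually.of_forall fun ξ => ?_
      exact Set.indicator_of_notMem
        (fun h' => hζ (nonempty_hitSet_concat.1 (show ¬ (S.hitSet w s _).Nonempty from h')).1) _
  have ha1 : a w s ≤ 1 := prob_le_one
  have hbound : ∀ R : ℝ, 0 < R → a w s ≤ ENNReal.ofReal (C w s) / ENNReal.ofReal (R ^ 2) := by
    intro R hR
    obtain ⟨p, hp0, hp1, hp⟩ := hS.exists_hit_ge hδ R
    have hpt : p ≠ ⊤ := (hp1.trans_lt ENNReal.one_lt_top).ne
    have hR2 : ENNReal.ofReal (R ^ 2) ≠ 0 := by simpa using hR.ne'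
    have hn : ∀ n, a w s + p * noise m (S.alive n w s) ≤ noise m (S.alive n w s)
        + p / ENNReal.ofReal (R ^ 2) * ENNReal.ofReal (C w s) := by
      intro n
      have hal := hS.measurableSet_alive_right n w s
      have hmx : Measurable ((S.alive n w s).indicator
          fun η => ENNReal.ofReal (‖(S.chain w η n).1‖ ^ 2)) :=
        (((hS.measurable_chain_index measurable_const measurable_id
          measurable_const).fst.norm.pow_const 2).ennreal_ofReal).indicator hal
      have hpt' : ∀ η, (S.alive n w s).indicator
            (fun ζ => a (S.chain w ζ n) (s + S.time w ζ n)) η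
            + p * (S.alive n w s).indicator 1 η ≤ (S.alive n w s).indicator 1 η
            + p / ENNReal.ofReal (R ^ 2) * (S.alive n w s).indicator
              (fun η => ENNReal.ofReal (‖(S.chain w η n).1‖ ^ 2)) η := by
        intro η
        by_cases h : η ∈ S.alive n w s
        · simp only [Set.indicator_of_mem h, Pi.one_apply, mul_one]
          rcases le_or_gt ‖(S.chain w η n).1‖ R with hx | hx
          · exact (hp _ _ hx (add_nonneg hs (hS.time_nonneg w η n))).trans le_self_add
          · refine add_le_add prob_le_one ?_
            rw [div_eq_mul_inv, mul_assoc]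
            refine le_mul_of_one_le_right zero_le ?_
            rw [mul_comm, ← div_eq_mul_inv, ENNReal.le_div_iff_mul_le (Or.inl hR2)
              (Or.inl ENNReal.ofReal_ne_top), one_mul]
            exact ENNReal.ofReal_le_ofReal (by gcongr)
        · simp [Set.indicator_of_notMem h]
      calc a w s + p * noise m (S.alive n w s)
          = ∫⁻ η, ((S.alive n w s).indicator (fun ζ => a (S.chain w ζ n) (s + S.time w ζ n)) η
            + p * (S.alive n w s).indicator 1 η) ∂(noise m) := by
            rw [lintegral_add_right _ ((measurable_one.indicator hal).const_mul p), ← hsplit n,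
              lintegral_const_mul _ (measurable_one.indicator hal), lintegral_indicator_one hal]
        _ ≤ ∫⁻ η, ((S.alive n w s).indicator 1 η
            + p / ENNReal.ofReal (R ^ 2) * (S.alive n w s).indicator
              (fun η => ENNReal.ofReal (‖(S.chain w η n).1‖ ^ 2)) η) ∂(noise m) :=
            lintegral_mono hpt'
        _ ≤ _ := by
            rw [lintegral_add_right _ (hmx.const_mul _), lintegral_indicator_one hal,
              lintegral_const_mul _ hmx]
            gcongr
            exact hC n w s hs hsD
    have hU : Tendsto (fun n => noise m (S.alive n w s)) atTop (𝓝 (a w s)) := by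
      have := tendsto_measure_iInter_atTop (μ := noise m)
        (fun n => (hS.measurableSet_alive_right n w s).nullMeasurableSet) (alive_antitone w s)
        ⟨0, measure_ne_top _ _⟩
      rwa [iInter_alive] at this
    have hlim := le_of_tendsto_of_tendsto'
      (tendsto_const_nhds.add (ENNReal.Tendsto.const_mul hU (Or.inr hpt)))
      (hU.add_const (p / ENNReal.ofReal (R ^ 2) * ENNReal.ofReal (C w s))) hn
    have h1 := (ENNReal.add_le_add_iff_left (ha1.trans_lt ENNReal.one_lt_top).ne).1 hlim
    rw [div_eq_mul_inv, mul_assoc, ENNReal.mul_le_mul_iff_right hp0 hpt] at h1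
    rwa [div_eq_mul_inv, mul_comm (ENNReal.ofReal (C w s))]
  have hzero : a w s = 0 := by
    have ht : Tendsto (fun R : ℝ => ENNReal.ofReal (C w s) / ENNReal.ofReal (R ^ 2)) atTop
        (𝓝 0) := by
      have h1 : Tendsto (fun R : ℝ => C w s / R ^ 2) atTop (𝓝 0) :=
        tendsto_const_nhds.div_atTop (tendsto_pow_atTop two_ne_zero)
      have h2 := ENNReal.tendsto_ofReal h1
      rw [ENNReal.ofReal_zero] at h2
      refine h2.congr' ?_
      filter_upwards [eventually_gt_atTop 0] with R hR
      exact ENNReal.ofReal_div_of_pos (by positivity)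
    refine le_antisymm (ge_of_tendsto ht ?_) zero_le
    filter_upwards [eventually_gt_atTop 0] with R hR using hbound R hR
  exact hzero

lemma measurable_wait : Measurable fun p : State m × (ℕ → Vec m) => S.wait p.1 p.2 :=
  hS.measurable_hitIdx.comp (measurable_fst.prodMk
    (((Measurable.of_discrete (f := S.stepSize)).comp measurable_fst.snd).prodMk measurable_snd))

lemma measurable_transition_map : Measurable fun p : State m × (ℕ → Vec m) =>
    S.chain p.1 p.2 (S.wait p.1 p.2 + 1) :=
  hS.measurable_chain_index measurable_fst measurable_snd (hS.measurable_wait.add_const 1)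

lemma measurable_transition_map_right (w : State m) :
    Measurable fun η : ℕ → Vec m => S.chain w η (S.wait w η + 1) := by
  have h : Measurable fun η : ℕ → Vec m => S.wait w η :=
    hS.measurable_wait.comp measurable_prodMk_left
  exact hS.measurable_chain_index measurable_const measurable_id (h.add_const 1)

/-- The transition probabilities of the sampled chain as a Markov kernel. -/
def transitionKernel : Kernel (State m) (State m) where
  toFun := S.transition
  measurable' := by
    refine Measure.measurable_of_measurable_coe _ fun A hA => ?_
    simp only [transition, Measure.map_apply (hS.measurable_transition_map_right _) hA]
    exact measurable_measure_prodMk_left (hS.measurable_transition_map hA)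

lemma transitionKernel_apply (w : State m) : hS.transitionKernel w = S.transition w := rfl

instance isMarkovKernel_transitionKernel : IsMarkovKernel hS.transitionKernel :=
  ⟨fun w => Measure.isProbabilityMeasure_map (hS.measurable_transition_map_right w).aemeasurable⟩

lemma lintegral_transitionKernel {φ : State m → ℝ≥0∞} (hφ : Measurable φ) (w : State m) :
    ∫⁻ y, φ y ∂(hS.transitionKernel w)
      = ∫⁻ η, φ (S.chain w η (S.wait w η + 1)) ∂(noise m) :=
  lintegral_map hφ (hS.measurable_transition_map_right w)

lemma ae_nonempty_hitSet_stepSize (hδ : 5 * S.Δmax < S.δ) (w : State m) :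
    ∀ᵐ η ∂(noise m), (S.hitSet w (S.stepSize w.2) η).Nonempty := by
  have := hS.stepMax_pos
  exact hS.ae_nonempty_hitSet hδ w (hS.stepSize_pos _).le (by linarith [hS.stepSize_le w.2])

lemma lintegral_transitionKernel_eq_reach (hδ : 5 * S.Δmax < S.δ) {φ : State m → ℝ≥0∞}
    (hφ : Measurable φ) (w : State m) :
    ∫⁻ y, φ y ∂(hS.transitionKernel w) = S.reach φ w (S.stepSize w.2) := by
  rw [hS.lintegral_transitionKernel hφ]
  refine lintegral_congr_ae ?_
  filter_upwards [hS.ae_nonempty_hitSet_stepSize hδ w] with η hη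
  rw [stopVal, if_pos hη]
  rfl

end Admissible

end Scheme

end AdaptiveEM

end

/-! ### Markov property of the sampled chain -/

noncomputable section

namespace AdaptiveEM

namespace Scheme

open scoped ENNReal
open Filter Topology

variable {m : ℕ}

/-- The indices at which the time exceeds that at index `n` by at least `δ`. -/
def laterSet (S : Scheme m) (z : State m) (n : ℕ) (η : ℕ → Vec m) : Set ℕ :=
  {k | S.δ + S.time z η n ≤ S.time z η k}

/-- The event that the sampling indices `N_1, …, N_j` are finite. -/
def found (S : Scheme m) (z : State m) (j : ℕ) : Set (ℕ → Vec m) :=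
  {η | ∀ i < j, (S.laterSet z (S.sampleIdx z η i) η).Nonempty}

/-- The first `j + 1` states of the sampled chain. -/
def sampledTuple (S : Scheme m) (z : State m) (j : ℕ) (η : ℕ → Vec m) : Fin (j + 1) → State m :=
  fun i => S.sampled z i η

variable {S : Scheme m}

lemma sampleIdx_succ (z : State m) (η : ℕ → Vec m) (j : ℕ) :
    S.sampleIdx z η (j + 1) = sInf (S.laterSet z (S.sampleIdx z η j) η) := rfl

lemma mem_laterSet_congr {z : State m} {n k N : ℕ} {η η' : ℕ → Vec m}
    (h : ∀ i < N, η i = η' i) (hn : n ≤ N) (hk : k ≤ N) :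
    k ∈ S.laterSet z n η ↔ k ∈ S.laterSet z n η' := by
  change S.δ + S.time z η n ≤ S.time z η k ↔ S.δ + S.time z η' n ≤ S.time z η' k
  rw [S.time_congr z fun i hi => h i (hi.trans_le hn),
    S.time_congr z fun i hi => h i (hi.trans_le hk)]

/-- The state at index `n + 1` carries the level of the step just made; that step counts towards
`δ`, so the clock restarts at its size and not at 0. -/
lemma add_mem_laterSet {z : State m} {n k : ℕ} {η : ℕ → Vec m} :
    n + 1 + k ∈ S.laterSet z n η ↔ k ∈ S.hitSet (S.chain z η (n + 1))
      (S.stepSize (S.chain z η (n + 1)).2) fun i => η (i + (n + 1)) := by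
  change S.δ + S.time z η n ≤ _ ↔ S.δ ≤ _
  rw [time_add, time]
  constructor <;> intro h <;> linarith

lemma found_succ {z : State m} {j : ℕ} {η : ℕ → Vec m} (h : η ∈ S.found z (j + 1)) :
    η ∈ S.found z j := fun i hi => h i (hi.trans j.lt_succ_self)

/-- Every past event is a preimage under a single random vector, so conditional expectations can be
tested on such preimages. -/
lemma past_eq_comap (z : State m) (j : ℕ) :
    S.past z j = MeasurableSpace.comap (S.sampledTuple z j) MeasurableSpace.pi := by
  simp only [past, MeasurableSpace.pi, MeasurableSpace.comap_iSup, MeasurableSpace.comap_comp]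
  rfl

namespace Admissible

variable (hS : S.Admissible)
include hS

lemma lt_of_mem_laterSet (hδ : 0 < S.δ) {z : State m} {n k : ℕ} {η : ℕ → Vec m}
    (h : k ∈ S.laterSet z n η) : n < k := by
  have h1 : S.δ + S.time z η n ≤ S.time z η k := h
  exact (hS.time_strictMono z η).lt_iff_lt.1 (by linarith)

lemma sInf_laterSet (hδ : 0 < S.δ) {z : State m} {n : ℕ} {η : ℕ → Vec m}
    (h : (S.hitSet (S.chain z η (n + 1)) (S.stepSize (S.chain z η (n + 1)).2)
      fun i => η (i + (n + 1))).Nonempty) :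
    sInf (S.laterSet z n η)
      = n + 1 + S.wait (S.chain z η (n + 1)) fun i => η (i + (n + 1)) := by
  have hmem : n + 1 + S.wait (S.chain z η (n + 1)) (fun i => η (i + (n + 1)))
      ∈ S.laterSet z n η := add_mem_laterSet.2 (Nat.sInf_mem h)
  refine le_antisymm (Nat.sInf_le hmem) (le_csInf ⟨_, hmem⟩ fun k hk => ?_)
  obtain ⟨i, rfl⟩ := Nat.exists_eq_add_of_le (hS.lt_of_mem_laterSet hδ hk)
  exact Nat.add_le_add_left (Nat.sInf_le (add_mem_laterSet.1 hk)) _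

lemma sampleIdx_lt_succ (hδ : 0 < S.δ) {z : State m} {j : ℕ} {η : ℕ → Vec m}
    (h : η ∈ S.found z (j + 1)) : S.sampleIdx z η j < S.sampleIdx z η (j + 1) :=
  hS.lt_of_mem_laterSet hδ (Nat.sInf_mem (h j j.lt_succ_self))

lemma sampleIdx_mono (hδ : 0 < S.δ) {z : State m} {η : ℕ → Vec m} {i j : ℕ} (hij : i ≤ j)
    (h : η ∈ S.found z j) : S.sampleIdx z η i ≤ S.sampleIdx z η j := by
  induction j, hij using Nat.le_induction with
  | base => exact le_rfl
  | succ j _ ih => exact (ih (found_succ h)).trans (hS.sampleIdx_lt_succ hδ h).le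

/-- `N_0, …, N_j` depend on the noise before `N_j` only. -/
lemma sampleIdx_congr (hδ : 0 < S.δ) {z : State m} {N : ℕ} {η η' : ℕ → Vec m}
    (h : ∀ i < N, η i = η' i) {j : ℕ} (hf : η ∈ S.found z j) (hN : S.sampleIdx z η j ≤ N) :
    η' ∈ S.found z j ∧ S.sampleIdx z η' j = S.sampleIdx z η j := by
  induction j with
  | zero => exact ⟨fun i hi => absurd hi i.not_lt_zero, rfl⟩
  | succ j ih =>
    have hlt := hS.sampleIdx_lt_succ hδ hf
    obtain ⟨h1, h2⟩ := ih (found_succ hf) (hlt.le.trans hN)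
    have hle := hlt.le.trans hN
    have hmem : S.sampleIdx z η (j + 1) ∈ S.laterSet z (S.sampleIdx z η j) η :=
      Nat.sInf_mem (hf j j.lt_succ_self)
    have hmem' := (mem_laterSet_congr h hle hN).1 hmem
    constructor
    · intro i hi
      rcases Nat.lt_succ_iff_lt_or_eq.1 hi with hi | rfl
      · exact h1 i hi
      · rw [h2]; exact ⟨_, hmem'⟩
    · rw [sampleIdx_succ, h2]
      have hle' := Nat.sInf_le hmem'
      exact le_antisymm hle' (Nat.sInf_le
        ((mem_laterSet_congr h hle (hle'.trans hN)).2 (Nat.sInf_mem ⟨_, hmem'⟩)))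

/-- Agreement is needed up to index `n` included, because the sampled state is taken one step after
the sampling index. -/
lemma sampledTuple_congr (hδ : 0 < S.δ) {z : State m} {n : ℕ} {η η' : ℕ → Vec m}
    (h : ∀ i < n + 1, η i = η' i) {j : ℕ} (hf : η ∈ S.found z j) (hN : S.sampleIdx z η j = n) :
    S.sampledTuple z j η' = S.sampledTuple z j η := by
  ext1 i
  have hi : (i : ℕ) ≤ j := Nat.lt_succ_iff.1 i.2
  have hle : S.sampleIdx z η i ≤ n := (hS.sampleIdx_mono hδ hi hf).trans hN.le
  have hfi : η ∈ S.found z i := fun k hk => hf k (hk.trans_le hi)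
  have := (hS.sampleIdx_congr hδ h hfi (hle.trans n.le_succ)).2
  rw [sampledTuple, sampledTuple, sampled, sampled, this]
  exact (S.chain_congr z fun k hk => h k (by omega)).symm

/-- From every index on, the time `δ` almost surely elapses. -/
lemma ae_nonempty_hitSet_chain (hδ : 5 * S.Δmax < S.δ) (z : State m) (n : ℕ) :
    ∀ᵐ η ∂(noise m), (S.hitSet (S.chain z η n) (S.stepSize (S.chain z η n).2)
      fun i => η (i + n)).Nonempty := by
  have hm : Measurable fun p : State m × (ℕ → Vec m) => (p.1, S.stepSize p.1.2, p.2) :=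
    measurable_fst.prodMk
      (((Measurable.of_discrete (f := S.stepSize)).comp measurable_fst.snd).prodMk measurable_snd)
  have hbad : MeasurableSet {p : State m × (ℕ → Vec m) |
      ¬ (S.hitSet p.1 (S.stepSize p.1.2) p.2).Nonempty} :=
    (hm hS.measurableSet_nonempty_hitSet).compl
  have hB := (measurable_one (α := ℝ≥0∞)).indicator hbad
  have h1 := lintegral_mul_chain_shift (n := n) (A := fun _ => 1) (B := fun w ξ =>
    Set.indicator {p : State m × (ℕ → Vec m) |
      ¬ (S.hitSet p.1 (S.stepSize p.1.2) p.2).Nonempty} 1 (w, ξ)) hS measurable_const hB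
    (fun _ _ => rfl) z
  have h2 : ∀ w : State m, ∫⁻ ξ, Set.indicator {p : State m × (ℕ → Vec m) |
      ¬ (S.hitSet p.1 (S.stepSize p.1.2) p.2).Nonempty} 1 (w, ξ) ∂(noise m) = (0 : ℝ≥0∞) := by
    intro w
    refine lintegral_eq_zero_of_ae_eq_zero ?_
    filter_upwards [hS.ae_nonempty_hitSet_stepSize hδ w] with ξ hξ
    exact Set.indicator_of_notMem (fun h => (show ¬ _ from h) hξ) _
  simp only [h2, one_mul, lintegral_zero] at h1
  have hsh : Measurable fun η : ℕ → Vec m => (S.chain z η n, fun i => η (i + n)) :=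
    (hS.measurable_chain_index measurable_const measurable_id measurable_const).prodMk
      (by fun_prop)
  have h3 := (lintegral_eq_zero_iff (hB.comp hsh)).1 h1
  filter_upwards [h3] with η hη
  by_contra hne
  have : (S.chain z η n, fun i => η (i + n)) ∈ {p : State m × (ℕ → Vec m) |
      ¬ (S.hitSet p.1 (S.stepSize p.1.2) p.2).Nonempty} := hne
  rw [Function.comp_apply, Set.indicator_of_mem this] at hη
  exact one_ne_zero hη

/-- The sampling indices are almost surely finite. -/
theorem ae_nonempty_laterSet (hδ : 5 * S.Δmax < S.δ) (z : State m) :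
    ∀ᵐ η ∂(noise m), ∀ n, (S.laterSet z n η).Nonempty := by
  refine ae_all_iff.2 fun n => ?_
  filter_upwards [hS.ae_nonempty_hitSet_chain hδ z (n + 1)] with η ⟨k, hk⟩
  exact ⟨_, add_mem_laterSet.2 hk⟩

lemma measurable_sampledTuple (z : State m) (j : ℕ) : Measurable (S.sampledTuple z j) :=
  measurable_pi_lambda _ fun i => hS.measurable_sampled z i

lemma measurableSet_found (z : State m) (j : ℕ) : MeasurableSet (S.found z j) := by
  have : S.found z j = ⋂ i, ⋂ _ : i < j, ⋃ k,
      {η | S.δ + S.time z η (S.sampleIdx z η i) ≤ S.time z η k} := by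
    ext η; simp [found, laterSet, Set.Nonempty]
  rw [this]
  refine MeasurableSet.iInter fun i => MeasurableSet.iInter fun _ => MeasurableSet.iUnion fun k => ?_
  exact measurableSet_le (measurable_const.add
    (hS.measurable_time_index measurable_const measurable_id (hS.measurable_sampleIdx z i)))
    (hS.measurable_time_index measurable_const measurable_id measurable_const)

/-- The Markov property of the sampled chain. -/
theorem lintegral_sampled_succ (hδ : 5 * S.Δmax < S.δ) (z : State m) (j : ℕ)
    {C : Set (Fin (j + 1) → State m)} (hC : MeasurableSet C) {φ : State m → ℝ≥0∞}
    (hφ : Measurable φ) :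
    ∫⁻ η in S.sampledTuple z j ⁻¹' C, φ (S.sampled z (j + 1) η) ∂(noise m)
      = ∫⁻ η in S.sampledTuple z j ⁻¹' C, ∫⁻ y, φ y ∂(hS.transitionKernel (S.sampled z j η))
        ∂(noise m) := by
  have hδ0 : 0 < S.δ := by have := hS.stepMax_pos; linarith
  have hCm := hS.measurable_sampledTuple z j hC
  set E : ℕ → Set (ℕ → Vec m) := fun n => {η | S.sampleIdx z η j = n} with hE
  have hEm : ∀ n, MeasurableSet (E n) := fun n =>
    hS.measurable_sampleIdx z j (measurableSet_singleton n)
  have hEd : Pairwise (Function.onFun Disjoint fun n => E n ∩ S.sampledTuple z j ⁻¹' C) := by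
    intro a b hab
    refine Set.disjoint_left.2 fun η h1 h2 => hab ?_
    exact (show S.sampleIdx z η j = a from h1.1).symm.trans h2.1
  have hU : S.sampledTuple z j ⁻¹' C = ⋃ n, E n ∩ S.sampledTuple z j ⁻¹' C := by
    rw [← Set.iUnion_inter]
    refine (Set.inter_eq_right.2 fun η _ => Set.mem_iUnion.2 ⟨S.sampleIdx z η j, ?_⟩).symm
    exact (rfl : S.sampleIdx z η j = _)
  rw [hU, lintegral_iUnion (fun n => (hEm n).inter hCm) hEd,
    lintegral_iUnion (fun n => (hEm n).inter hCm) hEd]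
  refine tsum_congr fun n => ?_
  -- On `found` the event that the sampling index equals `n` is decided by the noise up to index
  -- `n`. Without it a default index 0 would depend on the whole future; the difference is a null
  -- set.
  set D : Set (ℕ → Vec m) := S.found z j ∩ (E n ∩ S.sampledTuple z j ⁻¹' C) with hD
  have hDm : MeasurableSet D := (hS.measurableSet_found z j).inter ((hEm n).inter hCm)
  have hae : (E n ∩ S.sampledTuple z j ⁻¹' C : Set (ℕ → Vec m)) =ᵐ[noise m] D := by
    filter_upwards [hS.ae_nonempty_laterSet hδ z] with η hη
    refine propext ⟨fun h => ⟨fun i _ => hη _, h⟩, fun h => h.2⟩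
  have hcongr : ∀ {η η' : ℕ → Vec m}, (∀ i < n + 1, η i = η' i) → η ∈ D → η' ∈ D := by
    rintro η η' h ⟨hf, hn, hc⟩
    have hn' : S.sampleIdx z η j = n := hn
    have h1 := hS.sampleIdx_congr hδ0 h hf (hn'.le.trans n.le_succ)
    refine ⟨h1.1, h1.2.trans hn', ?_⟩
    rw [Set.mem_preimage, hS.sampledTuple_congr hδ0 h hf hn']
    exact hc
  have hA : ∀ ζ ξ, D.indicator (1 : (ℕ → Vec m) → ℝ≥0∞) (concat (n + 1) ζ ξ)
      = D.indicator 1 ζ := by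
    intro ζ ξ
    have hag : ∀ i < n + 1, concat (n + 1) ζ ξ i = ζ i := fun i hi => concat_of_lt hi ζ ξ
    by_cases h : ζ ∈ D
    · rw [Set.indicator_of_mem h, Set.indicator_of_mem (hcongr (fun i hi => (hag i hi).symm) h)]
      rfl
    · rw [Set.indicator_of_notMem h, Set.indicator_of_notMem fun h' => h (hcongr hag h')]
  have key := lintegral_mul_chain_shift (n := n + 1) hS (measurable_one.indicator hDm)
    (B := fun w ξ => φ (S.chain w ξ (S.wait w ξ + 1))) (hφ.comp hS.measurable_transition_map) hA z
  rw [setLIntegral_congr hae, setLIntegral_congr hae, ← lintegral_indicator hDm,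
    ← lintegral_indicator hDm]
  refine (lintegral_congr_ae ?_).trans (key.trans (lintegral_congr fun η => ?_))
  · filter_upwards [hS.ae_nonempty_hitSet_chain hδ z (n + 1)] with η hη
    by_cases h : η ∈ D
    · have hn : S.sampleIdx z η j = n := h.2.1
      rw [Set.indicator_of_mem h, Set.indicator_of_mem h, Pi.one_apply, one_mul, sampled,
        sampleIdx_succ, hn, hS.sInf_laterSet hδ0 hη, add_assoc (n + 1), chain_add]
    · rw [Set.indicator_of_notMem h, Set.indicator_of_notMem h, zero_mul]
  · by_cases h : η ∈ D
    · have hn : S.sampleIdx z η j = n := h.2.1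
      rw [Set.indicator_of_mem h, Set.indicator_of_mem h, Pi.one_apply, one_mul,
        hS.lintegral_transitionKernel hφ, sampled, hn]
    · rw [Set.indicator_of_notMem h, Set.indicator_of_notMem h, zero_mul]

theorem condExp_sampled_succ (hδ : 5 * S.Δmax < S.δ) (z : State m) (j : ℕ) {A : Set (State m)}
    (hA : MeasurableSet A) :
    (noise m)[fun η => A.indicator (fun _ => (1 : ℝ)) (S.sampled z (j + 1) η) | S.past z j]
      =ᵐ[noise m] fun η => (hS.transitionKernel (S.sampled z j η)).real A := by
  have hle : S.past z j ≤ MeasurableSpace.pi :=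
    iSup_le fun i => (hS.measurable_sampled z i).comap_le
  have hYm := hS.measurable_sampled z j
  have hym := hS.measurable_sampled z (j + 1)
  have hP : Measurable fun w => hS.transitionKernel w A :=
    Kernel.measurable_coe hS.transitionKernel hA
  have hf : Integrable (fun η => A.indicator (fun _ => (1 : ℝ)) (S.sampled z (j + 1) η))
      (noise m) := (integrable_const (1 : ℝ)).indicator (hym hA)
  have hg : Integrable (fun η => (hS.transitionKernel (S.sampled z j η)).real A) (noise m) := by
    refine Integrable.of_bound (hP.ennreal_toReal.comp hYm).aestronglyMeasurable 1
      (Eventually.of_forall fun η => ?_)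
    rw [Real.norm_of_nonneg measureReal_nonneg]
    exact measureReal_le_one
  refine (ae_eq_condExp_of_forall_setIntegral_eq hle hf (fun _ _ _ => hg.integrableOn) ?_ ?_).symm
  · intro s hs _
    rw [past_eq_comap] at hs
    obtain ⟨C, hC, rfl⟩ := hs
    have h := hS.lintegral_sampled_succ hδ z j hC (φ := A.indicator 1) (measurable_one.indicator hA)
    simp only [lintegral_indicator_one hA] at h
    have h1 : ∀ η, A.indicator (fun _ => (1 : ℝ)) (S.sampled z (j + 1) η)
        = (A.indicator (1 : State m → ℝ≥0∞) (S.sampled z (j + 1) η)).toReal := by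
      intro η
      by_cases hη : S.sampled z (j + 1) η ∈ A
      · simp [hη]
      · simp [hη]
    simp only [h1, measureReal_def]
    have h2 : Measurable fun η => hS.transitionKernel (S.sampled z j η) A := hP.comp hYm
    have h3 : Measurable fun η => A.indicator (1 : State m → ℝ≥0∞) (S.sampled z (j + 1) η) :=
      (measurable_one.indicator hA).comp hym
    rw [integral_toReal h2.aemeasurable (Eventually.of_forall fun η => measure_lt_top _ _),
      integral_toReal h3.aemeasurable (Eventually.of_forall fun η =>
        (Set.indicator_le_self A 1 _).trans_lt ENNReal.one_lt_top), ← h]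
  · have h1 : Measurable[S.past z j] (S.sampled z j) :=
      Measurable.of_comap_le (le_iSup (fun i : Fin (j + 1) =>
        MeasurableSpace.comap (S.sampled z i) inferInstance) (Fin.last j))
    exact (hP.ennreal_toReal.comp h1).stronglyMeasurable.aestronglyMeasurable

lemma map_sampled_zero (z : State m) :
    (noise m).map (S.sampled z 0) = (stdGaussian (Vec m)).map (S.step z) := by
  have h : (noise m).map (fun ζ => ζ 0) = stdGaussian (Vec m) := Measure.infinitePi_map_eval _ 0
  rw [← h, Measure.map_map (hS.measurable_step_right z) (measurable_pi_apply 0)]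
  rfl

/-- The law of the sampled chain. -/
theorem map_sampled (hδ : 5 * S.Δmax < S.δ) (z : State m) (n : ℕ) :
    (noise m).map (S.sampled z n)
      = ((stdGaussian (Vec m)).map (S.step z)).bind (hS.transitionKernel ^ n) := by
  induction n with
  | zero =>
    rw [hS.map_sampled_zero, pow_zero]
    exact Measure.bind_dirac.symm
  | succ n ih =>
    have h : (noise m).map (S.sampled z (n + 1))
        = ((noise m).map (S.sampled z n)).bind hS.transitionKernel := by
      refine Measure.ext_of_lintegral _ fun φ hφ => ?_
      have h1 := hS.lintegral_sampled_succ hδ z n .univ hφ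
      rw [Set.preimage_univ, Measure.restrict_univ] at h1
      rw [Measure.lintegral_bind hS.transitionKernel.aemeasurable hφ.aemeasurable,
        lintegral_map hφ (hS.measurable_sampled z _), h1,
        lintegral_map (hφ.lintegral_kernel) (hS.measurable_sampled z _)]
    rw [h, ih, Measure.comp_assoc, pow_succ']
    rfl

end Admissible

end Scheme

end AdaptiveEM

end

/-! ### Averaging over the first step, and conclusion -/

noncomputable section

/-- Averages a pointwise ergodic bound over a random start. The companion bound for `|φ|` is what
yields integrability under the averaged law. -/
lemma integrable_bind_and_abs_integral_sub_le {X : Type*} [MeasurableSpace X] {ρ : Measure X}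
    [IsProbabilityMeasure ρ] {κ : Kernel X X} [IsMarkovKernel κ] {V φ : X → ℝ} {b c C : ℝ}
    (hV : Integrable V ρ) (hφ : Measurable φ) (hint : ∀ x, Integrable φ (κ x))
    (habs : ∀ x, |(∫ y, |φ y| ∂(κ x)) - b| ≤ C * (1 + V x))
    (hle : ∀ x, |(∫ y, φ y ∂(κ x)) - c| ≤ C * (1 + V x)) :
    Integrable φ (ρ.bind κ) ∧ |(∫ y, φ y ∂(ρ.bind κ)) - c| ≤ C * (1 + ∫ x, V x ∂ρ) := by
  have hV1 : Integrable (fun x => C * (1 + V x)) ρ := ((integrable_const 1).add hV).const_mul C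
  have hsm : ∀ ψ : X → ℝ, Measurable ψ →
      AEStronglyMeasurable (fun x => ∫ y, ψ y ∂(κ x)) ρ := fun ψ hψ =>
    (StronglyMeasurable.integral_kernel hψ.stronglyMeasurable).aestronglyMeasurable
  have hb : Integrable φ (ρ.bind κ) := by
    rw [Measure.integrable_comp_iff hφ.aestronglyMeasurable]
    refine ⟨Filter.Eventually.of_forall hint, ((integrable_const b).add hV1).mono'
      (hsm _ hφ.norm) (Filter.Eventually.of_forall fun x => ?_)⟩
    rw [Real.norm_of_nonneg (integral_nonneg fun _ => norm_nonneg _)]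
    have := (abs_le.1 (habs x)).2
    simp only [Real.norm_eq_abs, Pi.add_apply]
    linarith
  have hd : Integrable (fun x => (∫ y, φ y ∂(κ x)) - c) ρ :=
    hV1.mono' ((hsm φ hφ).sub aestronglyMeasurable_const) (Filter.Eventually.of_forall hle)
  have h1 : (∫ y, φ y ∂(ρ.bind κ)) - c = ∫ x, ((∫ y, φ y ∂(κ x)) - c) ∂ρ := by
    have h2 : Integrable (fun x => ∫ y, φ y ∂(κ x)) ρ := by
      exact (hd.add (integrable_const c)).congr (Filter.Eventually.of_forall fun x => by simp)
    rw [integral_bind_kernel hb, integral_sub h2 (integrable_const _)]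
    simp
  have h3 : ∫ x, C * (1 + V x) ∂ρ = C * (1 + ∫ x, V x ∂ρ) := by
    rw [integral_const_mul, integral_add (integrable_const _) hV]
    simp
  refine ⟨hb, ?_⟩
  rw [h1, ← h3]
  exact norm_integral_le_of_norm_le (f := fun x => (∫ y, φ y ∂(κ x)) - c) hV1
    (Filter.Eventually.of_forall hle)

namespace AdaptiveEM

namespace Scheme

open scoped ENNReal
open Filter

variable {m : ℕ} {S : Scheme m}

namespace Admissible

variable (hS : S.Admissible)
include hS

lemma lintegral_norm_sq_transitionKernel_le (hδ : 5 * S.Δmax < S.δ) :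
    ∃ a b : ℝ, 0 ≤ a ∧ a < 1 ∧ 0 ≤ b ∧ ∀ w : State m,
      ∫⁻ y, ENNReal.ofReal (‖y.1‖ ^ 2) ∂(hS.transitionKernel w)
        ≤ ENNReal.ofReal (a * ‖w.1‖ ^ 2 + b) := by
  obtain ⟨a, b, ha, ha1, hb, h⟩ := hS.exists_drift (by have := hS.stepMax_pos; linarith)
  refine ⟨a, b, ha, ha1, hb, fun w => ?_⟩
  rw [hS.lintegral_transitionKernel_eq_reach hδ
    (measurable_fst.norm.pow_const 2).ennreal_ofReal]
  exact h w

lemma exists_le_transitionKernel (hδ : 5 * S.Δmax < S.δ) (R : ℝ) :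
    ∃ ν : Measure (State m), ν Set.univ ≠ 0 ∧
      ∀ w : State m, ‖w.1‖ ^ 2 ≤ R → ν ≤ hS.transitionKernel w := by
  obtain ⟨ν, hν, h⟩ := hS.exists_minorization hδ √R
  refine ⟨ν, hν, fun w hw => Measure.le_iff.2 fun A hA => ?_⟩
  have h1 := hS.lintegral_transitionKernel_eq_reach hδ (φ := A.indicator fun _ => 1)
    (measurable_const.indicator hA) w
  rw [show (A.indicator fun _ => (1 : ℝ≥0∞)) = A.indicator 1 from rfl,
    lintegral_indicator_one hA] at h1
  rw [h1]
  have hp := hS.stepSize_pos w.2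
  exact h w (Real.le_sqrt_of_sq_le hw) _ hp.le (by linarith) A hA

/-- A scheme started at `(x_0, k_{-1})` makes one ordinary step before the sampled chain begins;
this bounds its effect on the second moment. -/
lemma exists_integral_norm_sq_step_le : ∃ c : ℝ, 0 ≤ c ∧ ∀ w : State m,
    Integrable (fun y : State m => ‖y.1‖ ^ 2) ((stdGaussian (Vec m)).map (S.step w)) ∧
      ∫ y, ‖y.1‖ ^ 2 ∂((stdGaussian (Vec m)).map (S.step w)) ≤ ‖w.1‖ ^ 2 + c := by
  obtain ⟨γ, c, hγ, hc, h⟩ := hS.exists_lintegral_step_le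
  have hD := hS.stepMax_pos
  have hm : Measurable fun y : State m => ‖y.1‖ ^ 2 := measurable_fst.norm.pow_const 2
  refine ⟨c * S.Δmax, by positivity, fun w => integrable_and_integral_le hm (fun _ => by positivity)
    (by positivity) ?_⟩
  rw [lintegral_map hm.ennreal_ofReal (hS.measurable_step_right w)]
  have h1 := h w 1 0 zero_le_one le_rfl
  simp only [one_mul, add_zero] at h1
  refine h1.trans (ENNReal.ofReal_le_ofReal ?_)
  have hp := hS.stepSize_pos (S.level w.1 w.2)
  refine (div_le_self (by positivity) (le_add_of_nonneg_right (by positivity))).trans ?_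
  have := mul_le_mul_of_nonneg_left (hS.stepSize_le (S.level w.1 w.2)) hc
  linarith

end Admissible

end Scheme

end AdaptiveEM

end

theorem theorem3 (m : ℕ) (S : AdaptiveEM.Scheme m) (hS : S.Admissible)
    (hδ : 5 * S.Δmax < S.δ) :
    -- the sampling times are almost surely finite
    (∀ z : AdaptiveEM.State m, ∀ᵐ η ∂(AdaptiveEM.Scheme.noise m), ∀ j : ℕ,
      {n : ℕ | S.δ + S.time z η (S.sampleIdx z η j) ≤ S.time z η n}.Nonempty) ∧
    ∃ P : Kernel (AdaptiveEM.State m) (AdaptiveEM.State m),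
      (∀ w, P w = S.transition w) ∧ IsMarkovKernel P ∧
      -- from every start, the sampled sequence is a Markov chain with transition kernel `P`
      (∀ (z : AdaptiveEM.State m) (j : ℕ) (A : Set (AdaptiveEM.State m)), MeasurableSet A →
        (AdaptiveEM.Scheme.noise m)[
            fun η => A.indicator (fun _ => (1 : ℝ)) (S.sampled z (j + 1) η) | S.past z j]
          =ᵐ[AdaptiveEM.Scheme.noise m] fun η => (P (S.sampled z j η)).real A) ∧
      -- unique invariant probability measure
      ∃ π : Measure (AdaptiveEM.State m),
        (IsProbabilityMeasure π ∧ Kernel.Invariant P π) ∧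
        (∀ π' : Measure (AdaptiveEM.State m),
          IsProbabilityMeasure π' → Kernel.Invariant P π' → π' = π) ∧
        -- geometric ergodicity
        ∀ h : AdaptiveEM.State m → ℝ, Measurable h →
          (∀ w : AdaptiveEM.State m, |h w| ≤ 1 + ‖w.1‖ ^ 2) →
          Integrable h π ∧
          ∃ lam κ : ℝ, 0 < lam ∧ lam < 1 ∧ 0 < κ ∧
            ∀ (y : AdaptiveEM.Vec m) (l n : ℕ),
              -- the sampled chain started at `(y_0, l_0) = (y, l)`
              (Integrable h ((P ^ n) (y, l)) ∧
                |(∫ w, h w ∂((P ^ n) (y, l))) - ∫ w, h w ∂π|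
                  ≤ κ * lam ^ n * (1 + ‖y‖ ^ 2)) ∧
              -- the sampled chain of the scheme started at `(x_0, k_{-1}) = (y, l)`
              (Integrable (fun η => h (S.sampled (y, l) n η)) (AdaptiveEM.Scheme.noise m) ∧
                |(∫ η, h (S.sampled (y, l) n η) ∂(AdaptiveEM.Scheme.noise m))
                    - ∫ w, h w ∂π|
                  ≤ κ * lam ^ n * (1 + ‖y‖ ^ 2)) := by
  have := hS.isMarkovKernel_transitionKernel
  set P := hS.transitionKernel with hP
  refine ⟨fun z => ?_, P, hS.transitionKernel_apply, this,
    fun z j A hA => hS.condExp_sampled_succ hδ z j hA, ?_⟩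
  · filter_upwards [hS.ae_nonempty_laterSet hδ z] with η hη j using hη _
  obtain ⟨a, b, ha, ha1, hb, hdrift⟩ := hS.lintegral_norm_sq_transitionKernel_le hδ
  have hVm : Measurable fun w : AdaptiveEM.State m => ‖w.1‖ ^ 2 := measurable_fst.norm.pow_const 2
  obtain ⟨π, hπ, huniq, hVπ, lam, κ, hlam0, hlam1, hκ, herg⟩ :=
    harris (P := P) hVm (fun _ => by positivity) ha ha1 hb hdrift
      (hS.exists_le_transitionKernel hδ)
  obtain ⟨c, hc, hstep⟩ := hS.exists_integral_norm_sq_step_le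
  have := hπ.1
  -- The factor `1 + c` pays for that first step, so that one constant serves both kinds of start.
  refine ⟨π, hπ, huniq, fun h hm hh => ⟨?_, lam, κ * (1 + c), hlam0, hlam1, by positivity,
    fun y l n => ⟨?_, ?_⟩⟩⟩
  · exact ((integrable_const (1 : ℝ)).add hVπ).mono' hm.aestronglyMeasurable
      (Filter.Eventually.of_forall hh)
  · obtain ⟨h1, h2⟩ := herg h hm hh (y, l) n
    refine ⟨h1, h2.trans ?_⟩
    have h3 : κ * lam ^ n ≤ κ * (1 + c) * lam ^ n :=
      mul_le_mul_of_nonneg_right (le_mul_of_one_le_right hκ.le (by linarith)) (by positivity)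
    exact mul_le_mul_of_nonneg_right h3 (by positivity)
  · obtain ⟨hi, hle⟩ := hstep (y, l)
    set ρ := (stdGaussian (AdaptiveEM.Vec m)).map (S.step (y, l)) with hρ
    have hρp : IsProbabilityMeasure ρ :=
      Measure.isProbabilityMeasure_map (hS.measurable_step_right _).aemeasurable
    have habs := herg (fun w => |h w|) hm.norm fun w => by rw [abs_abs]; exact hh w
    obtain ⟨h1, h2⟩ := integrable_bind_and_abs_integral_sub_le (κ := P ^ n) hi hm
      (fun w => (herg h hm hh w n).1) (fun w => (habs w n).2) fun w => (herg h hm hh w n).2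
    have hsm := (hS.measurable_sampled (y, l) n).aemeasurable (μ := AdaptiveEM.Scheme.noise m)
    rw [← hS.map_sampled hδ (y, l) n] at h1 h2
    rw [integral_map hsm hm.aestronglyMeasurable] at h2
    refine ⟨h1.comp_aemeasurable hsm, h2.trans ?_⟩
    have h3 : 1 + ∫ w, ‖w.1‖ ^ 2 ∂ρ ≤ (1 + c) * (1 + ‖y‖ ^ 2) := by
      have : 0 ≤ c * ‖y‖ ^ 2 := by positivity
      change _ ≤ ‖y‖ ^ 2 + c at hle
      linarith
    calc _ ≤ κ * lam ^ n * ((1 + c) * (1 + ‖y‖ ^ 2)) :=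
          mul_le_mul_of_nonneg_left h3 (by positivity)
      _ = κ * (1 + c) * lam ^ n * (1 + ‖y‖ ^ 2) := by ring
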